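/- Setting. Let $\mathbb M$ be Minkowski space, signature $(+,-,-,-)$. For $\zeta\in\mathbb C$, $P=1+\zeta\bar\zeta$, put $\hat l^a=\frac{\sqrt2}{2P}(1+\zeta\bar\zeta,\ \zeta+\bar\zeta,\ i\bar\zeta-i\zeta,\ -1+\zeta\bar\zeta)$, $\hat n^a=\frac{\sqrt2}{2P}(1+\zeta\bar\zeta,\ -\zeta-\bar\zeta,\ i\zeta-i\bar\zeta,\ 1-\zeta\bar\zeta)$, $\hat m^a=\frac{\sqrt2}{2P}(0,\ 1-\bar\zeta^2,\ -i(1+\bar\zeta^2),\ 2\bar\zeta)$. Bondi coordinates are $x^a=u_B(\hat l^a+\hat n^a)+r\hat l^a$, with $u_{\rm ret}=\sqrt2\,u_B$; the Bondi tetrad is $l=\hat l$, $n=\hat n$, $m=-\hat m$ (that is, $m=-\frac Pr\partial_\zeta$). Put $Y^1_{1i}=-\hat m^i$, $Y^0_{1i}=\hat l^i-\hat n^i$, $Y^{-1}_{1i}=\overline{Y^1_{1i}}$. A Maxwell field is *asymptotically vanishing* if it is a smooth real solution $F_{ab}$ of the source-free Maxwell equations near future null infinity whose components $\phi_0=F(l,m)$,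 $\phi_1=\frac12(F(l,n)+F(\bar m,m))$, $\phi_2=F(\bar m,n)$ satisfy $\phi_k=\phi_k^0\,r^{k-3}+O(r^{k-4})$, uniformly over the sphere and over bounded $u_B$-intervals. It has *charge* $q$ if the $l=0$ part of $\phi_1^0$ is $q$. Its *Bondi dipole* is $D^i_{\mathbb C}=q\eta^i=\frac12\phi^0_{0i}$, where $\phi^0_{0i}$ is the coefficient of $Y^1_{1i}$ in $\phi_0^0$ at constant $u_B$; $\eta^i$ is regarded as a function of $u_{\rm ret}$, and $'=d/du_{\rm ret}$. For a complex analytic world line $\xi^a(\tau)$ let $G(\tau,\zeta)=\xi^a(\tau)\hat l_a$ and $L=\xi^a(\tau)\hat m_a$. Let $\lambda=\Lambda(s,\zeta)$ be the small real solution of $\operatorname{Im}G(s+i\lambda,\zeta)=0$. The *null-rotated complex dipole* $D^{*i}(s)$ is half the coefficient of $Y^1_{1i}$ in $$\phi_0^{*0}=\phi_0^0-2L\phi_1^0+L^2\phi_2^0,$$ where $L$ is taken at $\tau=s+i\Lambda(s,\zeta)$ and $\phi_k^0$ at $u_B=\operatorname{Re}G(s+i\Lambda(s,\zeta),\zeta)$,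 the coefficient being extracted at constant $s$. Orders. Consider families depending on a parameter $\varepsilon\to0^+$; "of order $k$" means $O(\varepsilon^k)$ uniformly on compact sets (for fields: uniformly over the sphere for bounded $u_B$). Let asymptotically vanishing Maxwell fields be given, all with the same real charge $q\ne0$, whose $\phi_k^0$ ($k=0,1,2$) have smooth-in-time $l=1$ coefficients of first order and smooth-in-time $l\ge2$ parts of second order, together with all their time derivatives. A *slow world line* is a family $\xi^a$ analytic on a fixed open neighbourhood $U$ of the real axis with $\xi^i$ and $\xi^0-\tau$ of first order on $U$, and $\operatorname{Re}\xi^0(s)-s$ of second order for real $s$. Write $\xi^0_I(s)=\operatorname{Im}\xi^0(s)$. Theorem. (1) For every slow world line: the real solution $\Lambda$ exists, and any two such solutions (uniformly small on bounded $s$-intervals) agree on every bounded $s$-interval for all sufficiently small $\varepsilon$. The dipole $D^{*k}(s)$ vanishes up to second-order terms (for $k=1,2,3$, locally uniformly in $s\in\mathbb R$) if and only if, for $k=1,2,3$, $$q\xi^k(s)=q\eta^k(s)+O(\varepsilon^2),$$ and it vanishes up to third-order terms if and only if, for $k=1,2,3$, $$\xi^k(s)=\eta^k(s)+i\,\xi_I^0(s)\,\eta^{k\prime}(s)-\tfrac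 i2\,\epsilon_{ijk}\,\eta^i(s)\,\eta^{j\prime}(s)+O(\varepsilon^3).$$ (2) Suppose a slow world line $\xi_0^a$ on $U$ is given, and $\eta^i$ extends to a family analytic and of first order on the same $U$. Then there is a slow world line (on some open neighbourhood $V$ of the real axis) with the same time component as $\xi_0^a$ on the real axis for which the null-rotated complex dipole vanishes up to third-order terms. -/

import Mathlib

open Filter Topology MeasureTheory
open scoped ContDiff

noncomputable section

namespace MaxwellCenter

/-! ### Minkowski space and vacuum Maxwell fields -/

/-- Points of Minkowski space, in inertial coordinates `(t, x, y, z)`. -/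
abbrev Minkowski := Fin 4 → ℝ

/-- The diagonal entries of the Minkowski metric, signature `(+,-,-,-)`. -/
def metricSign (a : Fin 4) : ℝ := if a = 0 then 1 else -1

/-- The Minkowski product `v^a w_a`, extended complex-bilinearly. -/
def mdot (v w : Fin 4 → ℂ) : ℂ := ∑ a, (metricSign a : ℂ) * v a * w a

/-- Partial derivative along the `a`-th inertial coordinate. -/
def pd (a : Fin 4) (f : Minkowski → ℝ) (x : Minkowski) : ℝ := fderiv ℝ f x (Pi.single a 1)

/-- `F_{ab}` is a real, smooth solution of the source-free Maxwell equations
`∂_[a F_bc] = 0`, `∂^a F_ab = 0` on the open set `D`. -/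
structure IsVacuumMaxwell (F : Minkowski → Fin 4 → Fin 4 → ℝ) (D : Set Minkowski) : Prop where
  isOpen : IsOpen D
  smooth : ∀ a b, ContDiffOn ℝ ∞ (fun x => F x a b) D
  antisymm : ∀ x ∈ D, ∀ a b, F x a b = -F x b a
  closed : ∀ x ∈ D, ∀ a b c,
    pd a (fun y => F y b c) x + pd b (fun y => F y c a) x + pd c (fun y => F y a b) x = 0
  divergence : ∀ x ∈ D, ∀ b, ∑ a, metricSign a * pd a (fun y => F y a b) x = 0

/-- Euclidean distance from the spatial origin. -/
def spatialRadius (x : Minkowski) : ℝ := √(x 1 ^ 2 + x 2 ^ 2 + x 3 ^ 2)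

/-- `D` contains a neighbourhood of future null infinity: for retarded times `t - |x|` in a bounded
interval, all points that are far enough out. -/
def ContainsNearScri (D : Set Minkowski) : Prop :=
  ∀ A B : ℝ, ∃ R : ℝ, ∀ x : Minkowski,
    A ≤ x 0 - spatialRadius x → x 0 - spatialRadius x ≤ B → R ≤ spatialRadius x → x ∈ D

/-! ### Null tetrad and Bondi coordinates, in the stereographic coordinate `ζ` -/

/-- `P = 1 + ζ ζ̄`. -/
def sphereP (ζ : ℂ) : ℝ := 1 + ‖ζ‖ ^ 2

/-- The null vector `l̂^a(ζ, ζ̄)` (its components are real). -/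
def lHat (ζ : ℂ) (a : Fin 4) : ℂ :=
  (√2 / (2 * sphereP ζ) : ℝ) *
    (![1 + ζ * star ζ, ζ + star ζ, Complex.I * star ζ - Complex.I * ζ, -1 + ζ * star ζ] a)

/-- The null vector `n̂^a(ζ, ζ̄)` (its components are real). -/
def nHat (ζ : ℂ) (a : Fin 4) : ℂ :=
  (√2 / (2 * sphereP ζ) : ℝ) *
    (![1 + ζ * star ζ, -(ζ + star ζ), Complex.I * ζ - Complex.I * star ζ, 1 - ζ * star ζ] a)

/-- The complex null vector `m̂^a(ζ, ζ̄)`. -/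
def mHat (ζ : ℂ) (a : Fin 4) : ℂ :=
  (√2 / (2 * sphereP ζ) : ℝ) *
    (![0, 1 - star ζ ^ 2, -Complex.I * (1 + star ζ ^ 2), 2 * star ζ] a)

/-- The point with Bondi coordinates `(u_B, r, ζ)`: `x^a = u_B (l̂^a + n̂^a) + r l̂^a`. In particular
`t - |x| = √2 u_B` is the retarded time, for `r ≥ 0`. -/
def bondiPoint (u r : ℝ) (ζ : ℂ) : Minkowski :=
  fun a => (u * (lHat ζ a + nHat ζ a) + r * lHat ζ a).re

/-- The vector `m^a` of the Bondi tetrad `(l, n, m, m̄)`. The Bondi tetrad has `l = ∂_r`,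
`n = ∂_{u_B} - ∂_r`, `m = -(P / r) ∂_ζ` in the coordinates `bondiPoint`, that is `l^a = l̂^a`,
`n^a = n̂^a` and `m^a = -m̂^a`. -/
def bondiM (ζ : ℂ) (a : Fin 4) : ℂ := -mHat ζ a

/-- Contraction `F_{ab} v^a w^b` at a point. -/
def contract (F : Fin 4 → Fin 4 → ℝ) (v w : Fin 4 → ℂ) : ℂ := ∑ a, ∑ b, (F a b : ℂ) * v a * w b

/-- The tetrad components `φ_0 = F(l, m)`, `φ_1 = (F(l, n) + F(m̄, m)) / 2`, `φ_2 = F(m̄, n)` of a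
two-form with respect to a null tetrad `(l, n, m, m̄)`. -/
def tetradPhi (F : Fin 4 → Fin 4 → ℝ) (l n m mbar : Fin 4 → ℂ) : Fin 3 → ℂ :=
  ![contract F l m, (contract F l n + contract F mbar m) / 2, contract F mbar n]

/-- The components `(φ_0, φ_1, φ_2)` of a Maxwell field in the Bondi tetrad, at the point with Bondi
coordinates `(u_B, r, ζ)`. -/
def npPhi (F : Minkowski → Fin 4 → Fin 4 → ℝ) (k : Fin 3) (u r : ℝ) (ζ : ℂ) : ℂ :=
  tetradPhi (F (bondiPoint u r ζ)) (lHat ζ) (nHat ζ) (bondiM ζ) (fun a => star (bondiM ζ a)) k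

/-- Under a null rotation about `n`, `l ↦ l + b m̄ + b̄ m + b b̄ n`, `m ↦ m + b n`, `n ↦ n`, the
component `φ_0` becomes `φ_0 + 2 b φ_1 + b² φ_2`. -/
theorem tetradPhi_nullRotation (F : Fin 4 → Fin 4 → ℝ) (hF : ∀ a b, F a b = -F b a)
    (l n m mbar : Fin 4 → ℂ) (b : ℂ) :
    tetradPhi F (fun a => l a + b * mbar a + star b * m a + b * star b * n a) n
        (fun a => m a + b * n a) (fun a => mbar a + star b * n a) 0
      = tetradPhi F l n m mbar 0 + 2 * b * tetradPhi F l n m mbar 1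
        + b ^ 2 * tetradPhi F l n m mbar 2 := by
  have h00 : F 0 0 = 0 := by linarith [hF 0 0]
  have h11 : F 1 1 = 0 := by linarith [hF 1 1]
  have h22 : F 2 2 = 0 := by linarith [hF 2 2]
  have h33 : F 3 3 = 0 := by linarith [hF 3 3]
  simp only [tetradPhi, contract, Fin.sum_univ_four, Matrix.cons_val_zero, Matrix.cons_val_one,
    Matrix.cons_val, hF 1 0, hF 2 0, hF 3 0, hF 2 1, hF 3 1, hF 3 2, h00, h11, h22, h33]
  push_cast
  ring

/-- Peeling: `φ_0 = φ_0^0 r⁻³ + O(r⁻⁴)`, `φ_1 = φ_1^0 r⁻² + O(r⁻³)`, `φ_2 = φ_2^0 r⁻¹ + O(r⁻²)`,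
uniformly over the sphere and over bounded intervals of `u_B`. The leading coefficients
`φ k = φ_k^0` are functions of `(u_B, ζ)`. -/
def Peels (F : Minkowski → Fin 4 → Fin 4 → ℝ) (φ : Fin 3 → ℝ → ℂ → ℂ) : Prop :=
  ∀ (k : Fin 3) (A B : ℝ), ∃ C : ℝ, ∃ r₀ > 0, ∀ u ∈ Set.Icc A B, ∀ r ≥ r₀, ∀ ζ : ℂ,
    ‖npPhi F k u r ζ - φ k u ζ / (r : ℂ) ^ (3 - (k : ℕ))‖ ≤ C / r ^ (4 - (k : ℕ))

/-- `F` is an asymptotically vanishing Maxwell field: it satisfies the vacuum Maxwell equations near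
future null infinity and peels, with leading coefficients `φ_k^0 = φ k`. -/
def IsAsymptoticallyVanishing (F : Minkowski → Fin 4 → Fin 4 → ℝ) (φ : Fin 3 → ℝ → ℂ → ℂ) : Prop :=
  (∃ D, ContainsNearScri D ∧ IsVacuumMaxwell F D) ∧ Peels F φ

/-! ### Harmonics and multipoles -/

/-- Integral over the unit sphere, with `dS = 4 P⁻² dx dy` for `ζ = x + i y`. -/
def sphereIntegral (f : ℂ → ℂ) : ℂ := ∫ ζ : ℂ, f ζ * ((4 / sphereP ζ ^ 2 : ℝ) : ℂ)

/-- The `l = 0` harmonic component of a function on the sphere. -/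
def monopole (f : ℂ → ℂ) : ℂ := sphereIntegral f / (4 * Real.pi)

/-- The tensorial `l = 1` harmonics `Y_{1i}^s` with spin weight `s = 1 - k`, as for `φ_k`:
`Y_{1i}^1 = m_i = -m̂^i`, `Y_{1i}^0 = -(l_i - n_i) = l̂^i - n̂^i`, `Y_{1i}^{-1} = m̄_i`. -/
def Y1 (k : Fin 3) (i : Fin 3) (ζ : ℂ) : ℂ :=
  ![-mHat ζ i.succ, lHat ζ i.succ - nHat ζ i.succ, star (-mHat ζ i.succ)] k

/-- The coefficient of `Y_{1i}^s`, `s = 1 - k`, in the harmonic expansion of a spin-`s` function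
(the harmonics `Y_{1i}^s`, `i = 1, 2, 3`, are orthogonal to one another). -/
def coeff1 (k : Fin 3) (f : ℂ → ℂ) (i : Fin 3) : ℂ :=
  sphereIntegral (fun ζ => f ζ * star (Y1 k i ζ)) /
    sphereIntegral (fun ζ => Y1 k i ζ * star (Y1 k i ζ))

/-- The `l ≥ 2` part of the spin-`(1 - k)` function `f` (an `l = 0` part exists only for spin `0`,
that is for `k = 1`). -/
def higherPart (k : Fin 3) (f : ℂ → ℂ) (ζ : ℂ) : ℂ :=
  f ζ - (if k = 1 then monopole f else 0) - ∑ i, coeff1 k f i * Y1 k i ζ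

/-- The complex center of charge `η^i` of the Bondi frame, as a function of the retarded time
`w = u_ret = √2 u_B`. The complex (electric and magnetic) dipole moment is
`D_ℂ^i = q η^i = φ_{0i}^0 / 2`. -/
def bondiCenter (q : ℝ) (φ : Fin 3 → ℝ → ℂ → ℂ) (w : ℝ) (i : Fin 3) : ℂ :=
  coeff1 0 (φ 0 (w / √2)) i / (2 * q)

/-- The derivative `η^i ′` with respect to the retarded time. -/
def bondiCenterDeriv (q : ℝ) (φ : Fin 3 → ℝ → ℂ → ℂ) (w : ℝ) (i : Fin 3) : ℂ :=
  deriv (fun v => bondiCenter q φ v i) w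

/-! ### Orders of smallness

All objects come in families with a parameter `ε > 0`; a quantity is of `k`-th order if it is
`O(ε^k)` as `ε → 0`, uniformly on compact sets. -/

/-- The family `f ε` of functions on `S` is of `k`-th order. -/
def IsOrder {α : Type} [TopologicalSpace α] (k : ℕ) (S : Set α) (f : ℝ → α → ℂ) : Prop :=
  ∀ K ⊆ S, IsCompact K → ∃ C : ℝ, ∀ᶠ ε in 𝓝[>] (0 : ℝ), ∀ x ∈ K, ‖f ε x‖ ≤ C * ε ^ k

/-- The family `f ε` of functions of `(u_B, ζ)` is of `k`-th order, uniformly over the sphere. -/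
def IsOrderOnScri (k : ℕ) (f : ℝ → ℝ → ℂ → ℂ) : Prop :=
  ∀ A B : ℝ, ∃ C : ℝ, ∀ᶠ ε in 𝓝[>] (0 : ℝ), ∀ u ∈ Set.Icc A B, ∀ ζ : ℂ, ‖f ε u ζ‖ ≤ C * ε ^ k

/-- Orders of the multipoles of a family of asymptotic Maxwell fields: the `l = 1` parts are of first
order and the `l ≥ 2` parts are of second order, together with their time derivatives. -/
structure MultipoleOrders (φ : ℝ → Fin 3 → ℝ → ℂ → ℂ) : Prop where
  dipole_smooth : ∀ ε > 0, ∀ k i, ContDiff ℝ ∞ (fun u => coeff1 k (φ ε k u) i)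
  dipole_order : ∀ k i (j : ℕ),
    IsOrder 1 Set.univ (fun ε => iteratedDeriv j (fun u => coeff1 k (φ ε k u) i))
  higher_smooth : ∀ ε > 0, ∀ k ζ, ContDiff ℝ ∞ (fun u => higherPart k (φ ε k u) ζ)
  higher_order : ∀ k (j : ℕ),
    IsOrderOnScri 2 (fun ε u ζ => iteratedDeriv j (fun v => higherPart k (φ ε k v) ζ) u)

/-! ### Complex world lines, good cuts and the rotated dipole -/

/-- A family of complex analytic world lines `ξ^a(τ)`, analytic on a neighbourhood `U` of the real
axis and close to the straight line `ξ^a = τ δ_0^a`: the deviations are of first order and, by the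
choice of the parameter `τ`, the real part `ξ_R^0` of the time component deviates from `τ` by a
second-order quantity only. -/
structure IsSlowWorldLine (U : Set ℂ) (ξ : ℝ → ℂ → Fin 4 → ℂ) : Prop where
  isOpen : IsOpen U
  real_mem : ∀ s : ℝ, (s : ℂ) ∈ U
  analytic : ∀ ε > 0, ∀ a, DifferentiableOn ℂ (fun τ => ξ ε τ a) U
  space_order : ∀ i : Fin 3, IsOrder 1 U (fun ε τ => ξ ε τ i.succ)
  time_order : IsOrder 1 U (fun ε τ => ξ ε τ 0 - τ)
  real_time_order : IsOrder 2 Set.univ (fun ε (s : ℝ) => (((ξ ε s 0).re - s : ℝ) : ℂ))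

/-- The good-cut function `G(τ, ζ) = ξ^a(τ) l̂_a(ζ)` of a complex world line. -/
def goodCut (z : ℂ → Fin 4 → ℂ) (τ ζ : ℂ) : ℂ := mdot (z τ) (lHat ζ)

/-- The stereographic angle field `L = ð_(τ) G = ξ^a(τ) m̂_a(ζ)`. -/
def angleField (z : ℂ → Fin 4 → ℂ) (τ ζ : ℂ) : ℂ := mdot (z τ) (mHat ζ)

/-- `λ = Λ ε s ζ` is the small real solution of `Im G(s + i λ, ζ) = 0`: the values
`τ = s + i Λ(s, ζ)` of the complex parameter give the real points `u_B = G(τ, ζ)` of the good cuts.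
Both conditions are required, for small `ε`, on every bounded interval of `s`. -/
structure IsRealSlicing (ξ : ℝ → ℂ → Fin 4 → ℂ) (Λ : ℝ → ℝ → ℂ → ℝ) : Prop where
  small : ∀ A B : ℝ, ∀ δ > 0, ∀ᶠ ε in 𝓝[>] (0 : ℝ), ∀ s ∈ Set.Icc A B, ∀ ζ, |Λ ε s ζ| < δ
  real_cut : ∀ A B : ℝ, ∀ᶠ ε in 𝓝[>] (0 : ℝ), ∀ s ∈ Set.Icc A B, ∀ ζ,
    (goodCut (ξ ε) (s + Complex.I * Λ ε s ζ) ζ).im = 0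

/-- The leading component `φ_0^{*0} = φ_0^0 - 2 L φ_1^0 + L² φ_2^0` of the Maxwell field in the tetrad
obtained by the null rotation about `n^a` with `b = -L / r`, where `L` is the angle field of the
world line `z`, evaluated at the point `ζ` of the real cut with label `s`: there `τ = s + i lam ζ` and
`u_B = G_R = Re G(τ, ζ)`. -/
def rotatedPhi0 (φ : Fin 3 → ℝ → ℂ → ℂ) (z : ℂ → Fin 4 → ℂ) (lam : ℂ → ℝ) (s : ℝ) (ζ : ℂ) : ℂ :=
  let τ : ℂ := s + Complex.I * lam ζ
  let u : ℝ := (goodCut z τ ζ).re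
  let L : ℂ := angleField z τ ζ
  φ 0 u ζ - 2 * L * φ 1 u ζ + L ^ 2 * φ 2 u ζ

/-- The null-rotated complex dipole: half the `l = 1` harmonic of `φ_0^{*0}`, extracted on the real
cut `s = const`. -/
def rotatedDipole (φ : Fin 3 → ℝ → ℂ → ℂ) (z : ℂ → Fin 4 → ℂ) (lam : ℂ → ℝ) (s : ℝ)
    (i : Fin 3) : ℂ :=
  coeff1 0 (rotatedPhi0 φ z lam s) i / 2

/-- The second-order expression
`η^k(s) + i ξ_I^0(s) η^k ′(s) - (i / 2) ε_{ijk} η^i(s) η^j ′(s)`. -/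
def secondOrderCenter (q : ℝ) (φ : Fin 3 → ℝ → ℂ → ℂ) (z : ℂ → Fin 4 → ℂ) (s : ℝ)
    (k : Fin 3) : ℂ :=
  bondiCenter q φ s k + Complex.I * ((z s 0).im : ℂ) * bondiCenterDeriv q φ s k
    - Complex.I / 2 * crossProduct (bondiCenter q φ s) (bondiCenterDeriv q φ s) k

end MaxwellCenter

end

namespace MaxwellCenter

/-! ### The unit sphere in the stereographic coordinate -/

/-! Write n for the unit vector with stereographic coordinate ζ. On the real cut with label s one
has Λ = -ξ_I^0 + ξ_I·n + O(ε²), u_ret = s - ξ_R·n + O(ε²) and ξ^i(s + iΛ) = ξ^i(s) + iΛ ξ^i'(s) +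
O(ε³); here analyticity supplies all derivative bounds through Cauchy's estimates. The l = 1 part of
the asymptotic Maxwell equation says that the dipole part of φ_1^0 is √2 q η^i'
(`IsAsymptoticallyVanishing.coeff1_one_eq_deriv`). Inserting all this in φ_0^{*0} leaves, up to
third order, only multiples of Y^1_{1i}, of n_j Y^1_{1i}, and the l ≥ 2 part of φ_0^0
(`rotatedPhi0_sub_order`). Since the l = 1 part of n_j Y^1_{1i} is (i/2) ε_{ijk} Y^1_{1k}
(`coeff1_zero_sphereDir_mul_Y1`), projection gives D^{*k} = q(η^k - ξ^k + Q^k) + O(ε³), with Q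
quadratic in first-order quantities. The second-order equivalence is then immediate.

For the third-order equivalence Q, which contains ξ and ξ', has to be replaced by an expression in η
and η'. This needs ξ - η = O(ε²), which is clear, and ξ' - η' = O(ε²), which is not: an asymptotic
relation cannot be differentiated. Instead ξ - η is compared at times s and s + ε. It equals a
slowly varying second-order quantity up to O(ε³), so its increment is O(ε³), while Taylor's formula
gives the increment as ε(ξ' - η') + O(ε³); division by ε finishes (`order_rate_of_slowlyVarying`,
`WorldLineBounds.correction_sub_order`).

The Maxwell equation at null infinity is not obtained by differentiating the peeling expansion,
whose error terms have no controlled derivatives. At finite distance an exact identity along ingoing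
null lines u + r = T holds for the l = 1 projections (`IsVacuumMaxwell.hasDerivAt_npPhi_zero`); it
rests on the curl equations for E + iB and on the divergence theorem on the sphere
(`sphereIntegral_tangential`). Both sides converge uniformly as T → ∞, so the identity passes to the
limit (`IsVacuumMaxwell.hasDerivAt_leading`).

For part (2) the third-order formula defines the world line explicitly. Only i ξ_I^0 is not
holomorphic as written; it is replaced by (ξ^0(τ) - conj ξ^0(conj τ))/2, which has the same values
on the real axis and is holomorphic on the part of U symmetric under conjugation. -/

/-- The unit vector with stereographic coordinate `ζ`. -/
noncomputable def sphereDir (ζ : ℂ) : Fin 3 → ℝ :=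
  ![2 * ζ.re / sphereP ζ, 2 * ζ.im / sphereP ζ, 1 - 2 / sphereP ζ]

/-- The area density `4 / P²`. -/
noncomputable def areaDensity (ζ : ℂ) : ℝ := 4 / sphereP ζ ^ 2

/-- The Levi-Civita symbol. -/
noncomputable def leviCivita (i j k : Fin 3) : ℝ :=
  (((j : ℕ) : ℝ) - (i : ℕ)) * (((k : ℕ) : ℝ) - (j : ℕ)) * (((k : ℕ) : ℝ) - (i : ℕ)) / 2

theorem sphereP_pos (ζ : ℂ) : 0 < sphereP ζ := by unfold sphereP; positivity

theorem sphereP_ne (ζ : ℂ) : sphereP ζ ≠ 0 := (sphereP_pos ζ).ne'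

theorem one_le_sphereP (ζ : ℂ) : 1 ≤ sphereP ζ := by
  unfold sphereP; nlinarith [sq_nonneg ‖ζ‖]

theorem sphereP_eq (ζ : ℂ) : sphereP ζ = 1 + ζ.re ^ 2 + ζ.im ^ 2 := by
  rw [sphereP, Complex.sq_norm, Complex.normSq_apply]; ring

@[fun_prop]
theorem continuous_sphereP : Continuous sphereP := by unfold sphereP; fun_prop

@[fun_prop]
theorem continuous_sphereDir (i : Fin 3) : Continuous fun ζ => sphereDir ζ i := by
  fin_cases i
  · exact Continuous.div₀ (by fun_prop) (by fun_prop) sphereP_ne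
  · exact Continuous.div₀ (by fun_prop) (by fun_prop) sphereP_ne
  · exact continuous_const.sub (Continuous.div₀ (by fun_prop) (by fun_prop) sphereP_ne)

@[fun_prop]
theorem continuous_sphereDir' : Continuous sphereDir := continuous_pi continuous_sphereDir

@[fun_prop]
theorem continuous_areaDensity : Continuous areaDensity :=
  Continuous.div₀ (by fun_prop) (by fun_prop) fun ζ => pow_ne_zero 2 (sphereP_ne ζ)

theorem areaDensity_nonneg (ζ : ℂ) : 0 ≤ areaDensity ζ := by unfold areaDensity; positivity

theorem sphereDir_sq (ζ : ℂ) :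
    sphereDir ζ 0 ^ 2 + sphereDir ζ 1 ^ 2 + sphereDir ζ 2 ^ 2 = 1 := by
  have h := sphereP_ne ζ
  have e := sphereP_eq ζ
  simp only [sphereDir, Matrix.cons_val]
  field_simp
  linear_combination (-4) * e

theorem abs_sphereDir_le (ζ : ℂ) (i : Fin 3) : |sphereDir ζ i| ≤ 1 := by
  have h := sphereDir_sq ζ
  apply abs_le_one_iff_mul_self_le_one.2
  fin_cases i <;> simp <;> nlinarith [sq_nonneg (sphereDir ζ 0), sq_nonneg (sphereDir ζ 1),
    sq_nonneg (sphereDir ζ 2)]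

/-- The tetrad is rewritten in terms of the unit vector `sphereDir` and the harmonic `Y1 0`, so that
the explicit stereographic formulas enter only through a few polynomial identities. -/
theorem lHat_zero (ζ : ℂ) : lHat ζ 0 = (√2 / 2 : ℝ) := by
  have h : (sphereP ζ : ℂ) ≠ 0 := by exact_mod_cast sphereP_ne ζ
  have e : (sphereP ζ : ℂ) = 1 + ζ * star ζ := by
    rw [sphereP]; push_cast; rw [Complex.star_def, Complex.mul_conj']
  simp only [lHat, Matrix.cons_val]
  rw [← e]; push_cast; field_simp

theorem nHat_zero (ζ : ℂ) : nHat ζ 0 = (√2 / 2 : ℝ) := by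
  have : nHat ζ 0 = lHat ζ 0 := by simp [nHat, lHat]
  rw [this, lHat_zero]

theorem eq_re_add_im_mul_I (ζ : ℂ) : ζ = ζ.re + ζ.im * Complex.I := (Complex.re_add_im ζ).symm

theorem star_eq_re_sub_im_mul_I (ζ : ℂ) : star ζ = ζ.re - ζ.im * Complex.I := by
  apply Complex.ext <;> simp

theorem lHat_succ (ζ : ℂ) (i : Fin 3) : lHat ζ i.succ = (√2 / 2 * sphereDir ζ i : ℝ) := by
  have h : (sphereP ζ : ℂ) ≠ 0 := by exact_mod_cast sphereP_ne ζ
  have e : (sphereP ζ : ℂ) = 1 + ζ.re ^ 2 + ζ.im ^ 2 := by exact_mod_cast sphereP_eq ζ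
  have hz : lHat ζ i.succ = (√2 / (2 * sphereP ζ) : ℂ) *
      ![2 * (ζ.re : ℂ), 2 * ζ.im, -1 + ζ.re ^ 2 + ζ.im ^ 2] i := by
    have h1 := eq_re_add_im_mul_I ζ
    have h2 := star_eq_re_sub_im_mul_I ζ
    generalize ζ.re = a at *
    generalize ζ.im = b at *
    subst h1
    fin_cases i <;> simp only [lHat, h2] <;> push_cast <;> congr 1 <;>
      (try simp [-mul_eq_mul_left_iff]) <;> ring_nf <;> try (simp only [Complex.I_sq]; ring)
  rw [hz]
  fin_cases i <;> simp [sphereDir] <;> field_simp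
  rw [e]; ring

theorem nHat_succ (ζ : ℂ) (i : Fin 3) : nHat ζ i.succ = -(√2 / 2 * sphereDir ζ i : ℝ) := by
  rw [← lHat_succ]
  fin_cases i <;> simp [nHat, lHat] <;> ring

theorem Y1_one (i : Fin 3) (ζ : ℂ) : Y1 1 i ζ = (√2 * sphereDir ζ i : ℝ) := by
  simp only [Y1, Matrix.cons_val, lHat_succ, nHat_succ]; push_cast; ring

theorem Y1_two (i : Fin 3) (ζ : ℂ) : Y1 2 i ζ = star (Y1 0 i ζ) := by
  simp only [Y1, Matrix.cons_val]

theorem mHat_zero (ζ : ℂ) : mHat ζ 0 = 0 := by simp [mHat]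

theorem mHat_succ (ζ : ℂ) (i : Fin 3) : mHat ζ i.succ = -Y1 0 i ζ := by
  simp [Y1]

theorem leviCivita_values : leviCivita 0 1 2 = 1 ∧ leviCivita 1 2 0 = 1 ∧ leviCivita 2 0 1 = 1 ∧
    leviCivita 0 2 1 = -1 ∧ leviCivita 2 1 0 = -1 ∧ leviCivita 1 0 2 = -1 := by
  norm_num [leviCivita]

theorem leviCivita_self_left (i k : Fin 3) : leviCivita i i k = 0 := by simp [leviCivita]
theorem leviCivita_self_right (i k : Fin 3) : leviCivita i k k = 0 := by simp [leviCivita]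
theorem leviCivita_self_outer (i k : Fin 3) : leviCivita i k i = 0 := by simp [leviCivita]

theorem Y1_zero_eq (ζ : ℂ) (i : Fin 3) : Y1 0 i ζ = -((√2 : ℝ) / (2 * sphereP ζ) : ℂ) *
    ![1 - star ζ ^ 2, -Complex.I * (1 + star ζ ^ 2), 2 * star ζ] i := by
  fin_cases i <;> simp [Y1, mHat]

/-- The spin-one harmonics form a complex null vector tangent to the sphere, normalised so that its
symmetric square is half the tangential projector; orientation fixes the antisymmetric part. This
reduces all integrals of pairs of spin-one harmonics to moments of `sphereDir`. -/
theorem Y1_zero_mul_star (i k : Fin 3) (ζ : ℂ) :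
    Y1 0 i ζ * star (Y1 0 k ζ) = ((if i = k then 1 else 0) - sphereDir ζ i * sphereDir ζ k
      - Complex.I * ∑ l, (leviCivita i k l : ℂ) * sphereDir ζ l) / 2 := by
  have h : (sphereP ζ : ℂ) ≠ 0 := by exact_mod_cast sphereP_ne ζ
  have e : (sphereP ζ : ℂ) = 1 + ζ.re ^ 2 + ζ.im ^ 2 := by exact_mod_cast sphereP_eq ζ
  have h2 : ((√2 : ℝ) : ℂ) ^ 2 = 2 := by
    rw [← Complex.ofReal_pow, Real.sq_sqrt (by norm_num)]; norm_num
  have hs : star (Y1 0 k ζ) = -((√2 : ℝ) / (2 * sphereP ζ) : ℂ) *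
      ![1 - ζ ^ 2, Complex.I * (1 + ζ ^ 2), 2 * ζ] k := by
    rw [Y1_zero_eq]; fin_cases k <;> simp
  have e1 := eq_re_add_im_mul_I ζ
  have e2 := star_eq_re_sub_im_mul_I ζ
  rw [hs, Y1_zero_eq, e2]
  simp only [sphereDir]
  generalize ζ.re = a at *
  generalize ζ.im = b at *
  generalize sphereP ζ = p at *
  subst e1
  have I3 : Complex.I ^ 3 = -Complex.I := Complex.I_pow_three
  have I4 : Complex.I ^ 4 = 1 := Complex.I_pow_four
  have I5 : Complex.I ^ 5 = Complex.I := by rw [pow_succ, I4, one_mul]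
  have I6 : Complex.I ^ 6 = -1 := by rw [pow_succ, I5, Complex.I_mul_I]
  fin_cases i <;> fin_cases k <;>
    simp [Fin.sum_univ_three, leviCivita_values, leviCivita_self_left,
      leviCivita_self_right, leviCivita_self_outer, -mul_eq_mul_left_iff, -mul_eq_mul_right_iff,
      -mul_eq_zero] <;>
    field_simp <;> rw [h2, e] <;> ring_nf <;>
    simp only [Complex.I_sq, I3, I4, I5, I6] <;> ring

@[fun_prop]
theorem continuous_Y1 (k i : Fin 3) : Continuous (Y1 k i) := by
  have h0 : ∀ i, Continuous (Y1 0 i) := by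
    intro i
    have hw : Continuous fun ζ : ℂ => ((√2 / (2 * sphereP ζ) : ℝ) : ℂ) := by
      refine Complex.continuous_ofReal.comp (Continuous.div₀ (by fun_prop) (by fun_prop) fun ζ => ?_)
      have := sphereP_pos ζ; positivity
    have : Y1 0 i = fun ζ => -mHat ζ i.succ := by ext; simp [Y1]
    rw [this]
    fin_cases i <;> simp only [mHat] <;> refine (hw.mul ?_).neg <;> simp <;> fun_prop
  fin_cases k
  · exact h0 i
  · show Continuous (Y1 1 i)
    rw [show Y1 1 i = _ from funext (Y1_one i)]; fun_prop
  · show Continuous (Y1 2 i)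
    rw [show Y1 2 i = _ from funext (Y1_two i)]; exact (h0 i).star

theorem norm_Y1_le (k i : Fin 3) (ζ : ℂ) : ‖Y1 k i ζ‖ ≤ 2 := by
  have h0 : ‖Y1 0 i ζ‖ ≤ 2 := by
    have h := Y1_zero_mul_star i i ζ
    have hn : ‖Y1 0 i ζ‖ * ‖Y1 0 i ζ‖ = ‖Y1 0 i ζ * star (Y1 0 i ζ)‖ := by
      rw [norm_mul, norm_star]
    have hr : Y1 0 i ζ * star (Y1 0 i ζ) = ((1 - sphereDir ζ i * sphereDir ζ i) / 2 : ℝ) := by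
      rw [h]; simp [leviCivita_self_left]
    rw [hr, Complex.norm_real, Real.norm_eq_abs] at hn
    have hx := abs_le.1 (abs_sphereDir_le ζ i)
    have : |(1 - sphereDir ζ i * sphereDir ζ i) / 2| ≤ 1 := by
      rw [abs_le]; constructor <;> nlinarith
    nlinarith [norm_nonneg (Y1 0 i ζ)]
  fin_cases k
  · exact h0
  · show ‖Y1 1 i ζ‖ ≤ 2
    rw [Y1_one, Complex.norm_real, Real.norm_eq_abs, abs_mul, abs_of_nonneg (Real.sqrt_nonneg 2)]
    have h1 := abs_sphereDir_le ζ i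
    have : √2 ≤ 2 := by rw [Real.sqrt_le_left (by norm_num)]; norm_num
    nlinarith [abs_nonneg (sphereDir ζ i), Real.sqrt_nonneg 2]
  · show ‖Y1 2 i ζ‖ ≤ 2
    rw [Y1_two, norm_star]; exact h0

/-! ### Bounded continuous functions on the sphere and their integrals -/

/-- Bounded continuous functions of the stereographic coordinate. -/
structure IsBddCont (f : ℂ → ℂ) : Prop where
  continuous : Continuous f
  bounded : ∃ C, ∀ ζ, ‖f ζ‖ ≤ C

namespace IsBddCont

variable {f g : ℂ → ℂ}

theorem const (c : ℂ) : IsBddCont fun _ => c := ⟨continuous_const, ‖c‖, fun _ => le_rfl⟩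

theorem add (hf : IsBddCont f) (hg : IsBddCont g) : IsBddCont fun ζ => f ζ + g ζ := by
  obtain ⟨C, hC⟩ := hf.2
  obtain ⟨D, hD⟩ := hg.2
  exact ⟨hf.1.add hg.1, C + D, fun ζ => (norm_add_le _ _).trans (add_le_add (hC ζ) (hD ζ))⟩

theorem neg (hf : IsBddCont f) : IsBddCont fun ζ => -f ζ := by
  obtain ⟨C, hC⟩ := hf.2
  exact ⟨hf.1.neg, C, fun ζ => by rw [norm_neg]; exact hC ζ⟩

theorem sub (hf : IsBddCont f) (hg : IsBddCont g) : IsBddCont fun ζ => f ζ - g ζ := by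
  simpa only [sub_eq_add_neg] using hf.add hg.neg

theorem mul (hf : IsBddCont f) (hg : IsBddCont g) : IsBddCont fun ζ => f ζ * g ζ := by
  obtain ⟨C, hC⟩ := hf.2
  obtain ⟨D, hD⟩ := hg.2
  refine ⟨hf.1.mul hg.1, C * D, fun ζ => ?_⟩
  rw [norm_mul]
  exact mul_le_mul (hC ζ) (hD ζ) (norm_nonneg _) ((norm_nonneg _).trans (hC ζ))

theorem star (hf : IsBddCont f) : IsBddCont fun ζ => star (f ζ) := by
  obtain ⟨C, hC⟩ := hf.2
  exact ⟨hf.1.star, C, fun ζ => by rw [norm_star]; exact hC ζ⟩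

theorem sum {ι : Type*} (s : Finset ι) {f : ι → ℂ → ℂ} (h : ∀ i ∈ s, IsBddCont (f i)) :
    IsBddCont fun ζ => ∑ i ∈ s, f i ζ := by
  classical
  induction s using Finset.induction_on with
  | empty => simpa using const 0
  | insert a s ha ih =>
    simp only [Finset.sum_insert ha]
    exact (h a (by simp)).add (ih fun i hi => h i (by simp [hi]))

theorem sphereDir (i : Fin 3) : IsBddCont fun ζ => (sphereDir ζ i : ℂ) :=
  ⟨by fun_prop, 1, fun ζ => by
    rw [Complex.norm_real, Real.norm_eq_abs]; exact abs_sphereDir_le ζ i⟩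

theorem Y1 (k i : Fin 3) : IsBddCont (Y1 k i) := ⟨continuous_Y1 k i, 2, norm_Y1_le k i⟩

end IsBddCont

theorem continuous_sphereWeight :
    Continuous fun ζ : ℂ => ((4 / sphereP ζ ^ 2 : ℝ) : ℂ) :=
  Complex.continuous_ofReal.comp continuous_areaDensity

theorem rpow_neg_three_halves (ζ : ℂ) :
    (1 + ‖ζ‖ ^ 2) ^ (-(3 : ℝ) / 2) = (√(sphereP ζ))⁻¹ ^ 3 := by
  have h := sphereP_pos ζ
  change sphereP ζ ^ (-(3 : ℝ) / 2) = _
  rw [Real.sqrt_eq_rpow, ← Real.rpow_neg h.le, ← Real.rpow_natCast, ← Real.rpow_mul h.le]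
  norm_num

/-- The exponent 3 exceeds the real dimension 2 of the plane. The power P^(-3/2) is the common
majorant for the area density and for the integrands of the divergence theorem. -/
theorem integrable_inv_sqrt_sphereP_cube : Integrable fun ζ => (√(sphereP ζ))⁻¹ ^ 3 := by
  have h := integrable_rpow_neg_one_add_norm_sq (E := ℂ) (μ := volume) (r := 3)
    (by rw [Complex.finrank_real_complex]; norm_num)
  exact h.congr (Eventually.of_forall fun ζ => rpow_neg_three_halves ζ)

theorem inv_sqrt_sphereP_mem (ζ : ℂ) :
    0 < (√(sphereP ζ))⁻¹ ∧ (√(sphereP ζ))⁻¹ ≤ 1 ∧ (√(sphereP ζ))⁻¹ ^ 2 = 1 / sphereP ζ := by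
  have h := sphereP_pos ζ
  have h1 := one_le_sphereP ζ
  refine ⟨by positivity, inv_le_one_of_one_le₀ (Real.one_le_sqrt.2 h1), ?_⟩
  rw [inv_pow, Real.sq_sqrt h.le, one_div]

theorem integrable_areaDensity : Integrable areaDensity := by
  refine (integrable_inv_sqrt_sphereP_cube.const_mul 4).mono'
    continuous_areaDensity.aestronglyMeasurable (Eventually.of_forall fun ζ => ?_)
  rw [Real.norm_of_nonneg (areaDensity_nonneg ζ)]
  obtain ⟨h0, h1, h2⟩ := inv_sqrt_sphereP_mem ζ
  have : areaDensity ζ = 4 * (√(sphereP ζ))⁻¹ ^ 4 := by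
    rw [show (√(sphereP ζ))⁻¹ ^ 4 = ((√(sphereP ζ))⁻¹ ^ 2) ^ 2 by ring, h2, areaDensity]
    ring
  rw [this]
  have := pow_le_pow_of_le_one h0.le h1 (show 3 ≤ 4 by norm_num)
  linarith

theorem IsBddCont.integrable {f : ℂ → ℂ} (hf : IsBddCont f) :
    Integrable fun ζ => f ζ * ((4 / sphereP ζ ^ 2 : ℝ) : ℂ) := by
  obtain ⟨C, hC⟩ := hf.2
  refine (integrable_areaDensity.const_mul C).mono'
    (hf.1.mul continuous_sphereWeight).aestronglyMeasurable (Eventually.of_forall fun ζ => ?_)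
  rw [norm_mul, Complex.norm_real]
  change _ * ‖areaDensity ζ‖ ≤ _
  rw [Real.norm_of_nonneg (areaDensity_nonneg ζ)]
  exact mul_le_mul_of_nonneg_right (hC ζ) (areaDensity_nonneg ζ)

theorem sphereIntegral_add {f g : ℂ → ℂ} (hf : IsBddCont f) (hg : IsBddCont g) :
    sphereIntegral (fun ζ => f ζ + g ζ) = sphereIntegral f + sphereIntegral g := by
  simp only [sphereIntegral, add_mul]
  exact integral_add hf.integrable hg.integrable

theorem sphereIntegral_sub {f g : ℂ → ℂ} (hf : IsBddCont f) (hg : IsBddCont g) :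
    sphereIntegral (fun ζ => f ζ - g ζ) = sphereIntegral f - sphereIntegral g := by
  simp only [sphereIntegral, sub_mul]
  exact integral_sub hf.integrable hg.integrable

theorem sphereIntegral_const_mul (c : ℂ) (f : ℂ → ℂ) :
    sphereIntegral (fun ζ => c * f ζ) = c * sphereIntegral f := by
  simp only [sphereIntegral, mul_assoc]
  exact integral_const_mul c _

theorem sphereIntegral_mul_const (f : ℂ → ℂ) (c : ℂ) :
    sphereIntegral (fun ζ => f ζ * c) = sphereIntegral f * c := by
  simpa only [mul_comm] using sphereIntegral_const_mul c f

theorem sphereIntegral_sum {ι : Type*} (s : Finset ι) {f : ι → ℂ → ℂ}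
    (h : ∀ i ∈ s, IsBddCont (f i)) :
    sphereIntegral (fun ζ => ∑ i ∈ s, f i ζ) = ∑ i ∈ s, sphereIntegral (f i) := by
  simp only [sphereIntegral, Finset.sum_mul]
  exact integral_finsetSum s fun i hi => (h i hi).integrable

/-- The area of the unit sphere. -/
noncomputable def sphereArea : ℝ := ∫ ζ, areaDensity ζ

theorem sphereArea_pos : 0 < sphereArea := by
  refine (integral_pos_iff_support_of_nonneg areaDensity_nonneg integrable_areaDensity).2 ?_
  have : Function.support areaDensity = Set.univ := by
    ext ζ
    have := sphereP_pos ζ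
    simp only [Function.mem_support, Set.mem_univ, iff_true]
    unfold areaDensity; positivity
  rw [this]
  exact isOpen_univ.measure_pos _ ⟨0, trivial⟩

theorem sphereIntegral_const (c : ℂ) : sphereIntegral (fun _ => c) = c * sphereArea := by
  simp only [sphereIntegral]
  rw [integral_const_mul]
  exact congrArg _ (integral_ofReal (f := areaDensity))

theorem norm_sphereIntegral_le {f : ℂ → ℂ} {C : ℝ} (hC : ∀ ζ, ‖f ζ‖ ≤ C) :
    ‖sphereIntegral f‖ ≤ C * sphereArea := by
  unfold sphereIntegral sphereArea
  rw [← integral_const_mul]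
  refine norm_integral_le_of_norm_le (integrable_areaDensity.const_mul C)
    (Eventually.of_forall fun ζ => ?_)
  rw [norm_mul, Complex.norm_real]
  change _ * ‖areaDensity ζ‖ ≤ _
  rw [Real.norm_of_nonneg (areaDensity_nonneg ζ)]
  exact mul_le_mul_of_nonneg_right (hC ζ) (areaDensity_nonneg ζ)

/-! ### The divergence theorem on the stereographic plane -/

/-- Fubini and the fundamental theorem of calculus on almost every horizontal line. Compact support
is not needed: decay at infinity kills the boundary values. -/
theorem integral_re_deriv_eq_zero {H H' : ℂ → ℂ}
    (hd : ∀ x y : ℝ, HasDerivAt (fun x : ℝ => H ⟨x, y⟩) (H' ⟨x, y⟩) x)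
    (hi : Integrable H') (h0 : Tendsto H (cocompact ℂ) (𝓝 0)) : ∫ ζ, H' ζ = 0 := by
  have hmp := Complex.volume_preserving_equiv_real_prod.symm
  have hi' : Integrable (fun z => H' (Complex.measurableEquivRealProd.symm z)) :=
    (hmp.integrable_comp_emb (MeasurableEquiv.measurableEmbedding _)).2 hi
  rw [← hmp.integral_comp (MeasurableEquiv.measurableEmbedding _) H']
  -- The factors are swapped so that the inner integral runs over the real part.
  have hsw : Integrable (fun z : ℝ × ℝ => H' (Complex.measurableEquivRealProd.symm z.swap))
      (volume.prod volume) := hi'.swap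
  rw [Measure.volume_eq_prod, ← integral_prod_swap, integral_prod _ hsw]
  refine integral_eq_zero_of_ae ?_
  filter_upwards [hsw.prod_right_ae] with y hy
  have ht : ∀ l : Filter ℝ, l ≤ cocompact ℝ → Tendsto (fun x : ℝ => H ⟨x, y⟩) l (𝓝 0) := by
    intro l hl
    refine h0.comp (Tendsto.mono_left ?_ hl)
    refine tendsto_cocompact_of_tendsto_dist_comp_atTop 0 ?_ |>.mono_left le_rfl
    refine tendsto_atTop_mono (fun x => ?_) (tendsto_norm_cocompact_atTop (E := ℝ))
    rw [dist_zero_right]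
    exact Complex.abs_re_le_norm ⟨x, y⟩
  simpa using integral_of_hasDerivAt_of_tendsto (fun x => hd x y) hy
    (ht _ atBot_le_cocompact) (ht _ atTop_le_cocompact)

theorem integral_im_deriv_eq_zero {H H' : ℂ → ℂ}
    (hd : ∀ x y : ℝ, HasDerivAt (fun y : ℝ => H ⟨x, y⟩) (H' ⟨x, y⟩) y)
    (hi : Integrable H') (h0 : Tendsto H (cocompact ℂ) (𝓝 0)) : ∫ ζ, H' ζ = 0 := by
  have hmp := Complex.volume_preserving_equiv_real_prod.symm
  have hi' : Integrable (fun z => H' (Complex.measurableEquivRealProd.symm z)) :=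
    (hmp.integrable_comp_emb (MeasurableEquiv.measurableEmbedding _)).2 hi
  rw [← hmp.integral_comp (MeasurableEquiv.measurableEmbedding _) H']
  rw [Measure.volume_eq_prod, integral_prod _ hi']
  refine integral_eq_zero_of_ae ?_
  filter_upwards [hi'.prod_right_ae] with x hx
  have ht : ∀ l : Filter ℝ, l ≤ cocompact ℝ → Tendsto (fun y : ℝ => H ⟨x, y⟩) l (𝓝 0) := by
    intro l hl
    refine h0.comp (Tendsto.mono_left ?_ hl)
    refine tendsto_cocompact_of_tendsto_dist_comp_atTop 0 ?_ |>.mono_left le_rfl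
    refine tendsto_atTop_mono (fun y => ?_) (tendsto_norm_cocompact_atTop (E := ℝ))
    rw [dist_zero_right]
    exact Complex.abs_im_le_norm ⟨x, y⟩
  simpa using integral_of_hasDerivAt_of_tendsto (fun y => hd x y) hx
    (ht _ atBot_le_cocompact) (ht _ atTop_le_cocompact)

/-- The derivative of `sphereDir` along the real axis of the stereographic plane. -/
noncomputable def sphereDirRe (ζ : ℂ) : Fin 3 → ℝ :=
  ![1 - sphereDir ζ 2 - sphereDir ζ 0 ^ 2, -(sphereDir ζ 0 * sphereDir ζ 1),
    sphereDir ζ 0 * (1 - sphereDir ζ 2)]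

/-- The derivative of `sphereDir` along the imaginary axis of the stereographic plane. -/
noncomputable def sphereDirIm (ζ : ℂ) : Fin 3 → ℝ :=
  ![-(sphereDir ζ 0 * sphereDir ζ 1), 1 - sphereDir ζ 2 - sphereDir ζ 1 ^ 2,
    sphereDir ζ 1 * (1 - sphereDir ζ 2)]

/-- The second derivative of `sphereDir` along the real axis. -/
noncomputable def sphereDirReRe (ζ : ℂ) : Fin 3 → ℝ :=
  ![-(sphereDirRe ζ 2) - 2 * sphereDir ζ 0 * sphereDirRe ζ 0,
    -(sphereDirRe ζ 0 * sphereDir ζ 1 + sphereDir ζ 0 * sphereDirRe ζ 1),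
    sphereDirRe ζ 0 * (1 - sphereDir ζ 2) - sphereDir ζ 0 * sphereDirRe ζ 2]

/-- The second derivative of `sphereDir` along the imaginary axis. -/
noncomputable def sphereDirImIm (ζ : ℂ) : Fin 3 → ℝ :=
  ![-(sphereDirIm ζ 0 * sphereDir ζ 1 + sphereDir ζ 0 * sphereDirIm ζ 1),
    -(sphereDirIm ζ 2) - 2 * sphereDir ζ 1 * sphereDirIm ζ 1,
    sphereDirIm ζ 1 * (1 - sphereDir ζ 2) - sphereDir ζ 1 * sphereDirIm ζ 2]

theorem hasDerivAt_sphereDir_re (x y : ℝ) (i : Fin 3) :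
    HasDerivAt (fun x : ℝ => sphereDir ⟨x, y⟩ i) (sphereDirRe ⟨x, y⟩ i) x := by
  have hP : (1 : ℝ) + x ^ 2 + y ^ 2 ≠ 0 := by positivity
  have h1 : HasDerivAt (fun x : ℝ => 1 + x ^ 2 + y ^ 2) (2 * x) x := by
    simpa using ((hasDerivAt_pow 2 x).const_add 1).add_const (y ^ 2)
  fin_cases i <;> simp [sphereDir, sphereDirRe, sphereP_eq]
  · refine (((hasDerivAt_id x).const_mul 2).div h1 hP).congr_deriv ?_
    simp only [id]; field_simp
  · refine ((hasDerivAt_const x (2 * y)).div h1 hP).congr_deriv ?_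
    field_simp; ring
  · refine (((hasDerivAt_const x (2 : ℝ)).div h1 hP).const_sub 1).congr_deriv ?_
    field_simp; ring

theorem hasDerivAt_sphereDir_im (x y : ℝ) (i : Fin 3) :
    HasDerivAt (fun y : ℝ => sphereDir ⟨x, y⟩ i) (sphereDirIm ⟨x, y⟩ i) y := by
  have hP : (1 : ℝ) + x ^ 2 + y ^ 2 ≠ 0 := by positivity
  have h1 : HasDerivAt (fun y : ℝ => 1 + x ^ 2 + y ^ 2) (2 * y) y := by
    simpa using (hasDerivAt_pow 2 y).const_add (1 + x ^ 2)
  fin_cases i <;> simp [sphereDir, sphereDirIm, sphereP_eq]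
  · refine ((hasDerivAt_const y (2 * x)).div h1 hP).congr_deriv ?_
    field_simp; ring
  · refine (((hasDerivAt_id y).const_mul 2).div h1 hP).congr_deriv ?_
    simp only [id]; field_simp
  · refine (((hasDerivAt_const y (2 : ℝ)).div h1 hP).const_sub 1).congr_deriv ?_
    field_simp; ring

theorem hasDerivAt_sphereDirRe (x y : ℝ) (i : Fin 3) :
    HasDerivAt (fun x : ℝ => sphereDirRe ⟨x, y⟩ i) (sphereDirReRe ⟨x, y⟩ i) x := by
  have h := hasDerivAt_sphereDir_re x y
  fin_cases i
  · refine (((h 2).const_sub 1).sub ((h 0).pow 2)).congr_deriv ?_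
    simp [sphereDirReRe]
  · exact ((h 0).mul (h 1)).neg
  · refine ((h 0).mul ((h 2).const_sub 1)).congr_deriv ?_
    simp [sphereDirReRe]; ring

theorem hasDerivAt_sphereDirIm (x y : ℝ) (i : Fin 3) :
    HasDerivAt (fun y : ℝ => sphereDirIm ⟨x, y⟩ i) (sphereDirImIm ⟨x, y⟩ i) y := by
  have h := hasDerivAt_sphereDir_im x y
  fin_cases i
  · exact ((h 0).mul (h 1)).neg
  · refine (((h 2).const_sub 1).sub ((h 1).pow 2)).congr_deriv ?_
    simp [sphereDirImIm]
  · refine ((h 1).mul ((h 2).const_sub 1)).congr_deriv ?_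
    simp [sphereDirImIm]; ring

@[fun_prop]
theorem continuous_sphereDirRe (i : Fin 3) : Continuous fun ζ => sphereDirRe ζ i := by
  fin_cases i <;> simp [sphereDirRe] <;> fun_prop

@[fun_prop]
theorem continuous_sphereDirIm (i : Fin 3) : Continuous fun ζ => sphereDirIm ζ i := by
  fin_cases i <;> simp [sphereDirIm] <;> fun_prop

@[fun_prop]
theorem continuous_sphereDirReRe (i : Fin 3) : Continuous fun ζ => sphereDirReRe ζ i := by
  fin_cases i <;> simp [sphereDirReRe] <;> fun_prop

@[fun_prop]
theorem continuous_sphereDirImIm (i : Fin 3) : Continuous fun ζ => sphereDirImIm ζ i := by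
  fin_cases i <;> simp [sphereDirImIm] <;> fun_prop

theorem one_sub_sphereDir_two (ζ : ℂ) :
    1 - sphereDir ζ 2 = 2 * (√(sphereP ζ))⁻¹ ^ 2 := by
  rw [(inv_sqrt_sphereP_mem ζ).2.2]; simp [sphereDir]; ring

/-- Infinity of the plane is the north pole. With s = P^(-1/2), the third coordinate satisfies 1 - z
= 2s², and x² + y² = 1 - z² then forces x and y to be O(s). -/
theorem abs_sphereDir_zero_le (ζ : ℂ) : |sphereDir ζ 0| ≤ 2 * (√(sphereP ζ))⁻¹ ∧
    |sphereDir ζ 1| ≤ 2 * (√(sphereP ζ))⁻¹ := by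
  obtain ⟨h0, h1, h2⟩ := inv_sqrt_sphereP_mem ζ
  have h := sphereDir_sq ζ
  have h3 := one_sub_sphereDir_two ζ
  have h4 := abs_le.1 (abs_sphereDir_le ζ 2)
  have key : sphereDir ζ 0 ^ 2 + sphereDir ζ 1 ^ 2 ≤ (2 * (√(sphereP ζ))⁻¹) ^ 2 := by
    nlinarith
  constructor <;> refine abs_le_of_sq_le_sq ?_ (by positivity)
  · nlinarith [sq_nonneg (sphereDir ζ 1)]
  · nlinarith [sq_nonneg (sphereDir ζ 0)]

theorem abs_mul_le_mul {a b A B : ℝ} (ha : |a| ≤ A) (hb : |b| ≤ B) : |a * b| ≤ A * B := by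
  rw [abs_mul]; exact mul_le_mul ha hb (abs_nonneg b) ((abs_nonneg a).trans ha)

/-- Each first derivative is a polynomial in x, y and 1 - z of weight at least two, where x and y
count once and 1 - z twice. Second derivatives have weight at least three in the same sense, hence
decay like s³. The constants 6 and 36 are merely convenient. -/
theorem abs_sphereDir_deriv_le (ζ : ℂ) (i : Fin 3) :
    |sphereDirRe ζ i| ≤ 6 * (√(sphereP ζ))⁻¹ ^ 2 ∧ |sphereDirIm ζ i| ≤ 6 * (√(sphereP ζ))⁻¹ ^ 2 := by
  obtain ⟨hx, hy⟩ := abs_sphereDir_zero_le ζ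
  have hz := one_sub_sphereDir_two ζ
  obtain ⟨h0, h1, -⟩ := inv_sqrt_sphereP_mem ζ
  generalize (√(sphereP ζ))⁻¹ = s at *
  have hz' : |1 - sphereDir ζ 2| ≤ 2 * s ^ 2 := by rw [hz, abs_of_nonneg (by positivity)]
  have hxx := abs_le.1 (abs_mul_le_mul hx hx)
  have hyy := abs_le.1 (abs_mul_le_mul hy hy)
  have hxy := abs_le.1 (abs_mul_le_mul hx hy)
  have hxz := abs_le.1 (abs_mul_le_mul hx hz')
  have hyz := abs_le.1 (abs_mul_le_mul hy hz')
  have hs : s ^ 3 ≤ s ^ 2 := pow_le_pow_of_le_one h0.le h1 (by norm_num)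
  have hs2 : 0 < s ^ 2 := by positivity
  have hzz := abs_le.1 hz'
  constructor <;> fin_cases i <;> simp only [sphereDirRe, sphereDirIm] <;> rw [abs_le] <;>
    simp [-neg_le_neg_iff] <;> constructor <;> nlinarith

theorem abs_sphereDir_deriv2_le (ζ : ℂ) (i : Fin 3) :
    |sphereDirReRe ζ i| ≤ 36 * (√(sphereP ζ))⁻¹ ^ 3 ∧
      |sphereDirImIm ζ i| ≤ 36 * (√(sphereP ζ))⁻¹ ^ 3 := by
  obtain ⟨hx, hy⟩ := abs_sphereDir_zero_le ζ
  have hz := one_sub_sphereDir_two ζ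
  obtain ⟨h0, h1, -⟩ := inv_sqrt_sphereP_mem ζ
  have hz1 := one_sub_sphereDir_two ζ
  have hR := fun i => (abs_sphereDir_deriv_le ζ i).1
  have hI := fun i => (abs_sphereDir_deriv_le ζ i).2
  have hRz : sphereDirRe ζ 2 = sphereDir ζ 0 * (1 - sphereDir ζ 2) := by simp [sphereDirRe]
  have hIz : sphereDirIm ζ 2 = sphereDir ζ 1 * (1 - sphereDir ζ 2) := by simp [sphereDirIm]
  generalize (√(sphereP ζ))⁻¹ = s at *
  have hz' : |1 - sphereDir ζ 2| ≤ 2 * s ^ 2 := by rw [hz, abs_of_nonneg (by positivity)]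
  have a1 := abs_le.1 (abs_mul_le_mul hx (hR 0))
  have a2 := abs_le.1 (abs_mul_le_mul hy (hR 0))
  have a3 := abs_le.1 (abs_mul_le_mul hx (hR 1))
  have a4 := abs_le.1 (abs_mul_le_mul hz' (hR 0))
  have a5 := abs_le.1 (abs_mul_le_mul hx (hR 2))
  have b1 := abs_le.1 (abs_mul_le_mul hy (hI 0))
  have b2 := abs_le.1 (abs_mul_le_mul hx (hI 1))
  have b3 := abs_le.1 (abs_mul_le_mul hy (hI 1))
  have b4 := abs_le.1 (abs_mul_le_mul hz' (hI 1))
  have b5 := abs_le.1 (abs_mul_le_mul hy (hI 2))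
  have c1 := abs_le.1 (abs_mul_le_mul hx hz')
  have c2 := abs_le.1 (abs_mul_le_mul hy hz')
  rw [← hRz] at c1
  rw [← hIz] at c2
  have hs : s ^ 4 ≤ s ^ 3 := pow_le_pow_of_le_one h0.le h1 (by norm_num)
  have hs3 : 0 < s ^ 3 := by positivity
  constructor <;> fin_cases i <;> simp only [sphereDirReRe, sphereDirImIm] <;> rw [abs_le] <;>
    simp [-neg_le_neg_iff] <;> constructor <;> linarith

/-- The Laplacian of `sphereDir` and the conformal factor. -/
theorem sphereDir_laplacian (ζ : ℂ) (k : Fin 3) :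
    sphereDirReRe ζ k + sphereDirImIm ζ k = -2 * sphereDir ζ k * areaDensity ζ := by
  have hP : (1 : ℝ) + ζ.re ^ 2 + ζ.im ^ 2 ≠ 0 := by positivity
  fin_cases k <;> simp [sphereDirReRe, sphereDirImIm, sphereDirRe, sphereDirIm, areaDensity,
    sphereDir, sphereP_eq] <;> field_simp <;> ring

/-- Stereographic projection is conformal. -/
theorem sphereDir_conformal (ζ : ℂ) (j k : Fin 3) :
    sphereDirRe ζ j * sphereDirRe ζ k + sphereDirIm ζ j * sphereDirIm ζ k
      = ((if j = k then 1 else 0) - sphereDir ζ j * sphereDir ζ k) * areaDensity ζ := by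
  have hP : (1 : ℝ) + ζ.re ^ 2 + ζ.im ^ 2 ≠ 0 := by positivity
  fin_cases j <;> fin_cases k <;> simp [sphereDirRe, sphereDirIm, areaDensity,
    sphereDir, sphereP_eq] <;> field_simp <;> ring

/-! ### Integration of tangential gradients -/

/-- `G` is the gradient in `ℝ³` of an extension of the function `g` of the sphere. -/
structure HasSphereGrad (g : ℂ → ℂ) (G : Fin 3 → ℂ → ℂ) : Prop where
  bdd : IsBddCont g
  bdd_grad : ∀ j, IsBddCont (G j)
  deriv_re : ∀ x y : ℝ, HasDerivAt (fun x : ℝ => g ⟨x, y⟩)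
    (∑ j, (sphereDirRe ⟨x, y⟩ j : ℂ) * G j ⟨x, y⟩) x
  deriv_im : ∀ x y : ℝ, HasDerivAt (fun y : ℝ => g ⟨x, y⟩)
    (∑ j, (sphereDirIm ⟨x, y⟩ j : ℂ) * G j ⟨x, y⟩) y

namespace HasSphereGrad

variable {f g : ℂ → ℂ} {F G : Fin 3 → ℂ → ℂ}

theorem const (c : ℂ) : HasSphereGrad (fun _ => c) (fun _ _ => 0) where
  bdd := .const c
  bdd_grad _ := .const 0
  deriv_re x y := by simpa using hasDerivAt_const x c
  deriv_im x y := by simpa using hasDerivAt_const y c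

theorem sphereDir (i : Fin 3) :
    HasSphereGrad (fun ζ => (sphereDir ζ i : ℂ)) (fun j _ => if i = j then 1 else 0) where
  bdd := .sphereDir i
  bdd_grad _ := .const _
  deriv_re x y := by simpa using (hasDerivAt_sphereDir_re x y i).ofReal_comp
  deriv_im x y := by simpa using (hasDerivAt_sphereDir_im x y i).ofReal_comp

theorem add (hf : HasSphereGrad f F) (hg : HasSphereGrad g G) :
    HasSphereGrad (fun ζ => f ζ + g ζ) (fun j ζ => F j ζ + G j ζ) where
  bdd := hf.bdd.add hg.bdd
  bdd_grad j := (hf.bdd_grad j).add (hg.bdd_grad j)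
  deriv_re x y := by
    refine ((hf.deriv_re x y).add (hg.deriv_re x y)).congr_deriv ?_
    simp only [mul_add, Finset.sum_add_distrib]
  deriv_im x y := by
    refine ((hf.deriv_im x y).add (hg.deriv_im x y)).congr_deriv ?_
    simp only [mul_add, Finset.sum_add_distrib]

theorem mul (hf : HasSphereGrad f F) (hg : HasSphereGrad g G) :
    HasSphereGrad (fun ζ => f ζ * g ζ) (fun j ζ => F j ζ * g ζ + f ζ * G j ζ) where
  bdd := hf.bdd.mul hg.bdd
  bdd_grad j := ((hf.bdd_grad j).mul hg.bdd).add (hf.bdd.mul (hg.bdd_grad j))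
  deriv_re x y := by
    refine ((hf.deriv_re x y).mul (hg.deriv_re x y)).congr_deriv ?_
    simp only [Fin.sum_univ_three]; ring
  deriv_im x y := by
    refine ((hf.deriv_im x y).mul (hg.deriv_im x y)).congr_deriv ?_
    simp only [Fin.sum_univ_three]; ring

theorem sum {ι : Type*} (s : Finset ι) {f : ι → ℂ → ℂ} {F : ι → Fin 3 → ℂ → ℂ}
    (h : ∀ i ∈ s, HasSphereGrad (f i) (F i)) :
    HasSphereGrad (fun ζ => ∑ i ∈ s, f i ζ) (fun j ζ => ∑ i ∈ s, F i j ζ) := by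
  classical
  induction s using Finset.induction_on with
  | empty => simpa using const 0
  | insert a s ha ih =>
    simp only [Finset.sum_insert ha]
    exact (h a (by simp)).add (ih fun i hi => h i (by simp [hi]))

end HasSphereGrad

theorem tendsto_inv_sqrt_sphereP_sq :
    Tendsto (fun ζ => (√(sphereP ζ))⁻¹ ^ 2) (cocompact ℂ) (𝓝 0) := by
  have h : (fun ζ => (√(sphereP ζ))⁻¹ ^ 2) = fun ζ => (sphereP ζ)⁻¹ := by
    ext ζ; rw [(inv_sqrt_sphereP_mem ζ).2.2, one_div]
  rw [h]
  refine tendsto_inv_atTop_zero.comp ?_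
  have h1 := (tendsto_pow_atTop (n := 2) two_ne_zero).comp (tendsto_norm_cocompact_atTop (E := ℂ))
  exact tendsto_atTop_add_const_left _ 1 h1

/-- The planar field g ∇x_k decays, so its divergence ∇g·∇x_k + g Δx_k integrates to zero.
Conformality of the stereographic projection turns the first term into the tangential gradient times
the area density, and Δx_k = -2 x_k · 4/P² produces the right side. -/
theorem sphereIntegral_tangential {g : ℂ → ℂ} {G : Fin 3 → ℂ → ℂ}
    (h : HasSphereGrad g G) (k : Fin 3) :
    sphereIntegral (fun ζ => G k ζ - sphereDir ζ k * ∑ j, (sphereDir ζ j : ℂ) * G j ζ)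
      = 2 * sphereIntegral (fun ζ => sphereDir ζ k * g ζ) := by
  obtain ⟨C, hC⟩ := h.bdd.bounded
  choose D hD using fun j => (h.bdd_grad j).bounded
  have hC0 : 0 ≤ C := (norm_nonneg _).trans (hC 0)
  have hD0 : ∀ j, 0 ≤ D j := fun j => (norm_nonneg _).trans (hD j 0)
  have hgc := h.bdd.continuous
  have hGc := fun j => (h.bdd_grad j).continuous
  -- decay of the two components of the flux and of their derivatives
  have decay : ∀ (E : ℂ → Fin 3 → ℝ), (∀ ζ i, |E ζ i| ≤ 6 * (√(sphereP ζ))⁻¹ ^ 2) →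
      Tendsto (fun ζ => g ζ * (E ζ k : ℂ)) (cocompact ℂ) (𝓝 0) := by
    intro E hE
    refine squeeze_zero_norm (a := fun ζ => C * 6 * (√(sphereP ζ))⁻¹ ^ 2) (fun ζ => ?_) ?_
    · rw [norm_mul, Complex.norm_real, Real.norm_eq_abs, mul_assoc]
      exact mul_le_mul (hC ζ) (hE ζ k) (abs_nonneg _) hC0
    · simpa using tendsto_inv_sqrt_sphereP_sq.const_mul (C * 6)
  have integ : ∀ (E E' : ℂ → Fin 3 → ℝ), (∀ ζ i, |E ζ i| ≤ 6 * (√(sphereP ζ))⁻¹ ^ 2) →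
      (∀ ζ i, |E' ζ i| ≤ 36 * (√(sphereP ζ))⁻¹ ^ 3) → (∀ i, Continuous fun ζ => E ζ i) →
      (∀ i, Continuous fun ζ => E' ζ i) →
      Integrable fun ζ => (∑ j, (E ζ j : ℂ) * G j ζ) * (E ζ k : ℂ) + g ζ * (E' ζ k : ℂ) := by
    intro E E' hE hE' hEc hEc'
    refine (integrable_inv_sqrt_sphereP_cube.const_mul (36 * (∑ j, D j) + 36 * C)).mono'
      (Continuous.aestronglyMeasurable (by fun_prop)) (Eventually.of_forall fun ζ => ?_)
    obtain ⟨h0, h1, -⟩ := inv_sqrt_sphereP_mem ζ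
    have hs : (√(sphereP ζ))⁻¹ ^ 4 ≤ (√(sphereP ζ))⁻¹ ^ 3 :=
      pow_le_pow_of_le_one h0.le h1 (by norm_num)
    have e1 : ‖∑ j, (E ζ j : ℂ) * G j ζ‖ ≤ 6 * (√(sphereP ζ))⁻¹ ^ 2 * ∑ j, D j := by
      rw [Finset.mul_sum]
      refine norm_sum_le_of_le _ fun j _ => ?_
      rw [norm_mul, Complex.norm_real, Real.norm_eq_abs]
      exact mul_le_mul (hE ζ j) (hD j ζ) (norm_nonneg _) (by positivity)
    have e2 : ‖(∑ j, (E ζ j : ℂ) * G j ζ) * (E ζ k : ℂ)‖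
        ≤ 36 * (∑ j, D j) * (√(sphereP ζ))⁻¹ ^ 4 := by
      rw [norm_mul, Complex.norm_real, Real.norm_eq_abs]
      refine (mul_le_mul e1 (hE ζ k) (abs_nonneg _) ?_).trans_eq (by ring)
      exact mul_nonneg (by positivity) (Finset.sum_nonneg fun j _ => hD0 j)
    have e3 : ‖g ζ * (E' ζ k : ℂ)‖ ≤ C * (36 * (√(sphereP ζ))⁻¹ ^ 3) := by
      rw [norm_mul, Complex.norm_real, Real.norm_eq_abs]
      exact mul_le_mul (hC ζ) (hE' ζ k) (abs_nonneg _) hC0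
    have e4 : 36 * (∑ j, D j) * (√(sphereP ζ))⁻¹ ^ 4 ≤ 36 * (∑ j, D j) * (√(sphereP ζ))⁻¹ ^ 3 :=
      mul_le_mul_of_nonneg_left hs (mul_nonneg (by norm_num) (Finset.sum_nonneg fun j _ => hD0 j))
    refine (norm_add_le _ _).trans ?_
    linarith
  have bR := fun ζ i => (abs_sphereDir_deriv_le ζ i).1
  have bI := fun ζ i => (abs_sphereDir_deriv_le ζ i).2
  have iR := integ sphereDirRe sphereDirReRe bR (fun ζ i => (abs_sphereDir_deriv2_le ζ i).1)
    (by fun_prop) (by fun_prop)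
  have iI := integ sphereDirIm sphereDirImIm bI (fun ζ i => (abs_sphereDir_deriv2_le ζ i).2)
    (by fun_prop) (by fun_prop)
  have zR := integral_re_deriv_eq_zero
    (fun x y => (h.deriv_re x y).mul (hasDerivAt_sphereDirRe x y k).ofReal_comp) iR
    (decay _ bR)
  have zI := integral_im_deriv_eq_zero
    (fun x y => (h.deriv_im x y).mul (hasDerivAt_sphereDirIm x y k).ofReal_comp) iI
    (decay _ bI)
  have htot := integral_add iR iI
  rw [zR, zI, add_zero] at htot
  have hb : IsBddCont fun ζ => G k ζ - sphereDir ζ k * ∑ j, (sphereDir ζ j : ℂ) * G j ζ :=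
    (h.bdd_grad k).sub ((IsBddCont.sphereDir k).mul
      (IsBddCont.sum _ fun j _ => (IsBddCont.sphereDir j).mul (h.bdd_grad j)))
  rw [← sub_eq_zero, ← sphereIntegral_const_mul, ← sphereIntegral_sub hb
    ((IsBddCont.const 2).mul ((IsBddCont.sphereDir k).mul h.bdd)), ← htot]
  refine integral_congr_ae (Eventually.of_forall fun ζ => ?_)
  have c1 : (sphereDirReRe ζ k : ℂ) + sphereDirImIm ζ k = -2 * sphereDir ζ k * areaDensity ζ := by
    exact_mod_cast sphereDir_laplacian ζ k
  have c2 : ∀ j, (sphereDirRe ζ j : ℂ) * sphereDirRe ζ k + sphereDirIm ζ j * sphereDirIm ζ k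
      = ((if j = k then 1 else 0) - sphereDir ζ j * sphereDir ζ k) * areaDensity ζ := fun j => by
    have := sphereDir_conformal ζ j k
    split_ifs at this ⊢ <;> exact_mod_cast this
  have c3 : G k ζ = ∑ j, (if j = k then (1 : ℂ) else 0) * G j ζ := by simp
  change (G k ζ - _ - _) * (areaDensity ζ : ℂ) = _
  rw [c3]
  simp only [Fin.sum_univ_three]
  linear_combination (-g ζ) * c1 - G 0 ζ * c2 0 - G 1 ζ * c2 1 - G 2 ζ * c2 2

/-! ### Moments of the sphere and `l = 1` coefficients -/

/-- All moments up to degree three come from the tangential divergence identity applied to g = 1,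
x_j and x_i x_j. No integral over the plane is evaluated, and the area of the sphere stays a symbol.
-/
theorem sphereIntegral_sphereDir (k : Fin 3) :
    sphereIntegral (fun ζ => (sphereDir ζ k : ℂ)) = 0 := by
  have h := sphereIntegral_tangential (HasSphereGrad.const 1) k
  simp [sphereIntegral_const] at h
  exact h

theorem sphereIntegral_sphereDir_mul (j k : Fin 3) :
    sphereIntegral (fun ζ => (sphereDir ζ j : ℂ) * sphereDir ζ k)
      = (if j = k then 1 else 0) * sphereArea / 3 := by
  have h := sphereIntegral_tangential (HasSphereGrad.sphereDir j) k
  simp only [mul_ite, mul_one, mul_zero, Finset.sum_ite_eq, Finset.mem_univ, if_true] at h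
  rw [sphereIntegral_sub (.const _) ((IsBddCont.sphereDir k).mul (.sphereDir j)),
    sphereIntegral_const] at h
  simp only [mul_comm (sphereDir _ k : ℂ)] at h
  linear_combination -h / 3

theorem sphereIntegral_sphereDir_mul_mul (i j k : Fin 3) :
    sphereIntegral (fun ζ => (sphereDir ζ i : ℂ) * sphereDir ζ j * sphereDir ζ k) = 0 := by
  have hx := IsBddCont.sphereDir
  have h := sphereIntegral_tangential ((HasSphereGrad.sphereDir i).mul (.sphereDir j)) k
  have e : ∀ ζ, ((if i = k then (1 : ℂ) else 0) * sphereDir ζ j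
      + sphereDir ζ i * (if j = k then 1 else 0)) - sphereDir ζ k * ∑ l, (sphereDir ζ l : ℂ) *
        ((if i = l then 1 else 0) * sphereDir ζ j + sphereDir ζ i * (if j = l then 1 else 0))
      = ((if i = k then (1 : ℂ) else 0) * sphereDir ζ j
        + sphereDir ζ i * (if j = k then 1 else 0))
        - 2 * (sphereDir ζ i * sphereDir ζ j * sphereDir ζ k) := by
    intro ζ
    -- Euler's identity for the quadratic polynomial x_i x_j.
    have : ∑ l, (sphereDir ζ l : ℂ) *
        ((if i = l then 1 else 0) * sphereDir ζ j + sphereDir ζ i * (if j = l then 1 else 0))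
        = 2 * (sphereDir ζ i * sphereDir ζ j) := by
      simp [mul_add, Finset.sum_add_distrib]; ring
    rw [this]; ring
  rw [funext e, sphereIntegral_sub (((IsBddCont.const _).mul (hx j)).add ((hx i).mul (.const _)))
    ((IsBddCont.const 2).mul (((hx i).mul (hx j)).mul (hx k))),
    sphereIntegral_add ((IsBddCont.const _).mul (hx j)) ((hx i).mul (.const _)),
    sphereIntegral_const_mul, sphereIntegral_mul_const, sphereIntegral_const_mul,
    sphereIntegral_sphereDir, sphereIntegral_sphereDir] at h
  simp only [mul_comm (sphereDir _ k : ℂ)] at h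
  linear_combination -h / 4

theorem sphereIntegral_Y1_mul_star (i k : Fin 3) :
    sphereIntegral (fun ζ => Y1 0 i ζ * star (Y1 0 k ζ))
      = (if i = k then 1 else 0) * sphereArea / 3 := by
  have hx := IsBddCont.sphereDir
  have e : ∀ ζ, Y1 0 i ζ * star (Y1 0 k ζ) = (1 / 2) * ((if i = k then 1 else 0)
      - sphereDir ζ i * sphereDir ζ k
      - Complex.I * ∑ l, (leviCivita i k l : ℂ) * sphereDir ζ l) := fun ζ => by
    rw [Y1_zero_mul_star]; ring
  rw [funext e, sphereIntegral_const_mul,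
    sphereIntegral_sub ((IsBddCont.const _).sub ((hx i).mul (hx k)))
      ((IsBddCont.const _).mul (.sum _ fun l _ => (IsBddCont.const _).mul (hx l))),
    sphereIntegral_sub (.const _) ((hx i).mul (hx k)), sphereIntegral_const,
    sphereIntegral_sphereDir_mul, sphereIntegral_const_mul,
    sphereIntegral_sum _ (fun l _ => (IsBddCont.const _).mul (hx l))]
  simp only [sphereIntegral_const_mul, sphereIntegral_sphereDir, mul_zero, Finset.sum_const_zero]
  ring

theorem leviCivita_swap (i j k : Fin 3) : leviCivita i k j = -leviCivita i j k := by
  unfold leviCivita; ring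

/-- Odd moments vanish, so only the antisymmetric part of Y_i conj(Y_k) contributes, through the
second moment of x. This Clebsch–Gordan coefficient is the origin of the cross product in the final
formula. -/
theorem sphereIntegral_sphereDir_mul_Y1_mul_star (i j k : Fin 3) :
    sphereIntegral (fun ζ => sphereDir ζ j * Y1 0 i ζ * star (Y1 0 k ζ))
      = Complex.I / 2 * leviCivita i j k * sphereArea / 3 := by
  have hx := IsBddCont.sphereDir
  have e : ∀ ζ, sphereDir ζ j * Y1 0 i ζ * star (Y1 0 k ζ)
      = (1 / 2) * ((if i = k then 1 else 0) * sphereDir ζ j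
      - sphereDir ζ j * sphereDir ζ i * sphereDir ζ k
      - Complex.I * ∑ l, (leviCivita i k l : ℂ) * (sphereDir ζ j * sphereDir ζ l)) := fun ζ => by
    rw [mul_assoc, Y1_zero_mul_star]
    simp only [Fin.sum_univ_three]
    ring
  rw [funext e, sphereIntegral_const_mul,
    sphereIntegral_sub (((IsBddCont.const _).mul (hx j)).sub (((hx j).mul (hx i)).mul (hx k)))
      ((IsBddCont.const _).mul (.sum _ fun l _ => (IsBddCont.const _).mul ((hx j).mul (hx l)))),
    sphereIntegral_sub ((IsBddCont.const _).mul (hx j)) (((hx j).mul (hx i)).mul (hx k)),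
    sphereIntegral_const_mul, sphereIntegral_const_mul, sphereIntegral_sphereDir,
    sphereIntegral_sphereDir_mul_mul,
    sphereIntegral_sum _ (fun l _ => (IsBddCont.const _).mul ((hx j).mul (hx l)))]
  simp only [sphereIntegral_const_mul, sphereIntegral_sphereDir_mul]
  have : ∑ l, (leviCivita i k l : ℂ) * ((if j = l then 1 else 0) * (sphereArea : ℂ) / 3)
      = leviCivita i k j * sphereArea / 3 := by
    rw [Finset.sum_eq_single j] <;> simp +contextual [eq_comm, mul_div_assoc]
  rw [this, leviCivita_swap]
  push_cast; ring

theorem sphereArea_ne : (sphereArea : ℂ) ≠ 0 := by exact_mod_cast sphereArea_pos.ne'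

/-- The normalising integral is a third of the area. In coefficients of explicit harmonics the area
cancels, which is why its value 4π is never needed. -/
theorem coeff1_zero_eq (f : ℂ → ℂ) (k : Fin 3) :
    coeff1 0 f k = sphereIntegral (fun ζ => f ζ * star (Y1 0 k ζ)) * (3 / sphereArea) := by
  have := sphereArea_ne
  rw [coeff1, sphereIntegral_Y1_mul_star]
  simp; field_simp

theorem coeff1_one_eq (f : ℂ → ℂ) (k : Fin 3) :
    coeff1 1 f k = sphereIntegral (fun ζ => f ζ * star (Y1 1 k ζ)) * (3 / (2 * sphereArea)) := by
  have := sphereArea_ne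
  have e : ∀ ζ, Y1 1 k ζ * star (Y1 1 k ζ) = 2 * (sphereDir ζ k * sphereDir ζ k) := fun ζ => by
    rw [Y1_one, Complex.star_def, Complex.conj_ofReal, ← Complex.ofReal_mul,
      show √2 * sphereDir ζ k * (√2 * sphereDir ζ k) = (√2 * √2) * (sphereDir ζ k * sphereDir ζ k)
        by ring, Real.mul_self_sqrt (by norm_num)]
    push_cast; ring
  rw [coeff1, funext e, sphereIntegral_const_mul, sphereIntegral_sphereDir_mul]
  simp; field_simp

section coeff1

variable {f g : ℂ → ℂ} (k : Fin 3)

theorem coeff1_zero_add (hf : IsBddCont f) (hg : IsBddCont g) :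
    coeff1 0 (fun ζ => f ζ + g ζ) k = coeff1 0 f k + coeff1 0 g k := by
  simp only [coeff1_zero_eq, add_mul]
  rw [sphereIntegral_add (hf.mul (IsBddCont.Y1 0 k).star) (hg.mul (IsBddCont.Y1 0 k).star)]
  ring

theorem coeff1_zero_sub (hf : IsBddCont f) (hg : IsBddCont g) :
    coeff1 0 (fun ζ => f ζ - g ζ) k = coeff1 0 f k - coeff1 0 g k := by
  simp only [coeff1_zero_eq, sub_mul]
  rw [sphereIntegral_sub (hf.mul (IsBddCont.Y1 0 k).star) (hg.mul (IsBddCont.Y1 0 k).star)]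
  ring

theorem coeff1_zero_const_mul (c : ℂ) (f : ℂ → ℂ) :
    coeff1 0 (fun ζ => c * f ζ) k = c * coeff1 0 f k := by
  simp only [coeff1_zero_eq, mul_assoc]
  rw [sphereIntegral_const_mul]
  ring

theorem coeff1_zero_sum {ι : Type*} (s : Finset ι) {f : ι → ℂ → ℂ}
    (h : ∀ i ∈ s, IsBddCont (f i)) :
    coeff1 0 (fun ζ => ∑ i ∈ s, f i ζ) k = ∑ i ∈ s, coeff1 0 (f i) k := by
  simp only [coeff1_zero_eq, Finset.sum_mul]
  rw [sphereIntegral_sum s fun i hi => (h i hi).mul (IsBddCont.Y1 0 k).star, Finset.sum_mul]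

theorem coeff1_zero_Y1 (i : Fin 3) : coeff1 0 (Y1 0 i) k = if i = k then 1 else 0 := by
  have := sphereArea_ne
  rw [coeff1_zero_eq, sphereIntegral_Y1_mul_star]
  field_simp

theorem coeff1_zero_sphereDir_mul_Y1 (i j : Fin 3) :
    coeff1 0 (fun ζ => sphereDir ζ j * Y1 0 i ζ) k = Complex.I / 2 * leviCivita i j k := by
  have := sphereArea_ne
  rw [coeff1_zero_eq, sphereIntegral_sphereDir_mul_Y1_mul_star]
  field_simp

theorem norm_coeff1_zero_le {C : ℝ} (hC : ∀ ζ, ‖f ζ‖ ≤ C) : ‖coeff1 0 f k‖ ≤ 6 * C := by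
  have hA := sphereArea_pos
  have hC0 : 0 ≤ C := (norm_nonneg _).trans (hC 0)
  rw [coeff1_zero_eq, norm_mul, norm_div, Complex.norm_real, Real.norm_of_nonneg hA.le]
  have : ‖sphereIntegral (fun ζ => f ζ * star (Y1 0 k ζ))‖ ≤ C * 2 * sphereArea := by
    refine norm_sphereIntegral_le fun ζ => ?_
    rw [norm_mul, norm_star]
    exact mul_le_mul (hC ζ) (norm_Y1_le 0 k ζ) (norm_nonneg _) hC0
  refine (mul_le_mul_of_nonneg_right this (by positivity)).trans_eq ?_
  rw [RCLike.norm_ofNat]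
  field_simp; ring

/-- Orthogonality is needed for spin one only: the l ≥ 2 parts of φ_1^0 and φ_2^0 are always
multiplied by the angle field and thereby become negligible before any projection. -/
theorem coeff1_zero_higherPart (hf : IsBddCont f) : coeff1 0 (higherPart 0 f) k = 0 := by
  have hs : IsBddCont fun ζ => ∑ i, coeff1 0 f i * Y1 0 i ζ :=
    .sum _ fun i _ => (IsBddCont.const _).mul (.Y1 0 i)
  have e : higherPart 0 f = fun ζ => f ζ - ∑ i, coeff1 0 f i * Y1 0 i ζ := by
    ext ζ; simp [higherPart]
  rw [e, coeff1_zero_sub k hf hs,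
    coeff1_zero_sum k _ fun i _ => (IsBddCont.const _).mul (.Y1 0 i)]
  simp [coeff1_zero_const_mul, coeff1_zero_Y1]

end coeff1

/-! ### The `l = 1` part of the Maxwell equations on a sphere -/

theorem sphereIntegral_tangential_sub {g : ℂ → ℂ} {G : Fin 3 → ℂ → ℂ}
    (h : HasSphereGrad g G) (k : Fin 3) :
    IsBddCont (fun ζ => G k ζ - sphereDir ζ k * ∑ j, (sphereDir ζ j : ℂ) * G j ζ
      - 2 * (sphereDir ζ k * g ζ)) ∧
    sphereIntegral (fun ζ => G k ζ - sphereDir ζ k * ∑ j, (sphereDir ζ j : ℂ) * G j ζ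
      - 2 * (sphereDir ζ k * g ζ)) = 0 := by
  have hx := IsBddCont.sphereDir
  have h1 : IsBddCont fun ζ => G k ζ - sphereDir ζ k * ∑ j, (sphereDir ζ j : ℂ) * G j ζ :=
    (h.bdd_grad k).sub ((hx k).mul (.sum _ fun j _ => (hx j).mul (h.bdd_grad j)))
  have h2 : IsBddCont fun ζ => 2 * ((sphereDir ζ k : ℂ) * g ζ) :=
    (IsBddCont.const 2).mul ((hx k).mul h.bdd)
  refine ⟨h1.sub h2, ?_⟩
  rw [sphereIntegral_sub h1 h2, sphereIntegral_tangential h k, sphereIntegral_const_mul, sub_self]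

/-- An integration by parts valid for any vector field W with gradient G: the integrands differ by a
combination of tangential divergences, each of integral zero. Applied to W = E + iB on a large
sphere, it yields the l = 1 part of the evolution of φ_0. -/
theorem sphereIntegral_maxwell {W : Fin 3 → ℂ → ℂ} {G : Fin 3 → Fin 3 → ℂ → ℂ}
    (h : ∀ l, HasSphereGrad (W l) (fun j => G j l)) (k : Fin 3) :
    sphereIntegral (fun ζ => ∑ l, (W l ζ
        + Complex.I * ∑ a, ∑ b, (leviCivita l a b : ℂ) * G a b ζ
        + ∑ j, (sphereDir ζ j : ℂ) * G j l ζ) * (Y1 0 l ζ * star (Y1 0 k ζ)))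
      = sphereIntegral (fun ζ => sphereDir ζ k * ∑ l, W l ζ * sphereDir ζ l) := by
  have hx := IsBddCont.sphereDir
  have hxg := HasSphereGrad.sphereDir
  -- The divergence identity for the radial component of W, in the direction k.
  have t0 := sphereIntegral_tangential_sub
    (HasSphereGrad.sum Finset.univ fun l _ => (hxg l).mul (h l)) k
  -- The same for the i-th component of W × (e_k - x_k n), the product with the tangential part of
  -- the k-th basis vector. The sum over i, weighted by I, accounts for the curl term.
  have ti := fun i => sphereIntegral_tangential_sub
    ((HasSphereGrad.sum Finset.univ fun j _ => (HasSphereGrad.const (leviCivita k i j)).mul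
      (h j)).add (((HasSphereGrad.const (-1)).mul (hxg k)).mul
        (HasSphereGrad.sum Finset.univ fun l _ => (hxg l).mul
          (HasSphereGrad.sum Finset.univ fun j _ =>
            (HasSphereGrad.const (leviCivita l i j)).mul (h j))))) i
  have b1 : IsBddCont fun ζ => ∑ l, (W l ζ
        + Complex.I * ∑ a, ∑ b, (leviCivita l a b : ℂ) * G a b ζ
        + ∑ j, (sphereDir ζ j : ℂ) * G j l ζ) * (Y1 0 l ζ * star (Y1 0 k ζ)) :=
    .sum _ fun l _ => ((((h l).bdd).add ((IsBddCont.const _).mul (.sum _ fun a _ => .sum _ fun b _ =>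
      (IsBddCont.const _).mul ((h b).bdd_grad a)))).add
        (.sum _ fun j _ => (hx j).mul ((h l).bdd_grad j))).mul ((IsBddCont.Y1 0 l).mul
          (IsBddCont.Y1 0 k).star)
  have b2 : IsBddCont fun ζ => sphereDir ζ k * ∑ l, W l ζ * sphereDir ζ l :=
    (hx k).mul (.sum _ fun l _ => ((h l).bdd).mul (hx l))
  have hz := sphereIntegral_add t0.1 ((IsBddCont.const Complex.I).mul
    (.sum Finset.univ fun i _ => (ti i).1))
  rw [t0.2, sphereIntegral_const_mul, sphereIntegral_sum _ fun i _ => (ti i).1,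
    Finset.sum_congr rfl fun i _ => (ti i).2, Finset.sum_const_zero, mul_zero, add_zero] at hz
  rw [← sub_eq_zero, ← sphereIntegral_sub b1 b2, ← mul_zero (1 / 2 : ℂ), ← hz,
    ← sphereIntegral_const_mul]
  congr 1
  ext ζ
  simp only [Y1_zero_mul_star]
  have hI : Complex.I ^ 2 = -1 := Complex.I_sq
  fin_cases k <;> simp [Fin.sum_univ_three, leviCivita_values, leviCivita_self_left,
    leviCivita_self_right, leviCivita_self_outer] <;> ring_nf <;> simp only [hI] <;> ring

/-! ### Tetrad components near null infinity -/

/-- The self-dual part `E + i B` of a two-form. -/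
noncomputable def selfDual (F : Fin 4 → Fin 4 → ℝ) : Fin 3 → ℂ :=
  ![-(F 0 1 : ℂ) + Complex.I * F 2 3, -(F 0 2 : ℂ) + Complex.I * F 3 1,
    -(F 0 3 : ℂ) + Complex.I * F 1 2]

/-- The vector m is an eigenvector of n × with eigenvalue -i. In φ_0 this merges the electric and
magnetic contributions into the combination E + iB. -/
theorem sphereDir_cross_Y1 (ζ : ℂ) :
    (sphereDir ζ 1 : ℂ) * Y1 0 2 ζ - sphereDir ζ 2 * Y1 0 1 ζ = -Complex.I * Y1 0 0 ζ ∧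
    (sphereDir ζ 2 : ℂ) * Y1 0 0 ζ - sphereDir ζ 0 * Y1 0 2 ζ = -Complex.I * Y1 0 1 ζ ∧
    (sphereDir ζ 0 : ℂ) * Y1 0 1 ζ - sphereDir ζ 1 * Y1 0 0 ζ = -Complex.I * Y1 0 2 ζ := by
  have h : (sphereP ζ : ℂ) ≠ 0 := by exact_mod_cast sphereP_ne ζ
  have e : (sphereP ζ : ℂ) = 1 + ζ.re ^ 2 + ζ.im ^ 2 := by exact_mod_cast sphereP_eq ζ
  have e2 := star_eq_re_sub_im_mul_I ζ
  simp only [Y1_zero_eq, e2]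
  simp only [sphereDir]
  generalize ζ.re = a at *
  generalize ζ.im = b at *
  generalize sphereP ζ = p at *
  have I3 : Complex.I ^ 3 = -Complex.I := Complex.I_pow_three
  have I4 : Complex.I ^ 4 = 1 := Complex.I_pow_four
  refine ⟨?_, ?_, ?_⟩ <;> simp <;> field_simp <;> rw [e] <;> ring_nf <;>
    simp only [Complex.I_sq, I3, I4] <;> ring

theorem bondiM_zero (ζ : ℂ) : bondiM ζ 0 = 0 := by simp [bondiM, mHat_zero]

theorem bondiM_succ (ζ : ℂ) (i : Fin 3) : bondiM ζ i.succ = Y1 0 i ζ := by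
  simp [bondiM, mHat_succ]

theorem antisymm_entries {F : Fin 4 → Fin 4 → ℝ} (hF : ∀ a b, F a b = -F b a) :
    (∀ a, F a a = 0) ∧ F 1 0 = -F 0 1 ∧ F 2 0 = -F 0 2 ∧ F 3 0 = -F 0 3 ∧ F 2 1 = -F 1 2 ∧
      F 3 2 = -F 2 3 ∧ F 1 3 = -F 3 1 :=
  ⟨fun a => by linarith [hF a a], hF _ _, hF _ _, hF _ _, hF _ _, hF _ _, hF _ _⟩

theorem tetradPhi_zero_eq {F : Fin 4 → Fin 4 → ℝ} (hF : ∀ a b, F a b = -F b a) (ζ : ℂ) :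
    tetradPhi F (lHat ζ) (nHat ζ) (bondiM ζ) (fun a => star (bondiM ζ a)) 0
      = -(√2 / 2 : ℝ) * ∑ l, selfDual F l * Y1 0 l ζ := by
  obtain ⟨h0, h1, h2, h3, h4, h5, h6⟩ := antisymm_entries hF
  obtain ⟨c0, c1, c2⟩ := sphereDir_cross_Y1 ζ
  have m0 := bondiM_zero ζ
  have l0 := lHat_zero ζ
  have m1 : bondiM ζ 1 = _ := bondiM_succ ζ 0
  have m2 : bondiM ζ 2 = _ := bondiM_succ ζ 1
  have m3 : bondiM ζ 3 = _ := bondiM_succ ζ 2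
  have l1 : lHat ζ 1 = _ := lHat_succ ζ 0
  have l2 : lHat ζ 2 = _ := lHat_succ ζ 1
  have l3 : lHat ζ 3 = _ := lHat_succ ζ 2
  simp only [tetradPhi, contract, Matrix.cons_val, Fin.sum_univ_four, Fin.sum_univ_three,
    m0, m1, m2, m3, l0, l1, l2, l3, h0, h1, h2, h3, h4, h5, h6, selfDual]
  push_cast
  linear_combination (√2 / 2 : ℂ) * (F 2 3 : ℂ) * c0 + (√2 / 2 : ℂ) * (F 3 1 : ℂ) * c1
    + (√2 / 2 : ℂ) * (F 1 2 : ℂ) * c2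

theorem Y1_cross_star (ζ : ℂ) :
    star (Y1 0 1 ζ) * Y1 0 2 ζ - star (Y1 0 2 ζ) * Y1 0 1 ζ = Complex.I * sphereDir ζ 0 ∧
    star (Y1 0 2 ζ) * Y1 0 0 ζ - star (Y1 0 0 ζ) * Y1 0 2 ζ = Complex.I * sphereDir ζ 1 ∧
    star (Y1 0 0 ζ) * Y1 0 1 ζ - star (Y1 0 1 ζ) * Y1 0 0 ζ = Complex.I * sphereDir ζ 2 := by
  have h := fun i k => Y1_zero_mul_star i k ζ
  simp only [mul_comm (star _)]
  simp only [h, Fin.sum_univ_three]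
  refine ⟨?_, ?_, ?_⟩ <;> simp [leviCivita_values, leviCivita_self_right,
    leviCivita_self_outer] <;> ring

/-- The term F(l, n) gives the radial electric field, and F(m̄, m) gives i times the radial magnetic
field because m̄ × m = i n. -/
theorem tetradPhi_one_eq {F : Fin 4 → Fin 4 → ℝ} (hF : ∀ a b, F a b = -F b a) (ζ : ℂ) :
    tetradPhi F (lHat ζ) (nHat ζ) (bondiM ζ) (fun a => star (bondiM ζ a)) 1
      = (1 / 2) * ∑ l, selfDual F l * sphereDir ζ l := by
  obtain ⟨h0, h1, h2, h3, h4, h5, h6⟩ := antisymm_entries hF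
  obtain ⟨c0, c1, c2⟩ := Y1_cross_star ζ
  have hs : ((√2 : ℝ) : ℂ) ^ 2 = 2 := by
    rw [← Complex.ofReal_pow, Real.sq_sqrt (by norm_num)]; norm_num
  have m0 := bondiM_zero ζ
  have l0 := lHat_zero ζ
  have n0 := nHat_zero ζ
  have m1 : bondiM ζ 1 = _ := bondiM_succ ζ 0
  have m2 : bondiM ζ 2 = _ := bondiM_succ ζ 1
  have m3 : bondiM ζ 3 = _ := bondiM_succ ζ 2
  have l1 : lHat ζ 1 = _ := lHat_succ ζ 0
  have l2 : lHat ζ 2 = _ := lHat_succ ζ 1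
  have l3 : lHat ζ 3 = _ := lHat_succ ζ 2
  have n1 : nHat ζ 1 = _ := nHat_succ ζ 0
  have n2 : nHat ζ 2 = _ := nHat_succ ζ 1
  have n3 : nHat ζ 3 = _ := nHat_succ ζ 2
  simp only [tetradPhi, contract, Matrix.cons_val, Fin.sum_univ_four, Fin.sum_univ_three,
    m0, m1, m2, m3, l0, l1, l2, l3, n0, n1, n2, n3, h0, h1, h2, h3, h4, h5, h6, selfDual, star_zero]
  push_cast
  linear_combination (1 / 2) * (F 2 3 : ℂ) * c0 + (1 / 2) * (F 3 1 : ℂ) * c1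
    + (1 / 2) * (F 1 2 : ℂ) * c2 - (1 / 4) * ((F 0 1 : ℂ) * sphereDir ζ 0 + F 0 2 * sphereDir ζ 1
      + F 0 3 * sphereDir ζ 2) * hs

/-! ### Large spheres near null infinity: restriction and differentiation of fields. -/

/-- The point at time `√2 u + r / √2` in direction `v` at distance `r ‖v‖ / √2`. -/
noncomputable def scriPoint (u r : ℝ) (v : Fin 3 → ℝ) : Minkowski :=
  Fin.cons (√2 * u + √2 / 2 * r) fun i => √2 / 2 * r * v i

theorem bondiPoint_eq (u r : ℝ) (ζ : ℂ) : bondiPoint u r ζ = scriPoint u r (sphereDir ζ) := by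
  ext a
  refine Fin.cases ?_ (fun i => ?_) a
  · simp only [bondiPoint, scriPoint, Fin.cons_zero, lHat_zero, nHat_zero]
    simp [-Complex.ofReal_div]; ring
  · simp only [bondiPoint, scriPoint, Fin.cons_succ, lHat_succ, nHat_succ]
    rw [add_neg_cancel, mul_zero, zero_add, ← Complex.ofReal_mul, Complex.ofReal_re]; ring

theorem continuous_scriPoint :
    Continuous fun p : ℝ × ℝ × (Fin 3 → ℝ) => scriPoint p.1 p.2.1 p.2.2 := by
  refine continuous_pi fun a => ?_
  refine Fin.cases ?_ (fun i => ?_) a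
  · simp only [scriPoint, Fin.cons_zero]; fun_prop
  · simp only [scriPoint, Fin.cons_succ]; fun_prop

/-- The unit sphere, as a set of coordinate vectors. -/
def unitVectors : Set (Fin 3 → ℝ) := {v | v 0 ^ 2 + v 1 ^ 2 + v 2 ^ 2 = 1}

theorem sphereDir_mem (ζ : ℂ) : sphereDir ζ ∈ unitVectors := sphereDir_sq ζ

theorem isCompact_unitVectors : IsCompact unitVectors := by
  refine Metric.isCompact_of_isClosed_isBounded
    (isClosed_eq (by fun_prop) continuous_const) ?_
  refine (Metric.isBounded_closedBall (x := 0) (r := 1)).subset fun v hv => ?_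
  rw [mem_closedBall_zero_iff, pi_norm_le_iff_of_nonneg zero_le_one]
  intro i
  have hv' : v 0 ^ 2 + v 1 ^ 2 + v 2 ^ 2 = 1 := hv
  rw [Real.norm_eq_abs]
  apply abs_le_one_iff_mul_self_le_one.2
  fin_cases i <;> simp <;> nlinarith [sq_nonneg (v 0), sq_nonneg (v 1), sq_nonneg (v 2)]

theorem scriPoint_mem {D : Set Minkowski} (hD : ContainsNearScri D) (A B : ℝ) :
    ∃ R > 0, ∀ u ∈ Set.Icc A B, ∀ r ≥ R, ∀ v ∈ unitVectors, scriPoint u r v ∈ D := by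
  obtain ⟨R, hR⟩ := hD (√2 * A) (√2 * B)
  have h2 : 0 < √2 := by positivity
  have h22 : √2 * √2 = 2 := Real.mul_self_sqrt (by norm_num)
  refine ⟨max 1 (√2 * R), by positivity, fun u hu r hr v hv => ?_⟩
  have hr0 : 0 < r := lt_of_lt_of_le one_pos ((le_max_left _ _).trans hr)
  have hs : spatialRadius (scriPoint u r v) = √2 / 2 * r := by
    have e : (scriPoint u r v 1) ^ 2 + (scriPoint u r v 2) ^ 2 + (scriPoint u r v 3) ^ 2
        = (√2 / 2 * r) ^ 2 := by
      have hv' : v 0 ^ 2 + v 1 ^ 2 + v 2 ^ 2 = 1 := hv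
      change (√2 / 2 * r * v 0) ^ 2 + (√2 / 2 * r * v 1) ^ 2 + (√2 / 2 * r * v 2) ^ 2 = _
      linear_combination (√2 / 2 * r) ^ 2 * hv'
    rw [spatialRadius, e, Real.sqrt_sq (by positivity)]
  have ht : scriPoint u r v 0 - spatialRadius (scriPoint u r v) = √2 * u := by
    rw [hs]; simp [scriPoint]
  refine hR _ ?_ ?_ ?_
  · rw [ht]; exact mul_le_mul_of_nonneg_left hu.1 h2.le
  · rw [ht]; exact mul_le_mul_of_nonneg_left hu.2 h2.le
  · rw [hs]
    have := (le_max_right 1 (√2 * R)).trans hr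
    nlinarith

theorem hasDerivAt_sphereIntegral {f f' : ℝ → ℂ → ℂ} {u₀ : ℝ} {s : Set ℝ} (hs : s ∈ 𝓝 u₀)
    (hf : ∀ u ∈ s, IsBddCont (f u)) (hf' : IsBddCont (f' u₀)) {C : ℝ}
    (hC : ∀ u ∈ s, ∀ ζ, ‖f' u ζ‖ ≤ C)
    (hd : ∀ u ∈ s, ∀ ζ, HasDerivAt (fun u => f u ζ) (f' u ζ) u) :
    HasDerivAt (fun u => sphereIntegral (f u)) (sphereIntegral (f' u₀)) u₀ := by
  refine (hasDerivAt_integral_of_dominated_loc_of_deriv_le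
    (F := fun u ζ => f u ζ * ((4 / sphereP ζ ^ 2 : ℝ) : ℂ))
    (F' := fun u ζ => f' u ζ * ((4 / sphereP ζ ^ 2 : ℝ) : ℂ))
    (bound := fun ζ => C * areaDensity ζ) hs ?_ (hf u₀ (mem_of_mem_nhds hs)).integrable
    hf'.integrable.aestronglyMeasurable ?_ (integrable_areaDensity.const_mul C) ?_).2
  · filter_upwards [hs] with u hu using (hf u hu).integrable.aestronglyMeasurable
  · refine Eventually.of_forall fun ζ u hu => ?_
    rw [norm_mul, Complex.norm_real]
    change _ * ‖areaDensity ζ‖ ≤ _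
    rw [Real.norm_of_nonneg (areaDensity_nonneg ζ)]
    exact mul_le_mul_of_nonneg_right (hC u hu ζ) (areaDensity_nonneg ζ)
  · exact Eventually.of_forall fun ζ u hu => (hd u hu ζ).mul_const _

theorem fderiv_eq_sum_pd (f : Minkowski → ℝ) (y v : Minkowski) :
    fderiv ℝ f y v = ∑ a, v a * pd a f y := by
  have h := LinearMap.pi_apply_eq_sum_univ (fderiv ℝ f y : Minkowski →ₗ[ℝ] ℝ) v
  rw [ContinuousLinearMap.coe_coe] at h
  rw [h]
  refine Finset.sum_congr rfl fun a _ => ?_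
  rw [smul_eq_mul, pd]
  congr 2
  ext b
  simp [Pi.single_apply, eq_comm]

theorem hasDerivAt_comp_scriCurve {f : Minkowski → ℝ} {D : Set Minkowski} (hD : IsOpen D)
    (hf : ContDiffOn ℝ ∞ f D) {c : ℝ → Minkowski} {c' : Minkowski} {t : ℝ} (ht : c t ∈ D)
    (hc : ∀ a, HasDerivAt (fun t => c t a) (c' a) t) :
    HasDerivAt (fun t => (f (c t) : ℂ)) (∑ a, (c' a : ℂ) * pd a f (c t)) t := by
  have h1 : HasFDerivAt f (fderiv ℝ f (c t)) (c t) :=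
    ((hf.contDiffAt (hD.mem_nhds ht)).differentiableAt (by simp)).hasFDerivAt
  have h2 := (h1.comp_hasDerivAt t (hasDerivAt_pi.2 hc)).ofReal_comp
  refine h2.congr_deriv ?_
  rw [fderiv_eq_sum_pd]
  push_cast; rfl

theorem continuousOn_pd {f : Minkowski → ℝ} {D : Set Minkowski} (hD : IsOpen D)
    (hf : ContDiffOn ℝ ∞ f D) (a : Fin 4) : ContinuousOn (pd a f) D :=
  (hf.continuousOn_fderiv_of_isOpen hD (by simp)).clm_apply continuousOn_const

/-- The ζ-plane is not compact. Uniformity in ζ is obtained from the full unit sphere, on which the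
points remain in the domain even at the direction missed by the chart. -/
theorem exists_bound_bondiPoint {g : Minkowski → ℝ} {D : Set Minkowski} (hg : ContinuousOn g D)
    {A B r₁ r₂ : ℝ}
    (hm : ∀ u ∈ Set.Icc A B, ∀ r ∈ Set.Icc r₁ r₂, ∀ v ∈ unitVectors, scriPoint u r v ∈ D) :
    ∃ C, ∀ u ∈ Set.Icc A B, ∀ r ∈ Set.Icc r₁ r₂, ∀ ζ, ‖(g (bondiPoint u r ζ) : ℂ)‖ ≤ C := by
  have hK : IsCompact (Set.Icc A B ×ˢ Set.Icc r₁ r₂ ×ˢ unitVectors) :=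
    isCompact_Icc.prod (isCompact_Icc.prod isCompact_unitVectors)
  obtain ⟨C, hC⟩ := hK.exists_bound_of_continuousOn (f := fun p => g (scriPoint p.1 p.2.1 p.2.2))
    (hg.comp continuous_scriPoint.continuousOn fun p hp => hm _ hp.1 _ hp.2.1 _ hp.2.2)
  refine ⟨C, fun u hu r hr ζ => ?_⟩
  rw [Complex.norm_real, bondiPoint_eq]
  exact hC (u, r, sphereDir ζ) ⟨hu, hr, sphereDir_mem ζ⟩

theorem isBddCont_bondiPoint {g : Minkowski → ℝ} {D : Set Minkowski} (hg : ContinuousOn g D)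
    {u r : ℝ} (hm : ∀ v ∈ unitVectors, scriPoint u r v ∈ D) :
    IsBddCont fun ζ => (g (bondiPoint u r ζ) : ℂ) := by
  refine ⟨Complex.continuous_ofReal.comp (hg.comp_continuous ?_ fun ζ => ?_), ?_⟩
  · rw [show bondiPoint u r = fun ζ => scriPoint u r (sphereDir ζ) from funext (bondiPoint_eq u r)]
    exact continuous_scriPoint.comp (continuous_const.prodMk
      (continuous_const.prodMk continuous_sphereDir'))
  · rw [bondiPoint_eq]; exact hm _ (sphereDir_mem ζ)
  · obtain ⟨C, hC⟩ := exists_bound_bondiPoint hg (A := u) (B := u) (r₁ := r) (r₂ := r)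
      (by intro u' hu r' hr; rw [Set.Icc_self, Set.mem_singleton_iff] at hu hr; subst hu hr; exact hm)
    exact ⟨C, fun ζ => hC u (by simp) r (by simp) ζ⟩

theorem hasSphereGrad_bondiPoint {f : Minkowski → ℝ} {D : Set Minkowski} (hD : IsOpen D)
    (hf : ContDiffOn ℝ ∞ f D) {u r : ℝ} (hm : ∀ v ∈ unitVectors, scriPoint u r v ∈ D) :
    HasSphereGrad (fun ζ => (f (bondiPoint u r ζ) : ℂ))
      (fun j ζ => (√2 / 2 * r : ℝ) * (pd j.succ f (bondiPoint u r ζ) : ℂ)) where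
  bdd := isBddCont_bondiPoint hf.continuousOn hm
  bdd_grad j := (IsBddCont.const _).mul (isBddCont_bondiPoint (continuousOn_pd hD hf _) hm)
  deriv_re x y := by
    refine (hasDerivAt_comp_scriCurve hD hf (c := fun x => bondiPoint u r ⟨x, y⟩)
      (c' := Fin.cons 0 fun i => √2 / 2 * r * sphereDirRe ⟨x, y⟩ i) ?_ fun a => ?_).congr_deriv ?_
    · rw [bondiPoint_eq]; exact hm _ (sphereDir_mem _)
    · simp only [bondiPoint_eq]
      refine Fin.cases ?_ (fun i => ?_) a
      · exact hasDerivAt_const _ _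
      · exact (hasDerivAt_sphereDir_re x y i).const_mul _
    · rw [Fin.sum_univ_succ]
      simp only [Fin.cons_zero, Fin.cons_succ, Complex.ofReal_zero, zero_mul, zero_add]
      exact Finset.sum_congr rfl fun j _ => by push_cast; ring
  deriv_im x y := by
    refine (hasDerivAt_comp_scriCurve hD hf (c := fun y => bondiPoint u r ⟨x, y⟩)
      (c' := Fin.cons 0 fun i => √2 / 2 * r * sphereDirIm ⟨x, y⟩ i) ?_ fun a => ?_).congr_deriv ?_
    · rw [bondiPoint_eq]; exact hm _ (sphereDir_mem _)
    · simp only [bondiPoint_eq]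
      refine Fin.cases ?_ (fun i => ?_) a
      · exact hasDerivAt_const _ _
      · exact (hasDerivAt_sphereDir_im x y i).const_mul _
    · rw [Fin.sum_univ_succ]
      simp only [Fin.cons_zero, Fin.cons_succ, Complex.ofReal_zero, zero_mul, zero_add]
      exact Finset.sum_congr rfl fun j _ => by push_cast; ring

/-- With u + r fixed, the point moves with velocity (√2/2)(1, -n), tangent to the ingoing null ray.
-/
theorem hasDerivAt_bondiPoint_incoming {f : Minkowski → ℝ} {D : Set Minkowski} (hD : IsOpen D)
    (hf : ContDiffOn ℝ ∞ f D) {T u : ℝ} {ζ : ℂ} (hm : bondiPoint u (T - u) ζ ∈ D) :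
    HasDerivAt (fun u => (f (bondiPoint u (T - u) ζ) : ℂ))
      ((√2 / 2 : ℝ) * (pd 0 f (bondiPoint u (T - u) ζ)
        - ∑ j, (sphereDir ζ j : ℂ) * pd (Fin.succ j) f (bondiPoint u (T - u) ζ))) u := by
  refine (hasDerivAt_comp_scriCurve hD hf (c := fun u => bondiPoint u (T - u) ζ)
      (c' := Fin.cons (√2 / 2) fun i => -(√2 / 2 * sphereDir ζ i)) hm fun a => ?_).congr_deriv ?_
  · simp only [bondiPoint_eq]
    have h : HasDerivAt (fun u => T - u) (-1) u := by simpa using (hasDerivAt_id u).const_sub T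
    refine Fin.cases ?_ (fun i => ?_) a
    · refine (((hasDerivAt_id u).const_mul √2).add (h.const_mul (√2 / 2))).congr_deriv ?_
      simp; ring
    · refine ((h.const_mul (√2 / 2)).mul_const (sphereDir ζ i)).congr_deriv ?_
      simp
  · rw [Fin.sum_univ_succ]
    simp only [Fin.cons_zero, Fin.cons_succ, Fin.sum_univ_three]
    push_cast; ring

/-! ### The Maxwell equations for the self-dual part, along spheres and ingoing rays. -/

section Maxwell

variable {F : Minkowski → Fin 4 → Fin 4 → ℝ} {D : Set Minkowski}

/-- The derivatives of the self-dual part of a field. -/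
noncomputable def selfDualDeriv (F : Minkowski → Fin 4 → Fin 4 → ℝ) (a : Fin 4) (y : Minkowski) :
    Fin 3 → ℂ :=
  selfDual fun b c => pd a (fun y => F y b c) y

theorem IsVacuumMaxwell.pd_antisymm (h : IsVacuumMaxwell F D) {y : Minkowski} (hy : y ∈ D)
    (a b c : Fin 4) : pd a (fun y => F y b c) y = -pd a (fun y => F y c b) y := by
  have e : (fun y => F y b c) =ᶠ[𝓝 y] fun y => -F y c b := by
    filter_upwards [h.isOpen.mem_nhds hy] with z hz using h.antisymm z hz b c
  rw [pd, e.fderiv_eq, fderiv_fun_neg]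
  rfl

/-- This is ∂_t W = -i curl W for W = E + iB. The real parts are the three Ampère equations `r1`,
`r2`, `r3`, the imaginary parts the three Faraday equations `i1`, `i2`, `i3`; the two Gauss laws
play no role. -/
theorem IsVacuumMaxwell.selfDualDeriv_zero (h : IsVacuumMaxwell F D) {y : Minkowski} (hy : y ∈ D)
    (l : Fin 3) : selfDualDeriv F 0 y l
      = -Complex.I * ∑ a : Fin 3, ∑ b, (leviCivita l a b : ℂ) * selfDualDeriv F a.succ y b := by
  have hc := h.closed y hy
  have hd := h.divergence y hy
  have ha := h.pd_antisymm hy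
  simp only [Fin.sum_univ_four, metricSign, if_true, Fin.reduceEq, if_false] at hd
  have z : ∀ a b, pd a (fun y => F y b b) y = 0 := fun a b => by linarith [ha a b b]
  have r1 : -pd 0 (fun y => F y 0 1) y = pd 2 (fun y => F y 1 2) y - pd 3 (fun y => F y 3 1) y := by
    linarith [hd 1, ha 2 2 1, z 1 1]
  have r2 : -pd 0 (fun y => F y 0 2) y = pd 3 (fun y => F y 2 3) y - pd 1 (fun y => F y 1 2) y := by
    linarith [hd 2, ha 3 3 2, z 2 2]
  have r3 : -pd 0 (fun y => F y 0 3) y = pd 1 (fun y => F y 3 1) y - pd 2 (fun y => F y 2 3) y := by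
    linarith [hd 3, ha 1 1 3, z 3 3]
  have i1 : pd 0 (fun y => F y 2 3) y = pd 2 (fun y => F y 0 3) y - pd 3 (fun y => F y 0 2) y := by
    linarith [hc 0 2 3, ha 2 3 0]
  have i2 : pd 0 (fun y => F y 3 1) y = pd 3 (fun y => F y 0 1) y - pd 1 (fun y => F y 0 3) y := by
    linarith [hc 0 3 1, ha 3 1 0]
  have i3 : pd 0 (fun y => F y 1 2) y = pd 1 (fun y => F y 0 2) y - pd 2 (fun y => F y 0 1) y := by
    linarith [hc 0 1 2, ha 1 2 0]
  apply_fun Complex.ofReal at r1 r2 r3 i1 i2 i3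
  push_cast at r1 r2 r3 i1 i2 i3
  have hI : Complex.I * Complex.I = -1 := Complex.I_mul_I
  fin_cases l <;> simp [selfDualDeriv, selfDual, Fin.sum_univ_three, leviCivita_values,
    leviCivita_self_left, leviCivita_self_right, leviCivita_self_outer]
  · linear_combination r1 + Complex.I * i1 + (pd 2 (fun y => F y 1 2) y
      - pd 3 (fun y => F y 3 1) y : ℂ) * hI
  · linear_combination r2 + Complex.I * i2 + (pd 3 (fun y => F y 2 3) y
      - pd 1 (fun y => F y 1 2) y : ℂ) * hI
  · linear_combination r3 + Complex.I * i3 + (pd 1 (fun y => F y 3 1) y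
      - pd 2 (fun y => F y 2 3) y : ℂ) * hI

theorem IsVacuumMaxwell.hasSphereGrad_selfDual (h : IsVacuumMaxwell F D) {u r : ℝ}
    (hm : ∀ v ∈ unitVectors, scriPoint u r v ∈ D) (l : Fin 3) :
    HasSphereGrad (fun ζ => selfDual (F (bondiPoint u r ζ)) l)
      (fun j ζ => (√2 / 2 * r : ℝ) * selfDualDeriv F j.succ (bondiPoint u r ζ) l) := by
  have hg := fun b c => hasSphereGrad_bondiPoint h.isOpen (h.smooth b c) hm
  have key : ∀ b c b' c', HasSphereGrad
      (fun ζ => -(F (bondiPoint u r ζ) b c : ℂ) + Complex.I * F (bondiPoint u r ζ) b' c')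
      (fun j ζ => (√2 / 2 * r : ℝ) * (-(pd j.succ (fun y => F y b c) (bondiPoint u r ζ) : ℂ)
        + Complex.I * pd j.succ (fun y => F y b' c') (bondiPoint u r ζ))) := by
    intro b c b' c'
    convert ((HasSphereGrad.const (-1)).mul (hg b c)).add
      ((HasSphereGrad.const Complex.I).mul (hg b' c')) using 3
    · ring
    · ring
  fin_cases l
  · exact key 0 1 2 3
  · exact key 0 2 3 1
  · exact key 0 3 1 2

theorem IsVacuumMaxwell.hasDerivAt_selfDual (h : IsVacuumMaxwell F D) {T u : ℝ} {ζ : ℂ}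
    (hm : bondiPoint u (T - u) ζ ∈ D) (l : Fin 3) :
    HasDerivAt (fun u => selfDual (F (bondiPoint u (T - u) ζ)) l)
      ((√2 / 2 : ℝ) * (selfDualDeriv F 0 (bondiPoint u (T - u) ζ) l
        - ∑ j : Fin 3, (sphereDir ζ j : ℂ) * selfDualDeriv F j.succ (bondiPoint u (T - u) ζ) l))
      u := by
  have hg := fun b c => hasDerivAt_bondiPoint_incoming h.isOpen (h.smooth b c) hm
  have key : ∀ b c b' c', HasDerivAt (fun u =>
      -(F (bondiPoint u (T - u) ζ) b c : ℂ) + Complex.I * F (bondiPoint u (T - u) ζ) b' c')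
      ((√2 / 2 : ℝ) * ((-(pd 0 (fun y => F y b c) (bondiPoint u (T - u) ζ) : ℂ)
        + Complex.I * pd 0 (fun y => F y b' c') (bondiPoint u (T - u) ζ))
        - ∑ j : Fin 3, (sphereDir ζ j : ℂ) *
          (-(pd j.succ (fun y => F y b c) (bondiPoint u (T - u) ζ) : ℂ)
        + Complex.I * pd j.succ (fun y => F y b' c') (bondiPoint u (T - u) ζ)))) u := by
    intro b c b' c'
    refine ((hg b c).neg.add ((hg b' c').const_mul Complex.I)).congr_deriv ?_
    simp only [Fin.sum_univ_three]; ring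
  fin_cases l
  · exact key 0 1 2 3
  · exact key 0 2 3 1
  · exact key 0 3 1 2

end Maxwell

section Maxwell

variable {F : Minkowski → Fin 4 → Fin 4 → ℝ} {D : Set Minkowski}

theorem IsVacuumMaxwell.npPhi_zero_eq (h : IsVacuumMaxwell F D) {u r : ℝ} {ζ : ℂ}
    (hm : bondiPoint u r ζ ∈ D) :
    npPhi F 0 u r ζ = -(√2 / 2 : ℝ) * ∑ l, selfDual (F (bondiPoint u r ζ)) l * Y1 0 l ζ :=
  tetradPhi_zero_eq (h.antisymm _ hm) ζ

theorem IsVacuumMaxwell.npPhi_one_eq (h : IsVacuumMaxwell F D) {u r : ℝ} {ζ : ℂ}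
    (hm : bondiPoint u r ζ ∈ D) :
    npPhi F 1 u r ζ = (1 / 2) * ∑ l, selfDual (F (bondiPoint u r ζ)) l * sphereDir ζ l :=
  tetradPhi_one_eq (h.antisymm _ hm) ζ

theorem norm_selfDual_le {F : Fin 4 → Fin 4 → ℝ} {M : ℝ} (h : ∀ b c, ‖(F b c : ℂ)‖ ≤ M)
    (l : Fin 3) : ‖selfDual F l‖ ≤ 2 * M := by
  have key : ∀ b c b' c', ‖-(F b c : ℂ) + Complex.I * F b' c'‖ ≤ 2 * M := by
    intro b c b' c'
    refine (norm_add_le _ _).trans ?_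
    rw [norm_neg, norm_mul, Complex.norm_I, one_mul]
    linarith [h b c, h b' c']
  fin_cases l
  · exact key 0 1 2 3
  · exact key 0 2 3 1
  · exact key 0 3 1 2

theorem IsVacuumMaxwell.exists_bound_selfDualDeriv (h : IsVacuumMaxwell F D) {A B r₁ r₂ : ℝ}
    (hm : ∀ u ∈ Set.Icc A B, ∀ r ∈ Set.Icc r₁ r₂, ∀ v ∈ unitVectors, scriPoint u r v ∈ D) :
    ∃ M, ∀ u ∈ Set.Icc A B, ∀ r ∈ Set.Icc r₁ r₂, ∀ ζ a l,
      ‖selfDualDeriv F a (bondiPoint u r ζ) l‖ ≤ M := by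
  choose C hC using fun a b c =>
    exists_bound_bondiPoint (continuousOn_pd h.isOpen (h.smooth b c) a) hm
  refine ⟨2 * ∑ a, ∑ b, ∑ c, |C a b c|, fun u hu r hr ζ a l => norm_selfDual_le (fun b c => ?_) l⟩
  refine (hC a b c u hu r hr ζ).trans ((le_abs_self _).trans ?_)
  refine (Finset.single_le_sum (f := fun c => |C a b c|) (fun _ _ => abs_nonneg _)
    (Finset.mem_univ c)).trans ?_
  refine (Finset.single_le_sum (f := fun b => ∑ c, |C a b c|)
    (fun _ _ => Finset.sum_nonneg fun _ _ => abs_nonneg _) (Finset.mem_univ b)).trans ?_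
  exact Finset.single_le_sum (f := fun a => ∑ b, ∑ c, |C a b c|)
    (fun _ _ => Finset.sum_nonneg fun _ _ => Finset.sum_nonneg fun _ _ => abs_nonneg _)
    (Finset.mem_univ a)

/-- The `l = 1` part of the evolution equation for `φ_0` along the ingoing null lines
`u + r = T`. -/
theorem IsVacuumMaxwell.hasDerivAt_npPhi_zero (h : IsVacuumMaxwell F D) {T u₀ : ℝ}
    (hm : ∀ u ∈ Set.Icc (u₀ - 1) (u₀ + 1), ∀ r ∈ Set.Icc (T - u₀ - 1) (T - u₀ + 1),
      ∀ v ∈ unitVectors, scriPoint u r v ∈ D) (k : Fin 3) :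
    HasDerivAt (fun u => ((T - u : ℝ) : ℂ) *
        sphereIntegral (fun ζ => npPhi F 0 u (T - u) ζ * star (Y1 0 k ζ)))
      (sphereIntegral (fun ζ => npPhi F 1 u₀ (T - u₀) ζ * star (Y1 1 k ζ))) u₀ := by
  have hnhds : Set.Icc (u₀ - 1) (u₀ + 1) ∈ 𝓝 u₀ := Icc_mem_nhds (by linarith) (by linarith)
  have hmem : ∀ u ∈ Set.Icc (u₀ - 1) (u₀ + 1), ∀ v ∈ unitVectors, scriPoint u (T - u) v ∈ D :=
    fun u hu => hm u hu _ ⟨by linarith [hu.2], by linarith [hu.1]⟩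
  have hmem' : ∀ u ∈ Set.Icc (u₀ - 1) (u₀ + 1), ∀ ζ, bondiPoint u (T - u) ζ ∈ D :=
    fun u hu ζ => by rw [bondiPoint_eq]; exact hmem u hu _ (sphereDir_mem ζ)
  have hu₀ : u₀ ∈ Set.Icc (u₀ - 1) (u₀ + 1) := mem_of_mem_nhds hnhds
  have hgrad := fun l => h.hasSphereGrad_selfDual (hmem u₀ hu₀) l
  have hY : ∀ l, IsBddCont fun ζ => Y1 0 l ζ * star (Y1 0 k ζ) :=
    fun l => (IsBddCont.Y1 0 l).mul (IsBddCont.Y1 0 k).star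
  set S : ℝ → ℂ → ℂ := fun u ζ =>
    ∑ l, selfDual (F (bondiPoint u (T - u) ζ)) l * (Y1 0 l ζ * star (Y1 0 k ζ)) with hS
  set S' : ℝ → ℂ → ℂ := fun u ζ => ∑ l, (√2 / 2 : ℝ) *
    (selfDualDeriv F 0 (bondiPoint u (T - u) ζ) l - ∑ j : Fin 3, (sphereDir ζ j : ℂ) *
      selfDualDeriv F j.succ (bondiPoint u (T - u) ζ) l) * (Y1 0 l ζ * star (Y1 0 k ζ)) with hS'
  obtain ⟨M, hM⟩ := h.exists_bound_selfDualDeriv hm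
  have hM0 : 0 ≤ M := (norm_nonneg _).trans (hM u₀ hu₀ (T - u₀) ⟨by linarith, by linarith⟩ 0 0 0)
  have hbS : ∀ u ∈ Set.Icc (u₀ - 1) (u₀ + 1), IsBddCont (S u) := fun u hu =>
    .sum _ fun l _ => ((h.hasSphereGrad_selfDual (hmem u hu) l).bdd).mul (hY l)
  have hdW : ∀ a l, IsBddCont fun ζ => selfDualDeriv F a (bondiPoint u₀ (T - u₀) ζ) l := by
    intro a l
    have hb := fun b c =>
      isBddCont_bondiPoint (continuousOn_pd h.isOpen (h.smooth b c) a) (hmem u₀ hu₀)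
    have key : ∀ b c b' c', IsBddCont fun ζ =>
        -(pd a (fun y => F y b c) (bondiPoint u₀ (T - u₀) ζ) : ℂ)
          + Complex.I * pd a (fun y => F y b' c') (bondiPoint u₀ (T - u₀) ζ) :=
      fun b c b' c' => (hb b c).neg.add ((IsBddCont.const _).mul (hb b' c'))
    fin_cases l
    · exact key 0 1 2 3
    · exact key 0 2 3 1
    · exact key 0 3 1 2
  have hbS' : IsBddCont (S' u₀) := .sum _ fun l _ => ((IsBddCont.const _).mul ((hdW 0 l).sub
    (.sum _ fun j _ => (IsBddCont.sphereDir j).mul (hdW j.succ l)))).mul (hY l)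
  have hderiv : HasDerivAt (fun u => sphereIntegral (S u)) (sphereIntegral (S' u₀)) u₀ := by
    refine hasDerivAt_sphereIntegral hnhds hbS hbS' (C := ∑ _l : Fin 3, 1 * (M + 3 * M) * 4)
      (fun u hu ζ => ?_) (fun u hu ζ => ?_)
    · refine norm_sum_le_of_le _ fun l _ => ?_
      have hr : T - u ∈ Set.Icc (T - u₀ - 1) (T - u₀ + 1) :=
        ⟨by linarith [hu.2], by linarith [hu.1]⟩
      have e1 : ‖selfDualDeriv F 0 (bondiPoint u (T - u) ζ) l - ∑ j : Fin 3, (sphereDir ζ j : ℂ) *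
          selfDualDeriv F j.succ (bondiPoint u (T - u) ζ) l‖ ≤ M + 3 * M := by
        refine (norm_sub_le _ _).trans (add_le_add (hM u hu _ hr ζ 0 l) ?_)
        refine (norm_sum_le_of_le _ (f := fun j : Fin 3 => (sphereDir ζ j : ℂ) *
          selfDualDeriv F j.succ (bondiPoint u (T - u) ζ) l) (n := fun _ => M)
          fun j _ => ?_).trans (by simp)
        rw [norm_mul, Complex.norm_real, Real.norm_eq_abs]
        exact (mul_le_mul (abs_sphereDir_le ζ j) (hM u hu _ hr ζ _ l) (norm_nonneg _)
          zero_le_one).trans (by simp)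
      have e2 : ‖((√2 / 2 : ℝ) : ℂ)‖ ≤ 1 := by
        rw [Complex.norm_real, Real.norm_of_nonneg (by positivity), div_le_one (by norm_num),
          Real.sqrt_le_left (by norm_num)]
        norm_num
      have e3 : ‖Y1 0 l ζ * star (Y1 0 k ζ)‖ ≤ 4 := by
        rw [norm_mul, norm_star]
        exact (mul_le_mul (norm_Y1_le 0 l ζ) (norm_Y1_le 0 k ζ) (norm_nonneg _)
          zero_le_two).trans (by norm_num)
      rw [norm_mul, norm_mul]
      exact mul_le_mul (mul_le_mul e2 e1 (norm_nonneg _) zero_le_one) e3 (norm_nonneg _)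
        (by positivity)
    · exact HasDerivAt.fun_sum fun l _ => (h.hasDerivAt_selfDual (hmem' u hu ζ) l).mul_const _
  have hT : HasDerivAt (fun u : ℝ => ((T - u : ℝ) : ℂ)) (-1) u₀ := by
    simpa using ((hasDerivAt_id u₀).const_sub T).ofReal_comp
  have hprod := (hT.mul hderiv).const_mul (-(√2 / 2 : ℝ) : ℂ)
  refine (hprod.congr_of_eventuallyEq ?_).congr_deriv ?_
  · filter_upwards [hnhds] with u hu
    have e : ∀ ζ, npPhi F 0 u (T - u) ζ * star (Y1 0 k ζ) = -(√2 / 2 : ℝ) * S u ζ := fun ζ => by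
      rw [h.npPhi_zero_eq (hmem' u hu ζ), hS]
      simp only [Fin.sum_univ_three]; ring
    rw [funext e, sphereIntegral_const_mul]
    simp only [Pi.mul_apply]
    ring
  · have hmax := sphereIntegral_maxwell hgrad k
    have e1 : ∀ ζ, npPhi F 1 u₀ (T - u₀) ζ * star (Y1 1 k ζ) = (√2 / 2 : ℝ) *
        (sphereDir ζ k * ∑ l, selfDual (F (bondiPoint u₀ (T - u₀) ζ)) l * sphereDir ζ l) := by
      intro ζ
      rw [h.npPhi_one_eq (hmem' u₀ hu₀ ζ), Y1_one, Complex.star_def, Complex.conj_ofReal]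
      push_cast; ring
    rw [funext e1, sphereIntegral_const_mul, ← hmax]
    -- Here r = T - u₀ and the gradient on the sphere carries the radius √2 r / 2. Replacing the
    -- time derivative by the curl identifies the integrand of `sphereIntegral_maxwell` with S - r
    -- S', which is what the product rule for (T - u) ∫ S produces.
    have e2 : ∀ ζ, ∑ l, (selfDual (F (bondiPoint u₀ (T - u₀) ζ)) l
        + Complex.I * ∑ a, ∑ b, (leviCivita l a b : ℂ) * ((√2 / 2 * (T - u₀) : ℝ) *
          selfDualDeriv F a.succ (bondiPoint u₀ (T - u₀) ζ) b)
        + ∑ j, (sphereDir ζ j : ℂ) * ((√2 / 2 * (T - u₀) : ℝ) *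
          selfDualDeriv F j.succ (bondiPoint u₀ (T - u₀) ζ) l)) * (Y1 0 l ζ * star (Y1 0 k ζ))
        = S u₀ ζ - ((T - u₀ : ℝ) : ℂ) * S' u₀ ζ := by
      intro ζ
      simp only [hS, hS', h.selfDualDeriv_zero (hmem' u₀ hu₀ ζ)]
      rw [Finset.mul_sum, ← Finset.sum_sub_distrib]
      refine Finset.sum_congr rfl fun l _ => ?_
      simp only [Fin.sum_univ_three]
      push_cast; ring
    rw [funext e2, sphereIntegral_sub (hbS u₀ hu₀) ((IsBddCont.const _).mul hbS'),
      sphereIntegral_const_mul]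
    ring

end Maxwell

@[fun_prop]
theorem continuous_lHat (a : Fin 4) : Continuous fun ζ => lHat ζ a := by
  refine Fin.cases ?_ (fun i => ?_) a
  · simp only [lHat_zero]; fun_prop
  · simp only [lHat_succ]; fun_prop

@[fun_prop]
theorem continuous_nHat (a : Fin 4) : Continuous fun ζ => nHat ζ a := by
  refine Fin.cases ?_ (fun i => ?_) a
  · simp only [nHat_zero]; fun_prop
  · simp only [nHat_succ]; fun_prop

@[fun_prop]
theorem continuous_bondiM (a : Fin 4) : Continuous fun ζ => bondiM ζ a := by
  refine Fin.cases ?_ (fun i => ?_) a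
  · simp only [bondiM_zero]; fun_prop
  · simp only [bondiM_succ]; fun_prop

theorem sqrt_two_div_two_le : √2 / 2 ≤ 1 := by
  rw [div_le_one (by norm_num), Real.sqrt_le_left (by norm_num)]; norm_num

theorem norm_tetrad_le (ζ : ℂ) (a : Fin 4) :
    ‖lHat ζ a‖ ≤ 2 ∧ ‖nHat ζ a‖ ≤ 2 ∧ ‖bondiM ζ a‖ ≤ 2 := by
  have h := sqrt_two_div_two_le
  have h0 : 0 ≤ √2 / 2 := by positivity
  refine Fin.cases ?_ (fun i => ?_) a
  · rw [lHat_zero, nHat_zero, bondiM_zero, Complex.norm_real, Real.norm_of_nonneg h0, norm_zero]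
    exact ⟨by linarith, by linarith, by norm_num⟩
  · have := abs_sphereDir_le ζ i
    rw [lHat_succ, nHat_succ, bondiM_succ, norm_neg, Complex.norm_real, Real.norm_eq_abs, abs_mul,
      abs_of_nonneg h0]
    exact ⟨by nlinarith [abs_nonneg (sphereDir ζ i)], by nlinarith [abs_nonneg (sphereDir ζ i)],
      norm_Y1_le 0 i ζ⟩

theorem norm_contract_le {F : Fin 4 → Fin 4 → ℝ} {v w : Fin 4 → ℂ} {M : ℝ}
    (hF : ∀ a b, ‖(F a b : ℂ)‖ ≤ M) (hv : ∀ a, ‖v a‖ ≤ 2) (hw : ∀ a, ‖w a‖ ≤ 2) :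
    ‖contract F v w‖ ≤ 64 * M := by
  have hM : 0 ≤ M := (norm_nonneg _).trans (hF 0 0)
  refine (norm_sum_le_of_le _ (n := fun _ => ∑ _ : Fin 4, M * 2 * 2) fun a _ =>
    norm_sum_le_of_le _ fun b _ => ?_).trans_eq ?_
  · rw [norm_mul, norm_mul]
    exact mul_le_mul (mul_le_mul (hF a b) (hv a) (norm_nonneg _) hM) (hw b) (norm_nonneg _)
      (by positivity)
  · simp; ring

theorem norm_npPhi_le {F : Minkowski → Fin 4 → Fin 4 → ℝ} {M u r : ℝ} {ζ : ℂ}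
    (hF : ∀ a b, ‖(F (bondiPoint u r ζ) a b : ℂ)‖ ≤ M) (k : Fin 3) :
    ‖npPhi F k u r ζ‖ ≤ 64 * M := by
  have hl := fun a => (norm_tetrad_le ζ a).1
  have hn := fun a => (norm_tetrad_le ζ a).2.1
  have hm := fun a => (norm_tetrad_le ζ a).2.2
  have hm' : ∀ a, ‖star (bondiM ζ a)‖ ≤ 2 := fun a => by rw [norm_star]; exact hm a
  unfold npPhi tetradPhi
  fin_cases k
  · simp only [Fin.zero_eta, Matrix.cons_val]
    exact norm_contract_le hF hl hm
  · simp only [Fin.mk_one, Matrix.cons_val]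
    rw [norm_div, RCLike.norm_ofNat, div_le_iff₀ (by norm_num)]
    refine (norm_add_le _ _).trans ?_
    linarith [norm_contract_le hF hl hn, norm_contract_le hF hm' hm]
  · simp only [Fin.reduceFinMk, Matrix.cons_val]
    exact norm_contract_le hF hm' hn

/-! ### Leading coefficients at null infinity as limits of the field. -/

section Peeling

variable {F : Minkowski → Fin 4 → Fin 4 → ℝ} {D : Set Minkowski} {φ : Fin 3 → ℝ → ℂ → ℂ}

theorem IsVacuumMaxwell.continuousOn_npPhi (h : IsVacuumMaxwell F D) {A B r : ℝ}
    (hm : ∀ u ∈ Set.Icc A B, ∀ v ∈ unitVectors, scriPoint u r v ∈ D) (k : Fin 3) :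
    ContinuousOn (fun p : ℝ × ℂ => npPhi F k p.1 r p.2) (Set.Icc A B ×ˢ Set.univ) := by
  have hF : ∀ a b, ContinuousOn (fun p : ℝ × ℂ => (F (bondiPoint p.1 r p.2) a b : ℂ))
      (Set.Icc A B ×ˢ Set.univ) := by
    intro a b
    simp only [bondiPoint_eq]
    refine Complex.continuous_ofReal.comp_continuousOn ((h.smooth a b).continuousOn.comp
      (f := fun p : ℝ × ℂ => scriPoint p.1 r (sphereDir p.2)) ?_ fun p hp => ?_)
    · exact (continuous_scriPoint.comp (continuous_fst.prodMk (continuous_const.prodMk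
        (continuous_sphereDir'.comp continuous_snd)))).continuousOn
    · exact hm p.1 hp.1 _ (sphereDir_mem _)
  have key : ∀ v w : ℂ → Fin 4 → ℂ, (∀ a, Continuous fun ζ => v ζ a) →
      (∀ a, Continuous fun ζ => w ζ a) →
      ContinuousOn (fun p : ℝ × ℂ => contract (F (bondiPoint p.1 r p.2)) (v p.2) (w p.2))
        (Set.Icc A B ×ˢ Set.univ) := fun v w hv hw =>
    continuousOn_finsetSum _ fun a _ => continuousOn_finsetSum _ fun b _ =>
      ((hF a b).mul ((hv a).comp continuous_snd).continuousOn).mul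
        ((hw b).comp continuous_snd).continuousOn
  have hmb : ∀ a, Continuous fun ζ => star (bondiM ζ a) := fun a => (continuous_bondiM a).star
  fin_cases k
  · exact key _ _ continuous_lHat continuous_bondiM
  · exact ((key _ _ continuous_lHat continuous_nHat).add
      (key (fun ζ a => star (bondiM ζ a)) _ hmb continuous_bondiM)).div_const 2
  · exact key (fun ζ a => star (bondiM ζ a)) _ hmb continuous_nHat

theorem Peels.exists_bound (h : Peels F φ) (k : Fin 3) (A B : ℝ) :
    ∃ C r₀ : ℝ, 0 < r₀ ∧
    ∀ u ∈ Set.Icc A B, ∀ r ≥ r₀, ∀ ζ : ℂ,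
      ‖(r : ℂ) ^ (3 - (k : ℕ)) * npPhi F k u r ζ - φ k u ζ‖ ≤ C / r := by
  obtain ⟨C, r₀, hr₀, hC⟩ := h k A B
  refine ⟨C, r₀, hr₀, fun u hu r hr ζ => ?_⟩
  have hr' : 0 < r := lt_of_lt_of_le hr₀ hr
  have hc : (r : ℂ) ≠ 0 := by exact_mod_cast hr'.ne'
  have e : (r : ℂ) ^ (3 - (k : ℕ)) * npPhi F k u r ζ - φ k u ζ = (r : ℂ) ^ (3 - (k : ℕ)) *
      (npPhi F k u r ζ - φ k u ζ / (r : ℂ) ^ (3 - (k : ℕ))) := by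
    field_simp
  rw [e, norm_mul, norm_pow, Complex.norm_real, Real.norm_of_nonneg hr'.le]
  refine (mul_le_mul_of_nonneg_left (hC u hu r hr ζ) (by positivity)).trans_eq ?_
  have : 4 - (k : ℕ) = 3 - (k : ℕ) + 1 := by omega
  rw [this, pow_succ]
  field_simp

/-- Peeling is uniform, so the leading coefficient is locally a uniform limit, as r → ∞, of the
continuous functions r^(3-k) φ_k. -/
theorem IsVacuumMaxwell.continuous_leading (h : IsVacuumMaxwell F D) (hD : ContainsNearScri D)
    (hp : Peels F φ) (k : Fin 3) : Continuous fun p : ℝ × ℂ => φ k p.1 p.2 := by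
  rw [continuous_iff_continuousAt]
  intro p₀
  set A := p₀.1 - 1
  set B := p₀.1 + 1
  obtain ⟨R, -, hR⟩ := scriPoint_mem hD A B
  obtain ⟨C, r₀, hr₀, hC⟩ := hp.exists_bound k A B
  have hu : TendstoUniformlyOn
      (fun (r : ℝ) (p : ℝ × ℂ) => (r : ℂ) ^ (3 - (k : ℕ)) * npPhi F k p.1 r p.2)
      (fun p => φ k p.1 p.2) atTop (Set.Icc A B ×ˢ Set.univ) := by
    rw [Metric.tendstoUniformlyOn_iff]
    intro δ hδ
    have : Tendsto (fun r : ℝ => C / r) atTop (𝓝 0) := tendsto_const_nhds.div_atTop tendsto_id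
    filter_upwards [this.eventually (gt_mem_nhds hδ), eventually_ge_atTop r₀] with r h1 h2 p hp
    rw [dist_comm, dist_eq_norm]
    exact (hC p.1 hp.1 r h2 p.2).trans_lt h1
  have hcont := hu.continuousOn (Eventually.frequently ?_)
  · exact hcont.continuousAt (prod_mem_nhds (Icc_mem_nhds (by simp [A]) (by simp [B])) univ_mem)
  · filter_upwards [eventually_ge_atTop R] with r hr
    exact continuousOn_const.mul (h.continuousOn_npPhi (fun u hu => hR u hu r hr) k)

theorem IsVacuumMaxwell.exists_bound_npPhi (h : IsVacuumMaxwell F D) {A B r : ℝ}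
    (hm : ∀ u ∈ Set.Icc A B, ∀ v ∈ unitVectors, scriPoint u r v ∈ D) (k : Fin 3) :
    ∃ M, ∀ u ∈ Set.Icc A B, ∀ ζ, ‖npPhi F k u r ζ‖ ≤ M := by
  choose M hM using fun a b => exists_bound_bondiPoint (h.smooth a b).continuousOn
    (A := A) (B := B) (r₁ := r) (r₂ := r) fun u hu r' hr' => by
      rw [Set.Icc_self, Set.mem_singleton_iff] at hr'; subst hr'; exact hm u hu
  refine ⟨64 * ∑ a, ∑ b, |M a b|, fun u hu ζ => norm_npPhi_le (fun a b => ?_) k⟩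
  refine (hM a b u hu r ⟨le_rfl, le_rfl⟩ ζ).trans ((le_abs_self _).trans ?_)
  refine (Finset.single_le_sum (f := fun b => |M a b|) (fun _ _ => abs_nonneg _)
    (Finset.mem_univ b)).trans ?_
  exact Finset.single_le_sum (f := fun a => ∑ b, |M a b|)
    (fun _ _ => Finset.sum_nonneg fun _ _ => abs_nonneg _) (Finset.mem_univ a)

theorem IsVacuumMaxwell.isBddCont_npPhi (h : IsVacuumMaxwell F D) {u r : ℝ}
    (hm : ∀ v ∈ unitVectors, scriPoint u r v ∈ D) (k : Fin 3) : IsBddCont (npPhi F k u r) := by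
  have hm' : ∀ u' ∈ Set.Icc u u, ∀ v ∈ unitVectors, scriPoint u' r v ∈ D := by
    intro u' hu'
    rw [Set.Icc_self, Set.mem_singleton_iff] at hu'
    subst hu'; exact hm
  obtain ⟨M, hM⟩ := h.exists_bound_npPhi hm' k
  refine ⟨?_, M, fun ζ => hM u ⟨le_rfl, le_rfl⟩ ζ⟩
  exact (h.continuousOn_npPhi hm' k).comp_continuous (f := fun ζ => (u, ζ)) (by fun_prop)
    fun ζ => ⟨⟨le_rfl, le_rfl⟩, trivial⟩

theorem IsVacuumMaxwell.exists_bound_leading (h : IsVacuumMaxwell F D) (hD : ContainsNearScri D)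
    (hp : Peels F φ) (k : Fin 3) (A B : ℝ) : ∃ M, ∀ u ∈ Set.Icc A B, ∀ ζ, ‖φ k u ζ‖ ≤ M := by
  obtain ⟨R, -, hR⟩ := scriPoint_mem hD A B
  obtain ⟨C, r₀, hr₀, hC⟩ := hp.exists_bound k A B
  set r := max R r₀
  obtain ⟨M, hM⟩ := h.exists_bound_npPhi (fun u hu => hR u hu r (le_max_left _ _)) k
  refine ⟨‖(r : ℂ) ^ (3 - (k : ℕ))‖ * M + C / r, fun u hu ζ => ?_⟩
  have h1 := hC u hu r (le_max_right _ _) ζ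
  have h2 := hM u hu ζ
  have h3 : φ k u ζ = (r : ℂ) ^ (3 - (k : ℕ)) * npPhi F k u r ζ
      - ((r : ℂ) ^ (3 - (k : ℕ)) * npPhi F k u r ζ - φ k u ζ) := by ring
  rw [h3]
  refine (norm_sub_le _ _).trans (add_le_add ?_ h1)
  rw [norm_mul]
  exact mul_le_mul_of_nonneg_left h2 (norm_nonneg _)

/-- Peeling comes with the weight (T - u)², but differentiation in u at fixed T calls for a weight
independent of u. For bounded u the two weights have ratio 1 + O(1/T). -/
theorem norm_sq_mul_sub_le {X X₀ : ℂ} {T u b C M : ℝ}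
    (hX : ‖((T - u : ℝ) : ℂ) ^ 2 * X - X₀‖ ≤ C / (T - u))
    (hM : ‖X₀‖ ≤ M) (hu : |u| ≤ b) (hb : 0 < b) (hT : 2 * b ≤ T) :
    ‖(T : ℂ) ^ 2 * X - X₀‖ ≤ (8 * C + 12 * b * M) / T := by
  have hT0 : 0 < T := by linarith
  obtain ⟨hu1, hu2⟩ := abs_le.1 hu
  have hd : T / 2 ≤ T - u := by linarith
  have hd0 : 0 < T - u := by linarith
  have hdc : ((T - u : ℝ) : ℂ) ≠ 0 := by exact_mod_cast hd0.ne'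
  -- Uses T² - (T - u)² = u(2T - u). The assumption 2b ≤ T keeps T - u at least T/2.
  have e : (T : ℂ) ^ 2 * X - X₀ = ((T ^ 2 / (T - u) ^ 2 : ℝ) : ℂ) *
      (((T - u : ℝ) : ℂ) ^ 2 * X - X₀) + ((u * (2 * T - u) / (T - u) ^ 2 : ℝ) : ℂ) * X₀ := by
    push_cast at hdc ⊢
    field_simp; ring
  have hC0 : 0 ≤ C / (T - u) := (norm_nonneg _).trans hX
  have hM0 : 0 ≤ M := (norm_nonneg _).trans hM
  have hC0' : 0 ≤ C := by rwa [le_div_iff₀ hd0, zero_mul] at hC0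
  have hsq : T ^ 2 / 4 ≤ (T - u) ^ 2 := by nlinarith
  have b1 : T ^ 2 / (T - u) ^ 2 ≤ 4 := by rw [div_le_iff₀ (by positivity)]; linarith
  have b2 : C / (T - u) ≤ 2 * C / T := by
    rw [div_le_div_iff₀ hd0 hT0]; nlinarith
  have b3 : |u * (2 * T - u) / (T - u) ^ 2| ≤ 12 * b / T := by
    rw [abs_div, abs_of_nonneg (sq_nonneg (T - u)), div_le_div_iff₀ (by positivity) hT0, abs_mul]
    have : |2 * T - u| ≤ 3 * T := by rw [abs_le]; constructor <;> linarith
    have h1 : |u| * |2 * T - u| ≤ b * (3 * T) :=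
      mul_le_mul hu this (abs_nonneg _) hb.le
    nlinarith
  rw [e]
  refine (norm_add_le _ _).trans ?_
  rw [norm_mul, norm_mul, Complex.norm_real, Complex.norm_real,
    Real.norm_of_nonneg (by positivity : 0 ≤ T ^ 2 / (T - u) ^ 2), Real.norm_eq_abs]
  have c1 := mul_le_mul b1 (hX.trans b2) (norm_nonneg _) (by norm_num)
  have c2 := mul_le_mul b3 hM (norm_nonneg _) (by positivity)
  refine (add_le_add c1 c2).trans_eq ?_
  ring

/-- The `l = 1` part of the asymptotic Maxwell equation `∂_u φ_0^0 = ð φ_1^0`. -/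
theorem IsVacuumMaxwell.hasDerivAt_leading (h : IsVacuumMaxwell F D) (hD : ContainsNearScri D)
    (hp : Peels F φ) (k : Fin 3) (u₀ : ℝ) :
    HasDerivAt (fun u => sphereIntegral (fun ζ => φ 0 u ζ * star (Y1 0 k ζ)))
      (sphereIntegral (fun ζ => φ 1 u₀ ζ * star (Y1 1 k ζ))) u₀ := by
  -- The limit is taken on (u₀ - 1, u₀ + 1), and the finite-distance identity at each of its points
  -- needs a further unit interval on either side.
  set A := u₀ - 2
  set B := u₀ + 2
  set b := |u₀| + 2
  have hb : 0 < b := by positivity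
  have hub : ∀ u ∈ Set.Icc A B, |u| ≤ b := fun u hu => by
    rw [abs_le]; constructor <;>
      linarith [hu.1, hu.2, neg_abs_le u₀, le_abs_self u₀, show A = u₀ - 2 from rfl,
        show B = u₀ + 2 from rfl, show b = |u₀| + 2 from rfl]
  obtain ⟨R, -, hR⟩ := scriPoint_mem hD A B
  have hcont : ∀ k u, Continuous fun ζ => φ k u ζ := fun k u =>
    (h.continuous_leading hD hp k).comp (continuous_const.prodMk continuous_id)
  -- the integrals of the field components approach those of their leading coefficients
  have key : ∀ (k : Fin 3) (Y : ℂ → ℂ), (∀ ζ, ‖Y ζ‖ ≤ 2) → Continuous Y → ∃ C M T₀ : ℝ,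
      ∀ T ≥ T₀, ∀ u ∈ Set.Icc A B,
      ‖((T - u : ℝ) : ℂ) ^ (3 - (k : ℕ)) *
        sphereIntegral (fun ζ => npPhi F k u (T - u) ζ * star (Y ζ))
        - sphereIntegral (fun ζ => φ k u ζ * star (Y ζ))‖ ≤ C / (T - u) ∧
      ‖sphereIntegral (fun ζ => φ k u ζ * star (Y ζ))‖ ≤ M := by
    intro k Y hY hYc
    obtain ⟨C, r₀, hr₀, hC⟩ := hp.exists_bound k A B
    obtain ⟨M, hM⟩ := h.exists_bound_leading hD hp k A B
    refine ⟨C * 2 * sphereArea, M * 2 * sphereArea, max r₀ R + B, fun T hT u hu => ?_⟩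
    have hr : max r₀ R ≤ T - u := by linarith [hu.2]
    have hr1 := (le_max_left r₀ R).trans hr
    have hr2 := (le_max_right r₀ R).trans hr
    have hM0 : 0 ≤ M := (norm_nonneg _).trans (hM u hu 0)
    have hYb : IsBddCont Y := ⟨hYc, 2, hY⟩
    have hb1 : IsBddCont fun ζ => φ k u ζ := ⟨hcont k u, M, hM u hu⟩
    have hb2 : IsBddCont fun ζ => npPhi F k u (T - u) ζ := h.isBddCont_npPhi (hR u hu _ hr2) k
    constructor
    · rw [← sphereIntegral_const_mul, ← sphereIntegral_sub
        ((IsBddCont.const _).mul (hb2.mul hYb.star)) (hb1.mul hYb.star)]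
      refine (norm_sphereIntegral_le (C := C / (T - u) * 2) fun ζ => ?_).trans_eq (by ring)
      rw [← mul_assoc, ← sub_mul, norm_mul, norm_star]
      exact mul_le_mul (hC u hu _ hr1 ζ) (hY ζ) (norm_nonneg _)
        ((norm_nonneg _).trans (hC u hu _ hr1 ζ))
    · refine norm_sphereIntegral_le fun ζ => ?_
      rw [norm_mul, norm_star]
      exact mul_le_mul (hM u hu ζ) (hY ζ) (norm_nonneg _) hM0
  obtain ⟨C₀, M₀, T₀, h₀⟩ := key 0 (Y1 0 k) (norm_Y1_le 0 k) (continuous_Y1 0 k)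
  obtain ⟨C₁, M₁, T₁, h₁⟩ := key 1 (Y1 1 k) (norm_Y1_le 1 k) (continuous_Y1 1 k)
  have hsub : Set.Ioo (u₀ - 1) (u₀ + 1) ⊆ Set.Icc A B := fun u hu =>
    ⟨by linarith [hu.1, show A = u₀ - 2 from rfl], by linarith [hu.2, show B = u₀ + 2 from rfl]⟩
  -- Limit and derivative may be exchanged because the derivative at finite T is itself an integral
  -- of φ_1, which converges uniformly by peeling; no derivative of an error term is taken.
  refine hasDerivAt_of_tendstoUniformlyOn (l := atTop) (s := Set.Ioo (u₀ - 1) (u₀ + 1)) isOpen_Ioo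
    (f := fun (T : ℝ) (u : ℝ) => (T : ℂ) ^ 2 * (((T - u : ℝ) : ℂ) *
      sphereIntegral (fun ζ => npPhi F 0 u (T - u) ζ * star (Y1 0 k ζ))))
    (f' := fun (T : ℝ) (u : ℝ) => (T : ℂ) ^ 2 *
      sphereIntegral (fun ζ => npPhi F 1 u (T - u) ζ * star (Y1 1 k ζ)))
    (g' := fun u => sphereIntegral (fun ζ => φ 1 u ζ * star (Y1 1 k ζ)))
    ?_ ?_ ?_ ⟨by linarith, by linarith⟩
  · rw [Metric.tendstoUniformlyOn_iff]
    intro δ hδ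
    have : Tendsto (fun T : ℝ => (8 * C₁ + 12 * b * M₁) / T) atTop (𝓝 0) :=
      tendsto_const_nhds.div_atTop tendsto_id
    filter_upwards [this.eventually (gt_mem_nhds hδ), eventually_ge_atTop T₁,
      eventually_ge_atTop (2 * b)] with T e1 e2 e3 u hu
    rw [dist_comm, dist_eq_norm]
    exact (norm_sq_mul_sub_le (h₁ T e2 u (hsub hu)).1 (h₁ T e2 u (hsub hu)).2
      (hub u (hsub hu)) hb e3).trans_lt e1
  · filter_upwards [eventually_ge_atTop (R + u₀ + 3)] with T hT u hu
    refine (h.hasDerivAt_npPhi_zero (fun u' hu' r hr => hR u' ?_ r ?_) k).const_mul _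
    · exact ⟨by linarith [hu'.1, hu.1, show A = u₀ - 2 from rfl],
        by linarith [hu'.2, hu.2, show B = u₀ + 2 from rfl]⟩
    · linarith [hr.1, hu.2]
  · intro u hu
    rw [tendsto_iff_norm_sub_tendsto_zero]
    have : Tendsto (fun T : ℝ => (8 * C₀ + 12 * b * M₀) / T) atTop (𝓝 0) :=
      tendsto_const_nhds.div_atTop tendsto_id
    refine squeeze_zero' (Eventually.of_forall fun _ => norm_nonneg _) ?_ this
    filter_upwards [eventually_ge_atTop T₀, eventually_ge_atTop (2 * b)] with T e2 e3
    refine norm_sq_mul_sub_le ?_ (h₀ T e2 u (hsub hu)).2 (hub u (hsub hu)) hb e3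
    have := (h₀ T e2 u (hsub hu)).1
    -- The factor T - u inside the differentiated quantity supplies the third power of r in the
    -- peeling of φ_0.
    rwa [← mul_assoc, ← pow_succ]

end Peeling

/-! ### Orders of smallness -/

section HasOrder

variable {α : Type*} {S : Set α} {k m : ℕ} {f g : ℝ × α → ℂ}

/-- `f (ε, x)` is `O(ε ^ k)` uniformly for `x ∈ S`. -/
def HasOrder (S : Set α) (k : ℕ) (f : ℝ × α → ℂ) : Prop :=
  f =O[𝓝[>] (0 : ℝ) ×ˢ 𝓟 S] fun p => p.1 ^ k

theorem eventually_fst_mem : ∀ᶠ ε : ℝ in 𝓝[>] 0, 0 < ε ∧ ε ≤ 1 := by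
  filter_upwards [self_mem_nhdsWithin, mem_nhdsWithin_of_mem_nhds (Iic_mem_nhds one_pos)]
    with ε h1 h2 using ⟨h1, h2⟩

theorem hasOrder_iff : HasOrder S k f ↔
    ∃ C : ℝ, ∀ᶠ ε in 𝓝[>] (0 : ℝ), ∀ x ∈ S, ‖f (ε, x)‖ ≤ C * ε ^ k := by
  rw [HasOrder, Asymptotics.isBigO_iff]
  refine exists_congr fun C => ?_
  rw [eventually_prod_principal_iff]
  refine eventually_congr ?_
  filter_upwards [eventually_fst_mem] with ε hε
  rw [Real.norm_of_nonneg (pow_nonneg hε.1.le k)]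

theorem HasOrder.add (hf : HasOrder S k f) (hg : HasOrder S k g) :
    HasOrder S k fun p => f p + g p := Asymptotics.IsBigO.add hf hg

theorem HasOrder.sub (hf : HasOrder S k f) (hg : HasOrder S k g) :
    HasOrder S k fun p => f p - g p := Asymptotics.IsBigO.sub hf hg

theorem HasOrder.neg (hf : HasOrder S k f) : HasOrder S k fun p => -f p :=
  Asymptotics.IsBigO.neg_left hf

theorem HasOrder.mul (hf : HasOrder S k f) (hg : HasOrder S m g) :
    HasOrder S (k + m) fun p => f p * g p :=
  (Asymptotics.IsBigO.mul hf hg).congr_right fun _ => (pow_add _ _ _).symm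

theorem HasOrder.const_mul (c : ℂ) (hf : HasOrder S k f) : HasOrder S k fun p => c * f p :=
  Asymptotics.IsBigO.const_mul_left hf c

theorem HasOrder.sum {ι : Type*} {s : Finset ι} {f : ι → ℝ × α → ℂ}
    (h : ∀ i ∈ s, HasOrder S k (f i)) : HasOrder S k fun p => ∑ i ∈ s, f i p :=
  Asymptotics.IsBigO.fun_sum h

theorem HasOrder.mono (hf : HasOrder S k f) (h : m ≤ k) : HasOrder S m f := by
  refine Asymptotics.IsBigO.trans hf (Asymptotics.IsBigO.of_bound 1 ?_)
  rw [eventually_prod_principal_iff]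
  filter_upwards [eventually_fst_mem] with ε hε x _
  rw [Real.norm_of_nonneg (pow_nonneg hε.1.le k), Real.norm_of_nonneg (pow_nonneg hε.1.le m),
    one_mul]
  exact pow_le_pow_of_le_one hε.1.le hε.2 h

theorem HasOrder.mono_set {T : Set α} (hf : HasOrder S k f) (h : T ⊆ S) : HasOrder T k f :=
  Asymptotics.IsBigO.mono hf (prod_mono le_rfl (principal_mono.2 h))

theorem HasOrder.of_le (hg : HasOrder S k g) (C : ℝ)
    (h : ∀ᶠ ε in 𝓝[>] (0 : ℝ), ∀ x ∈ S, ‖f (ε, x)‖ ≤ C * ‖g (ε, x)‖) : HasOrder S k f :=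
  (Asymptotics.IsBigO.of_bound C (eventually_prod_principal_iff.2 h)).trans hg

theorem HasOrder.congr (hg : HasOrder S k g)
    (h : ∀ᶠ ε in 𝓝[>] (0 : ℝ), ∀ x ∈ S, f (ε, x) = g (ε, x)) : HasOrder S k f :=
  hg.of_le 1 (by filter_upwards [h] with ε he x hx; rw [he x hx, one_mul])

theorem hasOrder_zero_of_bound (C : ℝ) (h : ∀ ε, ∀ x ∈ S, ‖f (ε, x)‖ ≤ C) : HasOrder S 0 f :=
  hasOrder_iff.2 ⟨C, Eventually.of_forall fun ε x hx => by simpa using h ε x hx⟩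

theorem hasOrder_param : HasOrder S 1 fun p => (p.1 : ℂ) :=
  hasOrder_iff.2 ⟨1, by filter_upwards [eventually_fst_mem] with ε hε x _; simp [abs_of_pos hε.1]⟩

theorem HasOrder.re (hf : HasOrder S k f) : HasOrder S k fun p => ((f p).re : ℂ) :=
  hf.of_le 1 (Eventually.of_forall fun ε x _ => by
    rw [Complex.norm_real, one_mul]; exact Complex.abs_re_le_norm _)

theorem HasOrder.im (hf : HasOrder S k f) : HasOrder S k fun p => ((f p).im : ℂ) :=
  hf.of_le 1 (Eventually.of_forall fun ε x _ => by
    rw [Complex.norm_real, one_mul]; exact Complex.abs_im_le_norm _)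

theorem HasOrder.comp {β : Type*} {T : Set β} (hf : HasOrder S k f) (g : ℝ → β → α)
    (hg : ∀ᶠ ε in 𝓝[>] (0 : ℝ), ∀ x ∈ T, g ε x ∈ S) :
    HasOrder T k fun p => f (p.1, g p.1 p.2) := by
  rw [hasOrder_iff] at hf ⊢
  obtain ⟨C, hC⟩ := hf
  refine ⟨C, ?_⟩
  filter_upwards [hC, hg] with ε h1 h2 x hx using h1 _ (h2 x hx)

theorem isOrder_iff {α : Type} [TopologicalSpace α] {S : Set α} {f : ℝ → α → ℂ} :
    IsOrder k S f ↔ ∀ K ⊆ S, IsCompact K → HasOrder K k fun p => f p.1 p.2 := by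
  simp only [IsOrder, hasOrder_iff]

theorem isOrder_univ_iff {f : ℝ → ℝ → ℂ} :
    IsOrder k Set.univ f ↔ ∀ A B : ℝ, HasOrder (Set.Icc A B) k fun p => f p.1 p.2 := by
  rw [isOrder_iff]
  refine ⟨fun h A B => h _ (Set.subset_univ _) isCompact_Icc, fun h K _ hK => ?_⟩
  obtain ⟨A, hA⟩ := hK.bddBelow
  obtain ⟨B, hB⟩ := hK.bddAbove
  exact (h A B).mono_set fun x hx => ⟨hA hx, hB hx⟩

end HasOrder

/-! ### Taylor estimates -/

/-- Two applications of the mean value inequality on a segment, which is why M appears without the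
factor 1/2. The scalar field is left open: real time is used for the field multipoles, complex time
for the world line. -/
theorem norm_taylor_le {𝕜 : Type*} [RCLike 𝕜] {f f' f'' : 𝕜 → ℂ} [NormedSpace 𝕜 ℂ] {S : Set 𝕜}
    {M : ℝ} (hS : Convex ℝ S) (hf : ∀ x ∈ S, HasDerivAt f (f' x) x)
    (hf' : ∀ x ∈ S, HasDerivAt f' (f'' x) x) (hM : ∀ x ∈ S, ‖f'' x‖ ≤ M) {x y : 𝕜} (hx : x ∈ S)
    (hy : y ∈ S) : ‖f y - f x - (y - x) • f' x‖ ≤ M * ‖y - x‖ ^ 2 := by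
  have hM0 : 0 ≤ M := (norm_nonneg _).trans (hM x hx)
  have hseg : segment ℝ x y ⊆ S := hS.segment_subset hx hy
  have h1 : ∀ z ∈ segment ℝ x y, HasDerivWithinAt (fun z => f z - (z - x) • f' x)
      (f' z - f' x) (segment ℝ x y) z := by
    intro z hz
    have : HasDerivAt (fun z => (z - x) • f' x) ((1 : 𝕜) • f' x) z :=
      ((hasDerivAt_id z).sub_const x).smul_const (f' x)
    rw [one_smul] at this
    exact ((hf z (hseg hz)).sub this).hasDerivWithinAt
  have h2 : ∀ z ∈ segment ℝ x y, ‖f' z - f' x‖ ≤ M * ‖y - x‖ := by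
    intro z hz
    refine (hS.norm_image_sub_le_of_norm_hasDerivWithin_le
      (fun w hw => (hf' w hw).hasDerivWithinAt) hM hx (hseg hz)).trans ?_
    exact mul_le_mul_of_nonneg_left (norm_sub_le_of_mem_segment hz) hM0
  have h3 := (convex_segment x y).norm_image_sub_le_of_norm_hasDerivWithin_le h1 h2
    (left_mem_segment ℝ x y) (right_mem_segment ℝ x y)
  simp only [sub_self, zero_smul, sub_zero] at h3
  rw [sub_right_comm]
  exact h3.trans_eq (by ring)

/-! ### Uniform derivative bounds for analytic families. -/

section Analytic

variable {U : Set ℂ}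

/-- The radius 3ρ leaves room for two Cauchy estimates: values are bounded on radius 3ρ, first
derivatives on 2ρ, second derivatives on ρ. -/
theorem exists_tube (hU : IsOpen U) (hr : ∀ s : ℝ, (s : ℂ) ∈ U) (A B : ℝ) :
    ∃ ρ > 0, ∃ K ⊆ U, IsCompact K ∧ ∀ s ∈ Set.Icc A B, Metric.closedBall (s : ℂ) (3 * ρ) ⊆ K := by
  have hK : IsCompact ((fun s : ℝ => (s : ℂ)) '' Set.Icc A B) :=
    isCompact_Icc.image Complex.continuous_ofReal
  obtain ⟨δ, hδ, hsub⟩ := hK.exists_cthickening_subset_open hU (by rintro _ ⟨s, -, rfl⟩; exact hr s)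
  refine ⟨δ / 3, by positivity, _, hsub, hK.cthickening, fun s hs => ?_⟩
  rw [show 3 * (δ / 3) = δ by ring]
  exact Metric.closedBall_subset_cthickening (Set.mem_image_of_mem _ hs) δ

/-- Cauchy estimates on a disc. -/
theorem cauchy_estimates (hU : IsOpen U) {f : ℂ → ℂ} (hf : DifferentiableOn ℂ f U) {s : ℂ}
    {ρ M : ℝ} (hρ : 0 < ρ) (hs : Metric.closedBall s (3 * ρ) ⊆ U)
    (hM : ∀ z ∈ Metric.closedBall s (3 * ρ), ‖f z‖ ≤ M) :
    (∀ z ∈ Metric.closedBall s (2 * ρ), ‖deriv f z‖ ≤ M / ρ) ∧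
    (∀ z ∈ Metric.closedBall s ρ, ‖deriv (deriv f) z‖ ≤ M / ρ / ρ) := by
  have hd : DifferentiableOn ℂ (deriv f) U := hf.deriv hU
  have step : ∀ {g : ℂ → ℂ} {R N : ℝ}, DifferentiableOn ℂ g U →
      Metric.closedBall s (R + ρ) ⊆ U → (∀ z ∈ Metric.closedBall s (R + ρ), ‖g z‖ ≤ N) →
      ∀ z ∈ Metric.closedBall s R, ‖deriv g z‖ ≤ N / ρ := by
    intro g R N hg hR hN z hz
    have hsub : Metric.closedBall z ρ ⊆ Metric.closedBall s (R + ρ) := by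
      refine Metric.closedBall_subset_closedBall' ?_
      rw [Metric.mem_closedBall] at hz; linarith
    refine Complex.norm_deriv_le_of_forall_mem_sphere_norm_le hρ ?_
      fun w hw => hN w (hsub (Metric.sphere_subset_closedBall hw))
    exact (hg.mono (hsub.trans hR)).diffContOnCl_ball subset_rfl
  have h1 := step hf (R := 2 * ρ) (by rwa [show 2 * ρ + ρ = 3 * ρ by ring])
    (by rwa [show 2 * ρ + ρ = 3 * ρ by ring])
  refine ⟨h1, step hd (R := ρ) ?_ (by rwa [show ρ + ρ = 2 * ρ by ring])⟩
  exact (Metric.closedBall_subset_closedBall (by linarith)).trans hs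

theorem analytic_family_bounds (hU : IsOpen U) {k : ℕ} {f : ℝ → ℂ → ℂ}
    (hf : ∀ ε > 0, DifferentiableOn ℂ (f ε) U) (ho : IsOrder k U f) {A B ρ : ℝ} (hρ : 0 < ρ)
    {K : Set ℂ} (hKU : K ⊆ U) (hK : IsCompact K)
    (hs : ∀ s ∈ Set.Icc A B, Metric.closedBall (s : ℂ) (3 * ρ) ⊆ K) :
    ∃ C > 0, ∀ᶠ ε in 𝓝[>] (0 : ℝ), ∀ s ∈ Set.Icc A B,
      (∀ z : ℂ, ‖z‖ ≤ ρ → ‖f ε (s + z)‖ ≤ C * ε ^ k) ∧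
      ‖deriv (f ε) s‖ ≤ C * ε ^ k ∧
      (∀ z w : ℂ, ‖z‖ ≤ ρ → ‖w‖ ≤ ρ → ‖f ε (s + z) - f ε (s + w)‖ ≤ C * ε ^ k * ‖z - w‖) ∧
      (∀ z : ℂ, ‖z‖ ≤ ρ → ‖f ε (s + z) - f ε s - z * deriv (f ε) s‖ ≤ C * ε ^ k * ‖z‖ ^ 2) ∧
      (∀ z : ℂ, ‖z‖ ≤ ρ → ‖deriv (f ε) (s + z) - deriv (f ε) s‖ ≤ C * ε ^ k * ‖z‖) := by
  obtain ⟨C, hC⟩ := ho K hKU hK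
  refine ⟨|C| + |C| / ρ + |C| / ρ / ρ + 1, by positivity, ?_⟩
  filter_upwards [hC, eventually_fst_mem] with ε hε hε0 s hsI
  have hek : 0 ≤ ε ^ k := pow_nonneg hε0.1.le k
  have hsub := hs s hsI
  have hM : ∀ z ∈ Metric.closedBall (s : ℂ) (3 * ρ), ‖f ε z‖ ≤ |C| * ε ^ k := fun z hz =>
    (hε z (hsub hz)).trans (mul_le_mul_of_nonneg_right (le_abs_self C) hek)
  obtain ⟨c1, c2⟩ := cauchy_estimates hU (hf ε hε0.1) hρ (hsub.trans hKU) hM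
  have hd : DifferentiableOn ℂ (deriv (f ε)) U := (hf ε hε0.1).deriv hU
  have hmem : ∀ z : ℂ, ‖z‖ ≤ ρ → (s : ℂ) + z ∈ Metric.closedBall (s : ℂ) ρ := fun z hz => by
    rw [Metric.mem_closedBall, dist_eq_norm]; simpa using hz
  have hsmall : Metric.closedBall (s : ℂ) ρ ⊆ Metric.closedBall (s : ℂ) (2 * ρ) :=
    Metric.closedBall_subset_closedBall (by linarith)
  have hsmall3 : Metric.closedBall (s : ℂ) ρ ⊆ Metric.closedBall (s : ℂ) (3 * ρ) :=
    Metric.closedBall_subset_closedBall (by linarith)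
  have hda : ∀ z ∈ Metric.closedBall (s : ℂ) ρ, HasDerivAt (f ε) (deriv (f ε) z) z := fun z hz =>
    ((hf ε hε0.1).differentiableAt (hU.mem_nhds (hKU (hsub (hsmall3 hz))))).hasDerivAt
  have hdda : ∀ z ∈ Metric.closedBall (s : ℂ) ρ,
      HasDerivAt (deriv (f ε)) (deriv (deriv (f ε)) z) z := fun z hz =>
    (hd.differentiableAt (hU.mem_nhds (hKU (hsub (hsmall3 hz))))).hasDerivAt
  have hself : (s : ℂ) ∈ Metric.closedBall (s : ℂ) ρ := Metric.mem_closedBall_self hρ.le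
  have hconv := convex_closedBall (s : ℂ) ρ
  set C' := |C| + |C| / ρ + |C| / ρ / ρ + 1
  have hC0 : |C| * ε ^ k ≤ C' * ε ^ k := mul_le_mul_of_nonneg_right
    (by have : 0 ≤ |C| / ρ + |C| / ρ / ρ := by positivity
        linarith [show C' = |C| + |C| / ρ + |C| / ρ / ρ + 1 from rfl]) hek
  have hC1 : |C| * ε ^ k / ρ ≤ C' * ε ^ k := by
    rw [mul_div_right_comm]
    exact mul_le_mul_of_nonneg_right
      (by have : 0 ≤ |C| + |C| / ρ / ρ := by positivity
          linarith [show C' = |C| + |C| / ρ + |C| / ρ / ρ + 1 from rfl]) hek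
  have hC2 : |C| * ε ^ k / ρ / ρ ≤ C' * ε ^ k := by
    rw [mul_div_right_comm, mul_div_right_comm]
    exact mul_le_mul_of_nonneg_right
      (by have : 0 ≤ |C| + |C| / ρ := by positivity
          linarith [show C' = |C| + |C| / ρ + |C| / ρ / ρ + 1 from rfl]) hek
  refine ⟨fun z hz => (hM _ (hsmall3 (hmem z hz))).trans hC0, (c1 _ (hsmall hself)).trans hC1,
    fun z w hz hw => ?_, fun z hz => ?_, fun z hz => ?_⟩
  · have := hconv.norm_image_sub_le_of_norm_hasDerivWithin_le
      (fun z hz => (hda z hz).hasDerivWithinAt) (fun z hz => (c1 z (hsmall hz)).trans hC1)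
      (hmem w hw) (hmem z hz)
    rwa [add_sub_add_left_eq_sub] at this
  · have := norm_taylor_le hconv hda hdda (fun z hz => (c2 z hz).trans hC2) hself (hmem z hz)
    rwa [add_sub_cancel_left, smul_eq_mul] at this
  · have := hconv.norm_image_sub_le_of_norm_hasDerivWithin_le
      (fun z hz => (hdda z hz).hasDerivWithinAt) (fun z hz => (c2 z hz).trans hC2)
      hself (hmem z hz)
    rwa [add_sub_cancel_left] at this

end Analytic

/-! ### Real slicings -/

theorem goodCut_eq (z : ℂ → Fin 4 → ℂ) (τ ζ : ℂ) :
    goodCut z τ ζ = (√2 / 2 : ℝ) * (z τ 0 - ∑ i : Fin 3, z τ i.succ * sphereDir ζ i) := by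
  rw [goodCut, mdot, Fin.sum_univ_succ]
  simp only [lHat_zero, lHat_succ, metricSign, Fin.succ_ne_zero, if_true, if_false,
    Fin.sum_univ_three]
  push_cast; ring

theorem angleField_eq (z : ℂ → Fin 4 → ℂ) (τ ζ : ℂ) :
    angleField z τ ζ = ∑ i : Fin 3, z τ i.succ * Y1 0 i ζ := by
  rw [angleField, mdot, Fin.sum_univ_succ]
  simp only [mHat_zero, mHat_succ, metricSign, Fin.succ_ne_zero, if_true, if_false,
    Fin.sum_univ_three]
  push_cast; ring

/-- The deviation of `√2 Im G(s + i λ)` from `λ`. -/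
noncomputable def cutResidual (z : ℂ → Fin 4 → ℂ) (s lam : ℝ) (ζ : ℂ) : ℝ :=
  (z (s + Complex.I * lam) 0 - (s + Complex.I * lam)).im
    - ∑ i : Fin 3, (z (s + Complex.I * lam) i.succ).im * sphereDir ζ i

theorem goodCut_im (z : ℂ → Fin 4 → ℂ) (s lam : ℝ) (ζ : ℂ) :
    (goodCut z (s + Complex.I * lam) ζ).im = √2 / 2 * (lam + cutResidual z s lam ζ) := by
  rw [goodCut_eq, Complex.im_ofReal_mul]
  simp [cutResidual, Fin.sum_univ_three]
  ring

theorem goodCut_im_eq_zero_iff (z : ℂ → Fin 4 → ℂ) (s lam : ℝ) (ζ : ℂ) :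
    (goodCut z (s + Complex.I * lam) ζ).im = 0 ↔ lam = -cutResidual z s lam ζ := by
  have : √2 / 2 ≠ 0 := by positivity
  rw [goodCut_im, mul_eq_zero, or_iff_right this, add_eq_zero_iff_eq_neg]

/-- Bounds for a slow world line near the real interval `[A, B]`, on discs of radius `ρ`. -/
structure WorldLineBounds (ξ : ℝ → ℂ → Fin 4 → ℂ) (A B ρ C : ℝ) : Prop where
  radius_pos : 0 < ρ
  const_pos : 0 < C
  time : ∀ᶠ ε in 𝓝[>] (0 : ℝ), ∀ s ∈ Set.Icc A B,
    (∀ z : ℂ, ‖z‖ ≤ ρ → ‖ξ ε (s + z) 0 - (s + z)‖ ≤ C * ε) ∧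
    (∀ z w : ℂ, ‖z‖ ≤ ρ → ‖w‖ ≤ ρ →
      ‖(ξ ε (s + z) 0 - (s + z)) - (ξ ε (s + w) 0 - (s + w))‖ ≤ C * ε * ‖z - w‖)
  space : ∀ i : Fin 3, ∀ᶠ ε in 𝓝[>] (0 : ℝ), ∀ s ∈ Set.Icc A B,
    (∀ z : ℂ, ‖z‖ ≤ ρ → ‖ξ ε (s + z) i.succ‖ ≤ C * ε) ∧
    ‖deriv (fun τ => ξ ε τ i.succ) s‖ ≤ C * ε ∧
    (∀ z w : ℂ, ‖z‖ ≤ ρ → ‖w‖ ≤ ρ → ‖ξ ε (s + z) i.succ - ξ ε (s + w) i.succ‖ ≤ C * ε * ‖z - w‖) ∧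
    (∀ z : ℂ, ‖z‖ ≤ ρ → ‖ξ ε (s + z) i.succ - ξ ε s i.succ
      - z * deriv (fun τ => ξ ε τ i.succ) s‖ ≤ C * ε * ‖z‖ ^ 2) ∧
    (∀ z : ℂ, ‖z‖ ≤ ρ → ‖deriv (fun τ => ξ ε τ i.succ) (s + z)
      - deriv (fun τ => ξ ε τ i.succ) s‖ ≤ C * ε * ‖z‖)

theorem IsSlowWorldLine.exists_bounds {U : Set ℂ} {ξ : ℝ → ℂ → Fin 4 → ℂ}
    (h : IsSlowWorldLine U ξ) (A B : ℝ) : ∃ ρ C, WorldLineBounds ξ A B ρ C := by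
  obtain ⟨ρ, hρ, K, hKU, hK, hs⟩ := exists_tube h.isOpen h.real_mem A B
  obtain ⟨C₀, hC₀, h₀⟩ := analytic_family_bounds h.isOpen
    (f := fun ε τ => ξ ε τ 0 - τ) (fun ε hε => (h.analytic ε hε 0).sub differentiableOn_id)
    h.time_order hρ hKU hK hs
  choose Ci hCi hi using fun i : Fin 3 => analytic_family_bounds h.isOpen
    (f := fun ε τ => ξ ε τ i.succ) (fun ε hε => h.analytic ε hε i.succ)
    (h.space_order i) hρ hKU hK hs
  have hle : ∀ i, Ci i ≤ C₀ + ∑ i, Ci i := fun i => by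
    have := Finset.single_le_sum (f := Ci) (fun j _ => (hCi j).le) (Finset.mem_univ i)
    linarith
  have hle₀ : C₀ ≤ C₀ + ∑ i, Ci i := by
    have := Finset.sum_nonneg (f := Ci) (s := Finset.univ) fun j _ => (hCi j).le
    linarith
  refine ⟨ρ, C₀ + ∑ i, Ci i, hρ, lt_of_lt_of_le hC₀ hle₀, ?_, fun i => ?_⟩
  · filter_upwards [h₀, eventually_fst_mem] with ε he hε s hsI
    obtain ⟨a1, -, a3, -, -⟩ := he s hsI
    have hce := mul_le_mul_of_nonneg_right hle₀ hε.1.le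
    simp only [pow_one] at a1 a3
    exact ⟨fun z hz => (a1 z hz).trans hce, fun z w hz hw => (a3 z w hz hw).trans
      (mul_le_mul_of_nonneg_right hce (norm_nonneg _))⟩
  · filter_upwards [hi i, eventually_fst_mem] with ε he hε s hsI
    obtain ⟨a1, a2, a3, a4, a5⟩ := he s hsI
    have hce := mul_le_mul_of_nonneg_right (hle i) hε.1.le
    simp only [pow_one] at a1 a2 a3 a4 a5
    exact ⟨fun z hz => (a1 z hz).trans hce, a2.trans hce, fun z w hz hw => (a3 z w hz hw).trans
      (mul_le_mul_of_nonneg_right hce (norm_nonneg _)), fun z hz => (a4 z hz).trans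
      (mul_le_mul_of_nonneg_right hce (sq_nonneg _)), fun z hz => (a5 z hz).trans
      (mul_le_mul_of_nonneg_right hce (norm_nonneg _))⟩

section Slicing

variable {ξ : ℝ → ℂ → Fin 4 → ℂ} {A B ρ C : ℝ}

theorem norm_I_mul_ofReal (x : ℝ) : ‖Complex.I * (x : ℂ)‖ = |x| := by
  rw [norm_mul, Complex.norm_I, one_mul, Complex.norm_real, Real.norm_eq_abs]

theorem WorldLineBounds.cutResidual_bounds (h : WorldLineBounds ξ A B ρ C) :
    ∀ᶠ ε in 𝓝[>] (0 : ℝ), ∀ s ∈ Set.Icc A B,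
      (∀ lam ζ, |lam| ≤ ρ → |cutResidual (ξ ε) s lam ζ| ≤ 4 * C * ε) ∧
      ∀ lam lam' ζ ζ', |lam| ≤ ρ → |lam'| ≤ ρ →
        |cutResidual (ξ ε) s lam ζ - cutResidual (ξ ε) s lam' ζ'| ≤ 4 * C * ε * |lam - lam'|
          + C * ε * ∑ i, |sphereDir ζ i - sphereDir ζ' i| := by
  filter_upwards [h.time, eventually_all.2 h.space, eventually_fst_mem] with ε h0 hi hε s hs
  obtain ⟨t1, t2⟩ := h0 s hs
  have hCε : 0 ≤ C * ε := mul_nonneg h.const_pos.le hε.1.le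
  constructor
  · intro lam ζ hl
    have hz : ‖Complex.I * (lam : ℂ)‖ ≤ ρ := by rwa [norm_I_mul_ofReal]
    have e0 := (Complex.abs_im_le_norm _).trans (t1 _ hz)
    have e1 : |∑ i : Fin 3, (ξ ε (s + Complex.I * lam) i.succ).im * sphereDir ζ i| ≤ 3 * (C * ε) := by
      refine (Finset.abs_sum_le_sum_abs _ _).trans ?_
      refine (Finset.sum_le_sum (g := fun _ => C * ε) fun i _ => ?_).trans (by simp)
      have := abs_mul_le_mul ((Complex.abs_im_le_norm _).trans ((hi i s hs).1 _ hz))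
        (abs_sphereDir_le ζ i)
      simpa using this
    unfold cutResidual
    refine (abs_sub _ _).trans ?_
    linarith
  · intro lam lam' ζ ζ' hl hl'
    have hz : ‖Complex.I * (lam : ℂ)‖ ≤ ρ := by rwa [norm_I_mul_ofReal]
    have hz' : ‖Complex.I * (lam' : ℂ)‖ ≤ ρ := by rwa [norm_I_mul_ofReal]
    have hd : ‖Complex.I * (lam : ℂ) - Complex.I * lam'‖ = |lam - lam'| := by
      rw [← mul_sub, ← Complex.ofReal_sub, norm_I_mul_ofReal]
    have e0 := (Complex.abs_im_le_norm _).trans (t2 _ _ hz hz')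
    rw [hd, Complex.sub_im] at e0
    have ei : ∀ i : Fin 3, |(ξ ε (s + Complex.I * lam) i.succ).im * sphereDir ζ i
        - (ξ ε (s + Complex.I * lam') i.succ).im * sphereDir ζ' i|
        ≤ C * ε * |lam - lam'| + C * ε * |sphereDir ζ i - sphereDir ζ' i| := by
      intro i
      have b1 := (Complex.abs_im_le_norm _).trans ((hi i s hs).2.2.1 _ _ hz hz')
      rw [hd, Complex.sub_im] at b1
      have b2 := (Complex.abs_im_le_norm _).trans ((hi i s hs).1 _ hz')
      have c1 := abs_mul_le_mul b1 (abs_sphereDir_le ζ i)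
      have c2 := abs_mul_le_mul b2 (le_refl |sphereDir ζ i - sphereDir ζ' i|)
      rw [mul_one] at c1
      rw [show (ξ ε (s + Complex.I * lam) i.succ).im * sphereDir ζ i
        - (ξ ε (s + Complex.I * lam') i.succ).im * sphereDir ζ' i
        = ((ξ ε (s + Complex.I * lam) i.succ).im - (ξ ε (s + Complex.I * lam') i.succ).im)
          * sphereDir ζ i + (ξ ε (s + Complex.I * lam') i.succ).im *
            (sphereDir ζ i - sphereDir ζ' i) by ring]
      exact (abs_add_le _ _).trans (add_le_add c1 c2)
    have e1 : |∑ i : Fin 3, ((ξ ε (s + Complex.I * lam) i.succ).im * sphereDir ζ i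
        - (ξ ε (s + Complex.I * lam') i.succ).im * sphereDir ζ' i)|
        ≤ 3 * (C * ε * |lam - lam'|) + C * ε * ∑ i, |sphereDir ζ i - sphereDir ζ' i| := by
      refine (Finset.abs_sum_le_sum_abs _ _).trans ((Finset.sum_le_sum fun i _ => ei i).trans ?_)
      rw [Finset.sum_add_distrib, Finset.mul_sum]
      simp
    unfold cutResidual
    rw [sub_sub_sub_comm, ← Finset.sum_sub_distrib]
    refine (abs_sub _ _).trans ?_
    linarith

theorem eventually_mul_le {C δ : ℝ} (hδ : 0 < δ) : ∀ᶠ ε in 𝓝[>] (0 : ℝ), C * ε ≤ δ := by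
  have : Tendsto (fun ε : ℝ => C * ε) (𝓝 0) (𝓝 0) := by
    simpa using (show Continuous fun ε : ℝ => C * ε by fun_prop).tendsto 0
  exact mem_nhdsWithin_of_mem_nhds (this.eventually (Iic_mem_nhds hδ))

theorem eventually_sqrt_lt {δ : ℝ} (hδ : 0 < δ) : ∀ᶠ ε in 𝓝[>] (0 : ℝ), √ε < δ := by
  have : Tendsto (fun ε : ℝ => √ε) (𝓝 0) (𝓝 0) := by
    simpa using Real.continuous_sqrt.tendsto 0
  exact mem_nhdsWithin_of_mem_nhds (this.eventually (Iio_mem_nhds hδ))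

/-- The equation is λ = -R(λ) with a residual R = O(ε), continuous in λ. On [-√ε, √ε] the function λ
+ R(λ) changes sign once 4Cε ≤ √ε, and the intermediate value theorem applies. -/
theorem WorldLineBounds.exists_solution (h : WorldLineBounds ξ A B ρ C) :
    ∀ᶠ ε in 𝓝[>] (0 : ℝ), ∀ s ∈ Set.Icc A B, ∀ ζ, ∃ lam : ℝ, |lam| ≤ √ε ∧
      (goodCut (ξ ε) (s + Complex.I * lam) ζ).im = 0 := by
  filter_upwards [h.cutResidual_bounds, eventually_sqrt_lt h.radius_pos, eventually_fst_mem,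
    eventually_sqrt_lt (δ := 1 / (4 * C)) (by have := h.const_pos; positivity)]
    with ε hb hρ hε hC s hs ζ
  obtain ⟨b1, b2⟩ := hb s hs
  have hr : 0 < √ε := Real.sqrt_pos.2 hε.1
  have h4 : 4 * C * ε ≤ √ε := by
    have hCpos := h.const_pos
    rw [lt_div_iff₀ (by positivity)] at hC
    nlinarith [Real.mul_self_sqrt hε.1.le]
  have hin : ∀ lam ∈ Set.Icc (-√ε) (√ε), |lam| ≤ ρ := fun lam hl => (abs_le.2 hl).trans hρ.le
  have hcont : ContinuousOn (fun lam => lam + cutResidual (ξ ε) s lam ζ) (Set.Icc (-√ε) (√ε)) := by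
    refine continuousOn_id.add ?_
    refine (LipschitzOnWith.of_dist_le_mul (K := Real.toNNReal (4 * C * ε)) ?_).continuousOn
    intro x hx y hy
    have := b2 x y ζ ζ (hin x hx) (hin y hy)
    rw [Real.dist_eq, Real.dist_eq, Real.coe_toNNReal _ (by have := h.const_pos; have := hε.1
                                                            positivity)]
    simpa using this
  have hle : -√ε ≤ √ε := by linarith
  have hL := abs_le.1 (b1 (-√ε) ζ (hin _ ⟨le_rfl, hle⟩))
  have hR := abs_le.1 (b1 (√ε) ζ (hin _ ⟨hle, le_rfl⟩))
  obtain ⟨lam, hl, h0⟩ := intermediate_value_Icc hle hcont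
    (show (0 : ℝ) ∈ _ from ⟨by linarith, by linarith⟩)
  exact ⟨lam, abs_le.2 hl, by rw [goodCut_im]; simp only at h0; rw [h0, mul_zero]⟩

theorem IsSlowWorldLine.exists_isRealSlicing {U : Set ℂ} (h : IsSlowWorldLine U ξ) :
    ∃ Λ, IsRealSlicing ξ Λ := by
  classical
  -- The bound √ε, unlike the constant C, does not depend on the interval [A, B], so one choice of
  -- solution serves all intervals. Where no solution exists the default value is 0.
  let P : ℝ → ℝ → ℂ → Prop := fun ε s ζ => ∃ lam : ℝ, |lam| ≤ √ε ∧
      (goodCut (ξ ε) (s + Complex.I * lam) ζ).im = 0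
  have hP : ∀ A B : ℝ, ∀ᶠ ε in 𝓝[>] (0 : ℝ), ∀ s ∈ Set.Icc A B, ∀ ζ, P ε s ζ := by
    intro A B
    obtain ⟨ρ, C, hb⟩ := h.exists_bounds A B
    exact hb.exists_solution
  refine ⟨fun ε s ζ => if hp : P ε s ζ then hp.choose else 0, ⟨fun A B δ hδ => ?_, fun A B => ?_⟩⟩
  · filter_upwards [hP A B, eventually_sqrt_lt hδ] with ε h1 h2 s hs ζ
    rw [dif_pos (h1 s hs ζ)]
    exact (h1 s hs ζ).choose_spec.1.trans_lt h2
  · filter_upwards [hP A B] with ε h1 s hs ζ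
    rw [dif_pos (h1 s hs ζ)]
    exact (h1 s hs ζ).choose_spec.2

theorem WorldLineBounds.slicing_eq (h : WorldLineBounds ξ A B ρ C) {Λ : ℝ → ℝ → ℂ → ℝ}
    (hΛ : IsRealSlicing ξ Λ) : ∀ᶠ ε in 𝓝[>] (0 : ℝ), ∀ s ∈ Set.Icc A B, ∀ ζ,
      |Λ ε s ζ| ≤ ρ ∧ Λ ε s ζ = -cutResidual (ξ ε) s (Λ ε s ζ) ζ ∧ |Λ ε s ζ| ≤ 4 * C * ε := by
  filter_upwards [h.cutResidual_bounds, hΛ.small A B ρ h.radius_pos, hΛ.real_cut A B]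
    with ε hb h1 h2 s hs ζ
  have e := (goodCut_im_eq_zero_iff _ _ _ _).1 (h2 s hs ζ)
  refine ⟨(h1 s hs ζ).le, e, ?_⟩
  rw [e, abs_neg]
  exact (hb s hs).1 _ ζ (h1 s hs ζ).le

/-- The residual is a contraction in λ for small ε, so its fixed points depend
Lipschitz-continuously on the direction. Allowing two slicings and two directions at once gives
uniqueness (equal directions) and continuity (equal slicings). -/
theorem WorldLineBounds.slicing_lipschitz (h : WorldLineBounds ξ A B ρ C)
    {Λ Λ' : ℝ → ℝ → ℂ → ℝ} (hΛ : IsRealSlicing ξ Λ) (hΛ' : IsRealSlicing ξ Λ') :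
    ∀ᶠ ε in 𝓝[>] (0 : ℝ), ∀ s ∈ Set.Icc A B, ∀ ζ ζ', |Λ ε s ζ - Λ' ε s ζ'|
      ≤ 2 * C * ε * ∑ i, |sphereDir ζ i - sphereDir ζ' i| := by
  filter_upwards [h.cutResidual_bounds, h.slicing_eq hΛ, h.slicing_eq hΛ',
    eventually_mul_le (C := 4 * C) (δ := 1 / 2) (by norm_num)] with ε hb h1 h2 h3 s hs ζ ζ'
  obtain ⟨a1, a2, -⟩ := h1 s hs ζ
  obtain ⟨b1, b2, -⟩ := h2 s hs ζ'
  have key := (hb s hs).2 _ _ ζ ζ' a1 b1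
  have e : |Λ ε s ζ - Λ' ε s ζ'| = |cutResidual (ξ ε) s (Λ ε s ζ) ζ
      - cutResidual (ξ ε) s (Λ' ε s ζ') ζ'| := by
    conv_lhs => rw [a2, b2]
    rw [← abs_neg]; ring_nf
  rw [← e] at key
  have := mul_le_mul_of_nonneg_right h3 (abs_nonneg (Λ ε s ζ - Λ' ε s ζ'))
  linarith

theorem IsSlowWorldLine.slicing_unique {U : Set ℂ} (h : IsSlowWorldLine U ξ)
    {Λ Λ' : ℝ → ℝ → ℂ → ℝ} (hΛ : IsRealSlicing ξ Λ) (hΛ' : IsRealSlicing ξ Λ') (A B : ℝ) :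
    ∀ᶠ ε in 𝓝[>] (0 : ℝ), ∀ s ∈ Set.Icc A B, ∀ ζ, Λ ε s ζ = Λ' ε s ζ := by
  obtain ⟨ρ, C, hb⟩ := h.exists_bounds A B
  filter_upwards [hb.slicing_lipschitz hΛ hΛ'] with ε h1 s hs ζ
  have := h1 s hs ζ ζ
  simp only [sub_self, abs_zero, Finset.sum_const_zero, mul_zero] at this
  exact sub_eq_zero.1 (abs_eq_zero.1 (le_antisymm this (abs_nonneg _)))

theorem WorldLineBounds.slicing_continuous (h : WorldLineBounds ξ A B ρ C)
    {Λ : ℝ → ℝ → ℂ → ℝ} (hΛ : IsRealSlicing ξ Λ) :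
    ∀ᶠ ε in 𝓝[>] (0 : ℝ), ∀ s ∈ Set.Icc A B, Continuous (Λ ε s) := by
  filter_upwards [h.slicing_lipschitz hΛ hΛ] with ε h1 s hs
  rw [continuous_iff_continuousAt]
  intro ζ₀
  rw [ContinuousAt, tendsto_iff_norm_sub_tendsto_zero]
  have hc : Continuous fun ζ => 2 * C * ε * ∑ i, |sphereDir ζ i - sphereDir ζ₀ i| := by fun_prop
  have hc0 := hc.tendsto ζ₀
  simp only [sub_self, abs_zero, Finset.sum_const_zero, mul_zero] at hc0
  exact squeeze_zero (fun _ => norm_nonneg _) (fun ζ => h1 s hs ζ ζ₀) hc0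

end Slicing

/-! ### Expansion of the world line on the real cuts -/

section Expansion

variable {ξ : ℝ → ℂ → Fin 4 → ℂ} {A B ρ C : ℝ} {Λ : ℝ → ℝ → ℂ → ℝ}

/-- The parameter set of the points of the real cuts with labels in `[A, B]`. -/
def cutSet (A B : ℝ) : Set (ℝ × ℂ) := Set.Icc A B ×ˢ Set.univ

/-- The time `u_B` at which the real cut with label `s` meets the generator `ζ`. -/
noncomputable def cutTime (ξ : ℝ → ℂ → Fin 4 → ℂ) (Λ : ℝ → ℝ → ℂ → ℝ) (p : ℝ × ℝ × ℂ) : ℝ :=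
  (goodCut (ξ p.1) (p.2.1 + Complex.I * Λ p.1 p.2.1 p.2.2) p.2.2).re

theorem hasOrder_sphereDir (S : Set (ℝ × ℂ)) (i : Fin 3) :
    HasOrder S 0 fun p => (sphereDir p.2.2 i : ℂ) :=
  hasOrder_zero_of_bound 1 fun _ x _ => by
    rw [Complex.norm_real, Real.norm_eq_abs]; exact abs_sphereDir_le _ i

theorem hasOrder_Y1 (S : Set (ℝ × ℂ)) (k i : Fin 3) : HasOrder S 0 fun p => Y1 k i p.2.2 :=
  hasOrder_zero_of_bound 2 fun _ _ _ => norm_Y1_le k i _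

namespace WorldLineBounds

theorem hasOrder_slicing (h : WorldLineBounds ξ A B ρ C) (hΛ : IsRealSlicing ξ Λ) :
    HasOrder (cutSet A B) 1 fun p => (Λ p.1 p.2.1 p.2.2 : ℂ) := by
  rw [hasOrder_iff]
  refine ⟨4 * C, ?_⟩
  filter_upwards [h.slicing_eq hΛ] with ε he x hx
  rw [Complex.norm_real, pow_one]
  exact (he x.1 hx.1 x.2).2.2

theorem hasOrder_space (h : WorldLineBounds ξ A B ρ C) (i : Fin 3) :
    HasOrder (Set.Icc A B) 1 fun p => ξ p.1 p.2 i.succ := by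
  rw [hasOrder_iff]
  refine ⟨C, ?_⟩
  filter_upwards [h.space i] with ε he s hs
  simpa using (he s hs).1 0 (by simpa using h.radius_pos.le)

theorem hasOrder_space_deriv (h : WorldLineBounds ξ A B ρ C) (i : Fin 3) :
    HasOrder (Set.Icc A B) 1 fun p => deriv (fun τ => ξ p.1 τ i.succ) p.2 := by
  rw [hasOrder_iff]
  refine ⟨C, ?_⟩
  filter_upwards [h.space i] with ε he s hs
  simpa using (he s hs).2.1

theorem hasOrder_space_cut (h : WorldLineBounds ξ A B ρ C) (hΛ : IsRealSlicing ξ Λ) (i : Fin 3) :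
    HasOrder (cutSet A B) 1
      fun p => ξ p.1 (p.2.1 + Complex.I * Λ p.1 p.2.1 p.2.2) i.succ := by
  rw [hasOrder_iff]
  refine ⟨C, ?_⟩
  filter_upwards [h.space i, h.slicing_eq hΛ] with ε he hl x hx
  simpa using (he x.1 hx.1).1 _ (by rw [norm_I_mul_ofReal]; exact (hl x.1 hx.1 x.2).1)

theorem hasOrder_space_cut_sub (h : WorldLineBounds ξ A B ρ C) (hΛ : IsRealSlicing ξ Λ)
    (i : Fin 3) : HasOrder (cutSet A B) 2
      fun p => ξ p.1 (p.2.1 + Complex.I * Λ p.1 p.2.1 p.2.2) i.succ - ξ p.1 p.2.1 i.succ := by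
  refine (hasOrder_param.mul (h.hasOrder_slicing hΛ)).of_le C ?_
  filter_upwards [h.space i, h.slicing_eq hΛ, eventually_fst_mem] with ε he hl hε x hx
  have := (he x.1 hx.1).2.2.1 (Complex.I * Λ ε x.1 x.2) 0
    (by rw [norm_I_mul_ofReal]; exact (hl x.1 hx.1 x.2).1) (by simpa using h.radius_pos.le)
  rw [sub_zero, norm_I_mul_ofReal, add_zero] at this
  refine this.trans_eq ?_
  rw [norm_mul, Complex.norm_real, Complex.norm_real, Real.norm_of_nonneg hε.1.le,
    Real.norm_eq_abs, mul_assoc]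

theorem hasOrder_space_cut_taylor (h : WorldLineBounds ξ A B ρ C) (hΛ : IsRealSlicing ξ Λ)
    (i : Fin 3) : HasOrder (cutSet A B) 3
      fun p => ξ p.1 (p.2.1 + Complex.I * Λ p.1 p.2.1 p.2.2) i.succ - ξ p.1 p.2.1 i.succ
        - Complex.I * Λ p.1 p.2.1 p.2.2 * deriv (fun τ => ξ p.1 τ i.succ) p.2.1 := by
  refine (hasOrder_param.mul ((h.hasOrder_slicing hΛ).mul (h.hasOrder_slicing hΛ))).of_le C ?_
  filter_upwards [h.space i, h.slicing_eq hΛ, eventually_fst_mem] with ε he hl hε x hx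
  have := (he x.1 hx.1).2.2.2.1 (Complex.I * Λ ε x.1 x.2)
    (by rw [norm_I_mul_ofReal]; exact (hl x.1 hx.1 x.2).1)
  rw [norm_I_mul_ofReal] at this
  refine this.trans_eq ?_
  rw [norm_mul, norm_mul, Complex.norm_real, Complex.norm_real, Real.norm_of_nonneg hε.1.le,
    Real.norm_eq_abs]
  ring

/-- One step of the fixed-point iteration: replacing λ by 0 in the residual costs the Lipschitz
constant O(ε) times Λ = O(ε). -/
theorem hasOrder_slicing_sub (h : WorldLineBounds ξ A B ρ C) (hΛ : IsRealSlicing ξ Λ) :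
    HasOrder (cutSet A B) 2 fun p => (Λ p.1 p.2.1 p.2.2 : ℂ)
      - (-((ξ p.1 p.2.1 0).im : ℂ) + ∑ j : Fin 3, ((ξ p.1 p.2.1 j.succ).im : ℂ) *
        sphereDir p.2.2 j) := by
  refine (hasOrder_param.mul (h.hasOrder_slicing hΛ)).of_le (4 * C) ?_
  filter_upwards [h.cutResidual_bounds, h.slicing_eq hΛ, eventually_fst_mem] with ε he hl hε x hx
  obtain ⟨l1, l2, -⟩ := hl x.1 hx.1 x.2
  have := (he x.1 hx.1).2 0 (Λ ε x.1 x.2) x.2 x.2 (by simpa using h.radius_pos.le) l1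
  simp only [sub_self, abs_zero, Finset.sum_const_zero, mul_zero, add_zero, zero_sub, abs_neg]
    at this
  have e : (Λ ε x.1 x.2 : ℂ) - (-((ξ ε x.1 0).im : ℂ) + ∑ j : Fin 3, ((ξ ε x.1 j.succ).im : ℂ) *
      sphereDir x.2 j)
      = ((cutResidual (ξ ε) x.1 0 x.2 - cutResidual (ξ ε) x.1 (Λ ε x.1 x.2) x.2 : ℝ) : ℂ) := by
    have e0 : cutResidual (ξ ε) x.1 0 x.2
        = (ξ ε x.1 0).im - ∑ j : Fin 3, (ξ ε x.1 j.succ).im * sphereDir x.2 j := by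
      simp [cutResidual]
    conv_lhs => rw [l2]
    rw [e0]
    push_cast; ring
  rw [e, norm_mul, Complex.norm_real, Complex.norm_real, Complex.norm_real,
    Real.norm_of_nonneg hε.1.le, Real.norm_eq_abs, Real.norm_eq_abs, ← mul_assoc]
  exact this

/-- Moving from s to s + iΛ changes the deviation ξ^0 - τ and the spatial components by O(ε²) only,
and iΛ itself has no real part. The normalisation of Re ξ^0 on the real axis then leaves only the
first-order term in Re ξ^j. -/
theorem hasOrder_cutTime_sub (h : WorldLineBounds ξ A B ρ C) (hΛ : IsRealSlicing ξ Λ)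
    (hre : HasOrder (Set.Icc A B) 2 fun p => (((ξ p.1 p.2 0).re - p.2 : ℝ) : ℂ)) :
    HasOrder (cutSet A B) 2 fun p => ((cutTime ξ Λ p : ℂ) - (p.2.1 / √2 : ℝ))
      + (√2 / 2 : ℝ) * ∑ j : Fin 3, ((ξ p.1 p.2.1 j.succ).re : ℂ) * sphereDir p.2.2 j := by
  have h1 : HasOrder (cutSet A B) 2 fun p =>
      ((ξ p.1 (p.2.1 + Complex.I * Λ p.1 p.2.1 p.2.2) 0
        - (p.2.1 + Complex.I * Λ p.1 p.2.1 p.2.2)) - (ξ p.1 p.2.1 0 - p.2.1)) := by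
    refine (hasOrder_param.mul (h.hasOrder_slicing hΛ)).of_le C ?_
    filter_upwards [h.time, h.slicing_eq hΛ, eventually_fst_mem] with ε he hl hε x hx
    have := (he x.1 hx.1).2 (Complex.I * Λ ε x.1 x.2) 0
      (by rw [norm_I_mul_ofReal]; exact (hl x.1 hx.1 x.2).1) (by simpa using h.radius_pos.le)
    rw [sub_zero, norm_I_mul_ofReal, add_zero] at this
    refine this.trans_eq ?_
    rw [norm_mul, Complex.norm_real, Complex.norm_real, Real.norm_of_nonneg hε.1.le,
      Real.norm_eq_abs, mul_assoc]
  have h2 : HasOrder (cutSet A B) 2 fun p => (((ξ p.1 p.2.1 0).re - p.2.1 : ℝ) : ℂ) :=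
    hre.comp (T := cutSet A B) (fun _ x => x.1) (Eventually.of_forall fun _ x hx => hx.1)
  have h3 : HasOrder (cutSet A B) 2 fun p => ∑ j : Fin 3,
      (((ξ p.1 (p.2.1 + Complex.I * Λ p.1 p.2.1 p.2.2) j.succ - ξ p.1 p.2.1 j.succ).re : ℝ) : ℂ)
        * sphereDir p.2.2 j :=
    HasOrder.sum fun j _ => (h.hasOrder_space_cut_sub hΛ j).re.mul (hasOrder_sphereDir _ j)
  refine (((h1.re.add h2).sub h3).const_mul ((√2 / 2 : ℝ) : ℂ)).congr
    (Eventually.of_forall fun ε x _ => ?_)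
  have hs : x.1 / √2 = √2 / 2 * x.1 := by
    rw [div_eq_iff (by positivity)]
    linear_combination (-x.1 / 2) * Real.mul_self_sqrt (show (0 : ℝ) ≤ 2 by norm_num)
  simp only [cutTime, goodCut_eq, Complex.re_ofReal_mul, hs]
  simp only [Fin.sum_univ_three, Complex.sub_re, Complex.add_re, Complex.mul_re,
    Complex.ofReal_re, Complex.ofReal_im, mul_zero, sub_zero, Complex.I_re, Complex.I_im, zero_mul]
  push_cast; ring

end WorldLineBounds

theorem cutTime_sub_order (h : WorldLineBounds ξ A B ρ C) (hΛ : IsRealSlicing ξ Λ)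
    (hre : HasOrder (Set.Icc A B) 2 fun p => (((ξ p.1 p.2 0).re - p.2 : ℝ) : ℂ)) :
    HasOrder (cutSet A B) 1 fun p => ((cutTime ξ Λ p : ℂ) - (p.2.1 / √2 : ℝ)) := by
  have h2 : HasOrder (cutSet A B) 1 fun p => (√2 / 2 : ℝ) *
      ∑ j : Fin 3, ((ξ p.1 p.2.1 j.succ).re : ℂ) * sphereDir p.2.2 j :=
    (HasOrder.sum fun j _ => (((h.hasOrder_space j).comp (T := cutSet A B) (fun _ x => x.1)
      (Eventually.of_forall fun _ x hx => hx.1)).re.mul (hasOrder_sphereDir _ j))).const_mul _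
  exact (((h.hasOrder_cutTime_sub hΛ hre).mono (by norm_num)).sub h2).congr
    (Eventually.of_forall fun ε x _ => by ring)

theorem cutTime_mem (h : WorldLineBounds ξ A B ρ C) (hΛ : IsRealSlicing ξ Λ)
    (hre : HasOrder (Set.Icc A B) 2 fun p => (((ξ p.1 p.2 0).re - p.2 : ℝ) : ℂ)) :
    ∀ᶠ ε in 𝓝[>] (0 : ℝ), ∀ x ∈ cutSet A B,
      cutTime ξ Λ (ε, x) ∈ Set.Icc (A / √2 - 1) (B / √2 + 1) ∧
      x.1 / √2 ∈ Set.Icc (A / √2 - 1) (B / √2 + 1) := by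
  obtain ⟨M, hM⟩ := hasOrder_iff.1 (cutTime_sub_order h hΛ hre)
  filter_upwards [hM, eventually_mul_le (C := M) one_pos] with ε h1 h2 x hx
  have e := h1 x hx
  rw [pow_one, ← Complex.ofReal_sub, Complex.norm_real, Real.norm_eq_abs] at e
  have e' := abs_le.1 (e.trans h2)
  have a1 : A / √2 ≤ x.1 / √2 := div_le_div_of_nonneg_right hx.1.1 (Real.sqrt_nonneg 2)
  have a2 : x.1 / √2 ≤ B / √2 := div_le_div_of_nonneg_right hx.1.2 (Real.sqrt_nonneg 2)
  exact ⟨⟨by linarith, by linarith⟩, ⟨by linarith, by linarith⟩⟩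

end Expansion

/-! ### Expansion of the field on the real cuts -/

section SmoothFamily

theorem hasDerivAt_iteratedDeriv {f : ℝ → ℂ} (hf : ContDiff ℝ ∞ f) (j : ℕ) (u : ℝ) :
    HasDerivAt (iteratedDeriv j f) (iteratedDeriv (j + 1) f u) u := by
  rw [iteratedDeriv_succ]
  exact (hf.differentiable_iteratedDeriv j (by exact_mod_cast ENat.natCast_lt_top j) u).hasDerivAt

/-- Bounds for a smooth family of functions of time whose derivatives are all of order `k`. -/
theorem smooth_family_bounds {k : ℕ} {f : ℝ → ℝ → ℂ} (hf : ∀ ε > 0, ContDiff ℝ ∞ (f ε))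
    (ho : ∀ j, IsOrder k Set.univ fun ε => iteratedDeriv j (f ε)) (A B : ℝ) :
    ∃ M : ℝ, ∀ᶠ ε in 𝓝[>] (0 : ℝ), ∀ u ∈ Set.Icc A B, ∀ v ∈ Set.Icc A B,
      ‖f ε u - f ε v‖ ≤ M * ε ^ k * ‖u - v‖ ∧
      ‖deriv (f ε) u - deriv (f ε) v‖ ≤ M * ε ^ k * ‖u - v‖ ∧
      ‖f ε u - f ε v - (u - v) • deriv (f ε) v‖ ≤ M * ε ^ k * ‖u - v‖ ^ 2 := by
  obtain ⟨M₁, h₁⟩ := ho 1 (Set.Icc A B) (Set.subset_univ _) isCompact_Icc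
  obtain ⟨M₂, h₂⟩ := ho 2 (Set.Icc A B) (Set.subset_univ _) isCompact_Icc
  refine ⟨|M₁| + |M₂|, ?_⟩
  filter_upwards [h₁, h₂, eventually_fst_mem] with ε e1 e2 hε u hu v hv
  have hek : 0 ≤ ε ^ k := pow_nonneg hε.1.le k
  have d0 : ∀ x ∈ Set.Icc A B, HasDerivAt (f ε) (deriv (f ε) x) x := fun x _ => by
    have := hasDerivAt_iteratedDeriv (hf ε hε.1) 0 x
    rwa [iteratedDeriv_zero, zero_add, iteratedDeriv_one] at this
  have d1 : ∀ x ∈ Set.Icc A B, HasDerivAt (deriv (f ε)) (iteratedDeriv 2 (f ε) x) x := fun x _ => by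
    have := hasDerivAt_iteratedDeriv (hf ε hε.1) 1 x
    rwa [iteratedDeriv_one] at this
  have b1 : ∀ x ∈ Set.Icc A B, ‖deriv (f ε) x‖ ≤ (|M₁| + |M₂|) * ε ^ k := fun x hx => by
    have := e1 x hx
    rw [iteratedDeriv_one] at this
    exact this.trans (mul_le_mul_of_nonneg_right
      (by linarith [le_abs_self M₁, abs_nonneg M₂]) hek)
  have b2 : ∀ x ∈ Set.Icc A B, ‖iteratedDeriv 2 (f ε) x‖ ≤ (|M₁| + |M₂|) * ε ^ k := fun x hx =>
    (e2 x hx).trans (mul_le_mul_of_nonneg_right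
      (by linarith [le_abs_self M₂, abs_nonneg M₁]) hek)
  have hc : Convex ℝ (Set.Icc A B) := convex_Icc A B
  exact ⟨hc.norm_image_sub_le_of_norm_hasDerivWithin_le (fun x hx => (d0 x hx).hasDerivWithinAt) b1
    hv hu, hc.norm_image_sub_le_of_norm_hasDerivWithin_le (fun x hx => (d1 x hx).hasDerivWithinAt)
    b2 hv hu, norm_taylor_le hc d0 d1 b2 hv hu⟩

end SmoothFamily

section Field

variable {q : ℝ} {F : ℝ → Minkowski → Fin 4 → Fin 4 → ℝ} {φ : ℝ → Fin 3 → ℝ → ℂ → ℂ}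

theorem IsAsymptoticallyVanishing.continuous_leading {F : Minkowski → Fin 4 → Fin 4 → ℝ}
    {φ : Fin 3 → ℝ → ℂ → ℂ} (h : IsAsymptoticallyVanishing F φ) (k : Fin 3) :
    Continuous fun p : ℝ × ℂ => φ k p.1 p.2 := by
  obtain ⟨⟨D, hD, hM⟩, hp⟩ := h
  exact hM.continuous_leading hD hp k

theorem IsAsymptoticallyVanishing.isBddCont {F : Minkowski → Fin 4 → Fin 4 → ℝ}
    {φ : Fin 3 → ℝ → ℂ → ℂ} (h : IsAsymptoticallyVanishing F φ) (k : Fin 3) (u : ℝ) :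
    IsBddCont (φ k u) := by
  have hc := (h.continuous_leading k).comp (continuous_const.prodMk continuous_id : Continuous
    fun ζ => (u, ζ))
  obtain ⟨⟨D, hD, hM⟩, hp⟩ := h
  obtain ⟨M, hb⟩ := hM.exists_bound_leading hD hp k u u
  exact ⟨hc, M, fun ζ => hb u ⟨le_rfl, le_rfl⟩ ζ⟩

theorem IsAsymptoticallyVanishing.hasDerivAt_coeff1 {F : Minkowski → Fin 4 → Fin 4 → ℝ}
    {φ : Fin 3 → ℝ → ℂ → ℂ} (h : IsAsymptoticallyVanishing F φ) (k : Fin 3) (u : ℝ) :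
    HasDerivAt (fun u => coeff1 0 (φ 0 u) k) (2 * coeff1 1 (φ 1 u) k) u := by
  obtain ⟨⟨D, hD, hM⟩, hp⟩ := h
  have := (hM.hasDerivAt_leading hD hp k u).mul_const (3 / sphereArea : ℂ)
  simp only [coeff1_zero_eq, coeff1_one_eq]
  refine this.congr_deriv ?_
  have := sphereArea_ne
  field_simp

theorem bondiCenter_spec (hq : q ≠ 0) (φ : Fin 3 → ℝ → ℂ → ℂ) (s : ℝ) (i : Fin 3) :
    coeff1 0 (φ 0 (s / √2)) i = 2 * q * bondiCenter q φ s i := by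
  have : (q : ℂ) ≠ 0 := by exact_mod_cast hq
  rw [bondiCenter]; field_simp

theorem IsAsymptoticallyVanishing.hasDerivAt_bondiCenter {F : Minkowski → Fin 4 → Fin 4 → ℝ}
    {φ : Fin 3 → ℝ → ℂ → ℂ} (h : IsAsymptoticallyVanishing F φ) (s : ℝ) (i : Fin 3) :
    HasDerivAt (fun w => bondiCenter q φ w i)
      ((1 / √2 : ℝ) * (2 * coeff1 1 (φ 1 (s / √2)) i) / (2 * q)) s := by
  have h1 : HasDerivAt (fun w : ℝ => w / √2) (1 / √2) s := (hasDerivAt_id s).div_const _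
  have h2 := (h.hasDerivAt_coeff1 i (s / √2)).scomp s h1
  rw [Complex.real_smul] at h2
  exact h2.div_const _

theorem sqrt_two_mul_inv : ((√2 : ℝ) : ℂ) * ((1 / √2 : ℝ) : ℂ) = 1 := by
  rw [← Complex.ofReal_mul, mul_one_div_cancel (by positivity), Complex.ofReal_one]

theorem sqrt_two_mul_self : ((√2 : ℝ) : ℂ) * ((√2 : ℝ) : ℂ) = 2 := by
  rw [← Complex.ofReal_mul, Real.mul_self_sqrt (by norm_num)]; norm_num

/-- The dipole part of `φ_1^0` is the rate of change of the dipole. -/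
theorem IsAsymptoticallyVanishing.coeff1_one_eq_deriv (hq : q ≠ 0)
    {F : Minkowski → Fin 4 → Fin 4 → ℝ} {φ : Fin 3 → ℝ → ℂ → ℂ}
    (h : IsAsymptoticallyVanishing F φ) (s : ℝ) (i : Fin 3) :
    coeff1 1 (φ 1 (s / √2)) i = √2 * q * bondiCenterDeriv q φ s i := by
  have : (q : ℂ) ≠ 0 := by exact_mod_cast hq
  rw [bondiCenterDeriv, (h.hasDerivAt_bondiCenter s i).deriv]
  field_simp
  linear_combination (-coeff1 1 (φ 1 (s / √2)) i) * sqrt_two_mul_inv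

theorem IsAsymptoticallyVanishing.deriv_coeff1_eq (hq : q ≠ 0)
    {F : Minkowski → Fin 4 → Fin 4 → ℝ} {φ : Fin 3 → ℝ → ℂ → ℂ}
    (h : IsAsymptoticallyVanishing F φ) (s : ℝ) (i : Fin 3) :
    deriv (fun u => coeff1 0 (φ 0 u) i) (s / √2) = 2 * √2 * q * bondiCenterDeriv q φ s i := by
  rw [(h.hasDerivAt_coeff1 i _).deriv, h.coeff1_one_eq_deriv hq]; ring

/-- The second-order part of the rotated dipole, divided by the charge. -/
noncomputable def dipoleQuadratic (q : ℝ) (φ : Fin 3 → ℝ → ℂ → ℂ) (z : ℂ → Fin 4 → ℂ) (s : ℝ)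
    (k : Fin 3) : ℂ :=
  Complex.I * ((z s 0).im : ℂ) * deriv (fun τ => z τ k.succ) s
    + Complex.I / 2 * ∑ i : Fin 3, ∑ j : Fin 3, (leviCivita i j k : ℂ) *
      (-(bondiCenterDeriv q φ s i * (z s j.succ).re)
        - Complex.I * (deriv (fun τ => z τ i.succ) s * (z s j.succ).im)
        - 2 * (z s i.succ * bondiCenterDeriv q φ s j))

/-- The expansion of `φ_0^{*0}` on the real cut `s` up to third-order terms. -/
noncomputable def rotatedExpansion (q : ℝ) (φ : Fin 3 → ℝ → ℂ → ℂ) (z : ℂ → Fin 4 → ℂ) (s : ℝ)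
    (ζ : ℂ) : ℂ :=
  ∑ i : Fin 3, 2 * q * (bondiCenter q φ s i - z s i.succ
      + Complex.I * ((z s 0).im : ℂ) * deriv (fun τ => z τ i.succ) s) * Y1 0 i ζ
    + ∑ i : Fin 3, ∑ j : Fin 3, 2 * q *
      (-(bondiCenterDeriv q φ s i * (z s j.succ).re)
        - Complex.I * (deriv (fun τ => z τ i.succ) s * (z s j.succ).im)
        - 2 * (z s i.succ * bondiCenterDeriv q φ s j)) * (sphereDir ζ j * Y1 0 i ζ)
    + higherPart 0 (φ 0 (s / √2)) ζ

theorem isBddCont_higherPart {f : ℂ → ℂ} (hf : IsBddCont f) (k : Fin 3) :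
    IsBddCont (higherPart k f) :=
  (hf.sub (.const _)).sub (.sum _ fun i _ => (IsBddCont.const _).mul (.Y1 k i))

theorem isBddCont_rotatedExpansion {F : Minkowski → Fin 4 → Fin 4 → ℝ} {φ : Fin 3 → ℝ → ℂ → ℂ}
    (h : IsAsymptoticallyVanishing F φ) (z : ℂ → Fin 4 → ℂ) (s : ℝ) :
    IsBddCont (rotatedExpansion q φ z s) :=
  ((IsBddCont.sum _ fun i _ => (IsBddCont.const _).mul (.Y1 0 i)).add
    (.sum _ fun i _ => .sum _ fun j _ => (IsBddCont.const _).mul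
      ((IsBddCont.sphereDir j).mul (.Y1 0 i)))).add (isBddCont_higherPart (h.isBddCont 0 _) 0)

theorem coeff1_zero_expansion (c : Fin 3 → ℂ) (d : Fin 3 → Fin 3 → ℂ) {g : ℂ → ℂ}
    (hg : IsBddCont g) (k : Fin 3) :
    coeff1 0 (fun ζ => ∑ i, c i * Y1 0 i ζ + ∑ i, ∑ j, d i j * (sphereDir ζ j * Y1 0 i ζ) + g ζ) k
      = c k + ∑ i, ∑ j, d i j * (Complex.I / 2 * leviCivita i j k) + coeff1 0 g k := by
  have b1 : ∀ i ∈ Finset.univ, IsBddCont fun ζ => c i * Y1 0 i ζ :=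
    fun i _ => (IsBddCont.const _).mul (.Y1 0 i)
  have b2 : ∀ i : Fin 3, ∀ j ∈ Finset.univ,
      IsBddCont fun ζ => d i j * ((sphereDir ζ j : ℂ) * Y1 0 i ζ) :=
    fun i j _ => (IsBddCont.const _).mul ((IsBddCont.sphereDir j).mul (.Y1 0 i))
  have b3 : ∀ i ∈ Finset.univ,
      IsBddCont fun ζ => ∑ j, d i j * ((sphereDir ζ j : ℂ) * Y1 0 i ζ) :=
    fun i _ => .sum _ (b2 i)
  rw [coeff1_zero_add k ((IsBddCont.sum _ b1).add (.sum _ b3)) hg,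
    coeff1_zero_add k (IsBddCont.sum _ b1) (.sum _ b3),
    coeff1_zero_sum k _ b1, coeff1_zero_sum k _ b3,
    Finset.sum_congr rfl fun i _ => coeff1_zero_sum k _ (b2 i)]
  simp only [coeff1_zero_const_mul, coeff1_zero_Y1, coeff1_zero_sphereDir_mul_Y1, mul_ite, mul_one,
    mul_zero, Finset.sum_ite_eq', Finset.mem_univ, if_true]

theorem coeff1_rotatedExpansion {F : Minkowski → Fin 4 → Fin 4 → ℝ} {φ : Fin 3 → ℝ → ℂ → ℂ}
    (h : IsAsymptoticallyVanishing F φ) (z : ℂ → Fin 4 → ℂ) (s : ℝ) (k : Fin 3) :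
    coeff1 0 (rotatedExpansion q φ z s) k
      = 2 * q * (bondiCenter q φ s k - z s k.succ + dipoleQuadratic q φ z s k) := by
  refine (coeff1_zero_expansion _ _ (isBddCont_higherPart (h.isBddCont 0 (s / √2)) 0) k).trans ?_
  rw [coeff1_zero_higherPart k (h.isBddCont 0 _)]
  simp only [dipoleQuadratic, Fin.sum_univ_three]
  ring

variable {ξ : ℝ → ℂ → Fin 4 → ℂ} {A B ρ C : ℝ} {Λ : ℝ → ℝ → ℂ → ℝ}

/-- A tautology, since `higherPart` is defined as the remainder. The charge hypothesis enters here
as the constant term of φ_1^0. -/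
theorem leading_decomposition {φ : Fin 3 → ℝ → ℂ → ℂ} (hc : ∀ u, monopole (φ 1 u) = q) (u : ℝ)
    (ζ : ℂ) :
    φ 0 u ζ = ∑ i, coeff1 0 (φ 0 u) i * Y1 0 i ζ + higherPart 0 (φ 0 u) ζ ∧
    φ 1 u ζ = q + ∑ i, coeff1 1 (φ 1 u) i * Y1 1 i ζ + higherPart 1 (φ 1 u) ζ ∧
    φ 2 u ζ = ∑ i, coeff1 2 (φ 2 u) i * Y1 2 i ζ + higherPart 2 (φ 2 u) ζ := by
  simp only [higherPart, hc]
  refine ⟨?_, ?_, ?_⟩ <;> simp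

/-- The angle field is of first order, so φ_0^0 is needed to second order, the dipole part of φ_1^0
to first order, and its l ≥ 2 part not at all. The charge multiplies L alone, so there ξ needs its
Taylor expansion up to O(ε³). The term L² φ_2^0 is negligible because φ_2^0 has no l = 0 part and is
therefore of first order. -/
theorem rotatedPhi0_sub_order (hq : q ≠ 0)
    (hF : ∀ ε > 0, IsAsymptoticallyVanishing (F ε) (φ ε))
    (hcharge : ∀ ε > 0, ∀ u : ℝ, monopole (φ ε 1 u) = q) (horders : MultipoleOrders φ)
    (h : WorldLineBounds ξ A B ρ C) (hΛ : IsRealSlicing ξ Λ)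
    (hre : HasOrder (Set.Icc A B) 2 fun p => (((ξ p.1 p.2 0).re - p.2 : ℝ) : ℂ)) :
    HasOrder (cutSet A B) 3 fun p => rotatedPhi0 (φ p.1) (ξ p.1) (Λ p.1 p.2.1) p.2.1 p.2.2
      - rotatedExpansion q (φ p.1) (ξ p.1) p.2.1 p.2.2 := by
  set A' := A / √2 - 1
  set B' := B / √2 + 1
  have hmem := cutTime_mem h hΛ hre
  have hdu := cutTime_sub_order h hΛ hre
  have hdu2 := h.hasOrder_cutTime_sub hΛ hre
  -- coefficients and their increments
  have hcoef : ∀ k i j, HasOrder (Set.Icc A' B') 1 fun p =>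
      iteratedDeriv j (fun u => coeff1 k (φ p.1 k u) i) p.2 := fun k i j =>
    isOrder_univ_iff.1 (horders.dipole_order k i j) A' B'
  have hvmem : ∀ᶠ ε in 𝓝[>] (0 : ℝ), ∀ x ∈ cutSet A B, x.1 / √2 ∈ Set.Icc A' B' := by
    filter_upwards [hmem] with ε he x hx using (he x hx).2
  have humem : ∀ᶠ ε in 𝓝[>] (0 : ℝ), ∀ x ∈ cutSet A B, cutTime ξ Λ (ε, x) ∈ Set.Icc A' B' := by
    filter_upwards [hmem] with ε he x hx using (he x hx).1
  have hb := fun k i => smooth_family_bounds (fun ε hε => horders.dipole_smooth ε hε k i)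
    (horders.dipole_order k i) A' B'
  -- `φ_0`
  have f1 : ∀ i, HasOrder (cutSet A B) 3 fun p =>
      coeff1 0 (φ p.1 0 (cutTime ξ Λ p)) i - coeff1 0 (φ p.1 0 (p.2.1 / √2)) i
        - ((cutTime ξ Λ p : ℂ) - (p.2.1 / √2 : ℝ)) *
          deriv (fun u => coeff1 0 (φ p.1 0 u) i) (p.2.1 / √2) := by
    intro i
    obtain ⟨M, hM⟩ := hb 0 i
    refine (hasOrder_param.mul (hdu.mul hdu)).of_le M ?_
    filter_upwards [hM, humem, hvmem, eventually_fst_mem] with ε e1 e2 e3 hε x hx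
    have := (e1 _ (e2 x hx) _ (e3 x hx)).2.2
    rw [Complex.real_smul, pow_one, Complex.ofReal_sub] at this
    refine this.trans_eq ?_
    rw [norm_mul, norm_mul, Complex.norm_real, Real.norm_of_nonneg hε.1.le, ← Complex.ofReal_sub,
      Complex.norm_real]
    ring
  have f2 : ∀ i, HasOrder (cutSet A B) 1 fun p =>
      deriv (fun u => coeff1 0 (φ p.1 0 u) i) (p.2.1 / √2) := fun i => by
    have := (hcoef 0 i 1).comp (T := cutSet A B) (fun _ x => x.1 / √2) hvmem
    simpa only [iteratedDeriv_one] using this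
  have f3 : HasOrder (cutSet A B) 3 fun p =>
      higherPart 0 (φ p.1 0 (cutTime ξ Λ p)) p.2.2
        - higherPart 0 (φ p.1 0 (p.2.1 / √2)) p.2.2 := by
    obtain ⟨M, hM⟩ := horders.higher_order 0 1 A' B'
    refine ((hasOrder_param.mul hasOrder_param).mul hdu).of_le M ?_
    filter_upwards [hM, humem, hvmem, eventually_fst_mem] with ε e1 e2 e3 hε x hx
    have hd : ∀ u ∈ Set.Icc A' B', HasDerivWithinAt (fun v => higherPart 0 (φ ε 0 v) x.2)
        (iteratedDeriv 1 (fun v => higherPart 0 (φ ε 0 v) x.2) u) (Set.Icc A' B') u := fun u _ => by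
      have := hasDerivAt_iteratedDeriv (horders.higher_smooth ε hε.1 0 x.2) 0 u
      rw [iteratedDeriv_zero] at this
      exact this.hasDerivWithinAt
    have := (convex_Icc A' B' : Convex ℝ _).norm_image_sub_le_of_norm_hasDerivWithin_le hd
      (fun u hu => e1 u hu x.2) (e3 x hx) (e2 x hx)
    refine this.trans_eq ?_
    rw [norm_mul, norm_mul, Complex.norm_real, Real.norm_of_nonneg hε.1.le, ← Complex.ofReal_sub,
      Complex.norm_real]
    ring
  -- `φ_1`
  have f4 : ∀ i, HasOrder (cutSet A B) 2 fun p =>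
      coeff1 1 (φ p.1 1 (cutTime ξ Λ p)) i - coeff1 1 (φ p.1 1 (p.2.1 / √2)) i := by
    intro i
    obtain ⟨M, hM⟩ := hb 1 i
    refine (hasOrder_param.mul hdu).of_le M ?_
    filter_upwards [hM, humem, hvmem, eventually_fst_mem] with ε e1 e2 e3 hε x hx
    have := (e1 _ (e2 x hx) _ (e3 x hx)).1
    rw [pow_one] at this
    refine this.trans_eq ?_
    rw [norm_mul, Complex.norm_real, Real.norm_of_nonneg hε.1.le, ← Complex.ofReal_sub,
      Complex.norm_real]
    ring
  have f5 : ∀ i, HasOrder (cutSet A B) 1 fun p => coeff1 1 (φ p.1 1 (p.2.1 / √2)) i := fun i => by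
    have := (hcoef 1 i 0).comp (T := cutSet A B) (fun _ x => x.1 / √2) hvmem
    simpa only [iteratedDeriv_zero] using this
  have hhigh : ∀ k, HasOrder (cutSet A B) 2 fun p =>
      higherPart k (φ p.1 k (cutTime ξ Λ p)) p.2.2 := by
    intro k
    obtain ⟨M, hM⟩ := horders.higher_order k 0 A' B'
    rw [hasOrder_iff]
    refine ⟨M, ?_⟩
    filter_upwards [hM, humem] with ε e1 e2 x hx
    have := e1 _ (e2 x hx) x.2
    simpa only [iteratedDeriv_zero] using this
  -- `φ_2`
  have f7 : HasOrder (cutSet A B) 1 fun p =>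
      ∑ i, coeff1 2 (φ p.1 2 (cutTime ξ Λ p)) i * Y1 2 i p.2.2
        + higherPart 2 (φ p.1 2 (cutTime ξ Λ p)) p.2.2 := by
    refine (HasOrder.sum fun i _ => ?_).add ((hhigh 2).mono (by norm_num))
    have := (hcoef 2 i 0).comp (T := cutSet A B) (fun ε x => cutTime ξ Λ (ε, x)) humem
    simp only [iteratedDeriv_zero] at this
    exact this.mul (hasOrder_Y1 _ 2 i)
  -- the world line
  have x1 : ∀ i, HasOrder (cutSet A B) 1 fun p =>
      deriv (fun τ => ξ p.1 τ (Fin.succ i)) p.2.1 := fun i =>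
    (h.hasOrder_space_deriv i).comp (T := cutSet A B) (fun _ x => x.1)
      (Eventually.of_forall fun _ x hx => hx.1)
  have hY := hasOrder_Y1 (cutSet A B)
  have hL : HasOrder (cutSet A B) 1 fun p =>
      ∑ i : Fin 3, ξ p.1 (p.2.1 + Complex.I * Λ p.1 p.2.1 p.2.2) i.succ * Y1 0 i p.2.2 :=
    HasOrder.sum fun i _ => (h.hasOrder_space_cut hΛ i).mul (hY 0 i)
  -- The total error splits into eight sums and `f3`. For φ_0^0: `t1` is the Taylor remainder in
  -- time, `t2` the error in the cut time, `f3` the shift of the l ≥ 2 part. For the charge term: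
  -- `t3` is the Taylor remainder of ξ, `t4` the error in Λ. For the dipole part of φ_1^0: `t5` and
  -- `t6` freeze the time and the world line. The terms `t7` and `t8` are dropped altogether.
  have t1 := HasOrder.sum (s := Finset.univ) fun i _ => (f1 i).mul (hY 0 i)
  have t2 := HasOrder.sum (s := Finset.univ) fun i _ => ((f2 i).mul hdu2).mul (hY 0 i)
  have t3 := (HasOrder.sum (s := Finset.univ) fun i _ =>
    (h.hasOrder_space_cut_taylor hΛ i).mul (hY 0 i)).const_mul (2 * q)
  have t4 := (HasOrder.sum (s := Finset.univ) fun i _ =>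
    ((h.hasOrder_slicing_sub hΛ).mul (x1 i)).mul (hY 0 i)).const_mul (2 * q * Complex.I)
  have t5 := (hL.mul (HasOrder.sum (s := Finset.univ) fun j _ =>
    (f4 j).mul (hY 1 j))).const_mul 2
  have t6 := ((HasOrder.sum (s := Finset.univ) fun i _ =>
    (h.hasOrder_space_cut_sub hΛ i).mul (hY 0 i)).mul (HasOrder.sum (s := Finset.univ) fun j _ =>
      (f5 j).mul (hY 1 j))).const_mul 2
  have t7 := (hL.mul (hhigh 1)).const_mul 2
  have t8 := (hL.mul hL).mul f7
  refine ((((((((t1.add t2).add f3).sub t3).sub t4).sub t5).sub t6).sub t7).add t8).congr ?_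
  filter_upwards [eventually_fst_mem] with ε hε x hx
  obtain ⟨d0, d1, d2⟩ := leading_decomposition (hcharge ε hε.1) (cutTime ξ Λ (ε, x)) x.2
  have c0 := fun i => (hF ε hε.1).deriv_coeff1_eq hq x.1 i
  have c1 := fun i => (hF ε hε.1).coeff1_one_eq_deriv hq x.1 i
  have c2 := fun i => bondiCenter_spec hq (φ ε) x.1 i
  have hs := sqrt_two_mul_self
  have e : rotatedPhi0 (φ ε) (ξ ε) (Λ ε x.1) x.1 x.2 =
      φ ε 0 (cutTime ξ Λ (ε, x)) x.2
        - 2 * angleField (ξ ε) (x.1 + Complex.I * Λ ε x.1 x.2) x.2 * φ ε 1 (cutTime ξ Λ (ε, x)) x.2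
        + angleField (ξ ε) (x.1 + Complex.I * Λ ε x.1 x.2) x.2 ^ 2
          * φ ε 2 (cutTime ξ Λ (ε, x)) x.2 := rfl
  rw [e, d0, d1, d2, angleField_eq]
  simp only [rotatedExpansion, c0, c1, c2, Y1_one, Fin.sum_univ_three]
  push_cast
  -- The two products √2 · √2 come from the dipole of φ_1^0 against the normalisation of Y^0_{1i},
  -- and from the change between u_B and u_ret.
  linear_combination (-2 * q * (ξ ε x.1 1 * Y1 0 0 x.2 + ξ ε x.1 2 * Y1 0 1 x.2
      + ξ ε x.1 3 * Y1 0 2 x.2) * (bondiCenterDeriv q (φ ε) x.1 0 * sphereDir x.2 0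
      + bondiCenterDeriv q (φ ε) x.1 1 * sphereDir x.2 1
      + bondiCenterDeriv q (φ ε) x.1 2 * sphereDir x.2 2)
    - q * (bondiCenterDeriv q (φ ε) x.1 0 * Y1 0 0 x.2 + bondiCenterDeriv q (φ ε) x.1 1 * Y1 0 1 x.2
      + bondiCenterDeriv q (φ ε) x.1 2 * Y1 0 2 x.2) *
      (((ξ ε x.1 1).re : ℂ) * sphereDir x.2 0 + ((ξ ε x.1 2).re : ℂ)
        * sphereDir x.2 1 + ((ξ ε x.1 3).re : ℂ) * sphereDir x.2 2)) * hs

end Field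

/-! ### From the expansion of the field to the expansion of the dipole. -/

section Dipole

variable {q : ℝ} {F : ℝ → Minkowski → Fin 4 → Fin 4 → ℝ} {φ : ℝ → Fin 3 → ℝ → ℂ → ℂ}
  {ξ : ℝ → ℂ → Fin 4 → ℂ} {A B ρ C : ℝ} {Λ : ℝ → ℝ → ℂ → ℝ}

theorem WorldLineBounds.continuousOn (h : WorldLineBounds ξ A B ρ C) :
    ∀ᶠ ε in 𝓝[>] (0 : ℝ), ∀ s ∈ Set.Icc A B, ∀ a : Fin 4,
      ContinuousOn (fun z : ℂ => ξ ε (s + z) a) (Metric.closedBall 0 ρ) := by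
  have key : ∀ (f : ℂ → ℂ) (K : ℝ), 0 ≤ K →
      (∀ z w : ℂ, ‖z‖ ≤ ρ → ‖w‖ ≤ ρ → ‖f z - f w‖ ≤ K * ‖z - w‖) →
      ContinuousOn f (Metric.closedBall 0 ρ) := fun f K hK hf =>
    (LipschitzOnWith.of_dist_le_mul (K := K.toNNReal) fun x hx y hy => by
      rw [dist_eq_norm, dist_eq_norm, Real.coe_toNNReal K hK]
      exact hf x y (by simpa using hx) (by simpa using hy)).continuousOn
  filter_upwards [h.time, eventually_all.2 h.space, eventually_fst_mem] with ε h0 hi hε s hs a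
  have hCε : 0 ≤ C * ε := mul_nonneg h.const_pos.le hε.1.le
  refine Fin.cases ?_ (fun i => ?_) a
  · have := (key _ _ hCε (h0 s hs).2).add
      (show ContinuousOn (fun z : ℂ => (s : ℂ) + z) (Metric.closedBall 0 ρ) by fun_prop)
    exact this.congr fun z _ => by simp
  · exact key _ _ hCε (hi i s hs).2.2.1

/-- Splitting the coefficient of a difference requires integrability on both sides; this provides
the measurability of the rotated field on a cut. -/
theorem WorldLineBounds.continuous_rotatedPhi0 (h : WorldLineBounds ξ A B ρ C)
    (hF : ∀ ε > 0, IsAsymptoticallyVanishing (F ε) (φ ε)) (hΛ : IsRealSlicing ξ Λ) :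
    ∀ᶠ ε in 𝓝[>] (0 : ℝ), ∀ s ∈ Set.Icc A B,
      Continuous (rotatedPhi0 (φ ε) (ξ ε) (Λ ε s) s) := by
  filter_upwards [h.continuousOn, h.slicing_continuous hΛ, h.slicing_eq hΛ, eventually_fst_mem]
    with ε h1 h2 h3 hε s hs
  have hx : ∀ a, Continuous fun ζ => ξ ε (s + Complex.I * Λ ε s ζ) a := fun a => by
    refine (h1 s hs a).comp_continuous (f := fun ζ => Complex.I * (Λ ε s ζ : ℂ)) ?_ fun ζ => ?_
    · have := h2 s hs
      fun_prop
    · rw [mem_closedBall_zero_iff, norm_I_mul_ofReal]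
      exact (h3 s hs ζ).1
  have hd := continuous_sphereDir
  have hY := continuous_Y1
  have hG : Continuous fun ζ => goodCut (ξ ε) (s + Complex.I * Λ ε s ζ) ζ := by
    simp only [goodCut_eq]
    exact continuous_const.mul ((hx 0).sub (continuous_finsetSum _ fun i _ =>
      (hx i.succ).mul (Complex.continuous_ofReal.comp (hd i))))
  have hL : Continuous fun ζ => angleField (ξ ε) (s + Complex.I * Λ ε s ζ) ζ := by
    simp only [angleField_eq]
    exact continuous_finsetSum _ fun i _ => (hx i.succ).mul (hY 0 i)
  have hp : ∀ k, Continuous fun ζ => φ ε k (goodCut (ξ ε) (s + Complex.I * Λ ε s ζ) ζ).re ζ :=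
    fun k => ((hF ε hε.1).continuous_leading k).comp
      ((Complex.continuous_re.comp hG).prodMk continuous_id)
  exact ((hp 0).sub ((continuous_const.mul hL).mul (hp 1))).add ((hL.pow 2).mul (hp 2))

theorem WorldLineBounds.rotatedDipole_sub_order (h : WorldLineBounds ξ A B ρ C) (hq : q ≠ 0)
    (hF : ∀ ε > 0, IsAsymptoticallyVanishing (F ε) (φ ε))
    (hcharge : ∀ ε > 0, ∀ u : ℝ, monopole (φ ε 1 u) = q)
    (horders : MultipoleOrders φ) (hΛ : IsRealSlicing ξ Λ)
    (hre : HasOrder (Set.Icc A B) 2 fun p => (((ξ p.1 p.2 0).re - p.2 : ℝ) : ℂ)) (k : Fin 3) :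
    HasOrder (Set.Icc A B) 3 fun p => rotatedDipole (φ p.1) (ξ p.1) (Λ p.1 p.2) p.2 k
      - q * (bondiCenter q (φ p.1) p.2 k - ξ p.1 p.2 k.succ
        + dipoleQuadratic q (φ p.1) (ξ p.1) p.2 k) := by
  obtain ⟨M, hM⟩ := hasOrder_iff.1 (rotatedPhi0_sub_order hq hF hcharge horders h hΛ hre)
  rw [hasOrder_iff]
  -- The coefficient bound contributes 6, and the dipole is half of the coefficient.
  refine ⟨3 * M, ?_⟩
  filter_upwards [hM, h.continuous_rotatedPhi0 hF hΛ, eventually_fst_mem] with ε h1 h2 hε s hs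
  have hb := isBddCont_rotatedExpansion (q := q) (hF ε hε.1) (ξ ε) s
  have hd : ∀ ζ, ‖rotatedPhi0 (φ ε) (ξ ε) (Λ ε s) s ζ - rotatedExpansion q (φ ε) (ξ ε) s ζ‖
      ≤ M * ε ^ 3 := fun ζ => h1 (s, ζ) ⟨hs, Set.mem_univ _⟩
  obtain ⟨K, hK⟩ := hb.bounded
  have hr : IsBddCont (rotatedPhi0 (φ ε) (ξ ε) (Λ ε s) s) := by
    refine ⟨h2 s hs, M * ε ^ 3 + K, fun ζ => ?_⟩
    rw [← sub_add_cancel (rotatedPhi0 (φ ε) (ξ ε) (Λ ε s) s ζ) (rotatedExpansion q (φ ε) (ξ ε) s ζ)]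
    exact (norm_add_le _ _).trans (add_le_add (hd ζ) (hK ζ))
  have e := norm_coeff1_zero_le k hd
  rw [coeff1_zero_sub k hr hb, coeff1_rotatedExpansion (hF ε hε.1)] at e
  have : rotatedDipole (φ ε) (ξ ε) (Λ ε s) s k - q * (bondiCenter q (φ ε) s k - ξ ε s k.succ
        + dipoleQuadratic q (φ ε) (ξ ε) s k) = (coeff1 0 (rotatedPhi0 (φ ε) (ξ ε) (Λ ε s) s) k
      - 2 * q * (bondiCenter q (φ ε) s k - ξ ε s k.succ
        + dipoleQuadratic q (φ ε) (ξ ε) s k)) / 2 := by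
    rw [rotatedDipole]; ring
  rw [this, norm_div, RCLike.norm_ofNat]
  linarith

end Dipole

/-! ### Slowly varying families of functions of time -/

section SlowlyVarying

/-- The family is of order `k`, and changes by a quantity of order `k + 1` over a time `ε`. -/
structure SlowlyVarying (A B : ℝ) (k : ℕ) (f : ℝ × ℝ → ℂ) : Prop where
  order : HasOrder (Set.Icc A (B + 1)) k f
  shift : HasOrder (Set.Icc A B) (k + 1) fun p => f (p.1, p.2 + p.1) - f p

variable {A B : ℝ} {k m : ℕ} {f g : ℝ × ℝ → ℂ}

theorem eventually_shift_mem (A B : ℝ) : ∀ᶠ ε in 𝓝[>] (0 : ℝ), ∀ s ∈ Set.Icc A B,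
    s + ε ∈ Set.Icc A (B + 1) := by
  filter_upwards [eventually_fst_mem] with ε hε s hs
  exact ⟨by linarith [hs.1], by linarith [hs.2]⟩

theorem Icc_subset_Icc_add_one (A B : ℝ) : Set.Icc A B ⊆ Set.Icc A (B + 1) :=
  Set.Icc_subset_Icc_right (by linarith)

theorem HasOrder.shift (hf : HasOrder (Set.Icc A (B + 1)) k f) :
    HasOrder (Set.Icc A B) k fun p => f (p.1, p.2 + p.1) :=
  hf.comp (T := Set.Icc A B) (fun ε s => s + ε) (eventually_shift_mem A B)

namespace SlowlyVarying

theorem add (hf : SlowlyVarying A B k f) (hg : SlowlyVarying A B k g) :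
    SlowlyVarying A B k fun p => f p + g p :=
  ⟨hf.order.add hg.order, (hf.shift.add hg.shift).congr (Eventually.of_forall fun _ _ _ => by ring)⟩

theorem sub (hf : SlowlyVarying A B k f) (hg : SlowlyVarying A B k g) :
    SlowlyVarying A B k fun p => f p - g p :=
  ⟨hf.order.sub hg.order, (hf.shift.sub hg.shift).congr (Eventually.of_forall fun _ _ _ => by ring)⟩

theorem neg (hf : SlowlyVarying A B k f) : SlowlyVarying A B k fun p => -f p :=
  ⟨hf.order.neg, hf.shift.neg.congr (Eventually.of_forall fun _ _ _ => by ring)⟩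

theorem mul (hf : SlowlyVarying A B k f) (hg : SlowlyVarying A B m g) :
    SlowlyVarying A B (k + m) fun p => f p * g p := by
  refine ⟨hf.order.mul hg.order, ?_⟩
  have h1 : HasOrder (Set.Icc A B) (k + m + 1) fun p =>
      (f (p.1, p.2 + p.1) - f p) * g (p.1, p.2 + p.1) :=
    (hf.shift.mul hg.order.shift).mono (by omega)
  have h2 : HasOrder (Set.Icc A B) (k + m + 1) fun p => f p * (g (p.1, p.2 + p.1) - g p) :=
    ((hf.order.mono_set (Icc_subset_Icc_add_one A B)).mul hg.shift).mono (by omega)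
  exact (h1.add h2).congr (Eventually.of_forall fun _ _ _ => by ring)

theorem const_mul (c : ℂ) (hf : SlowlyVarying A B k f) : SlowlyVarying A B k fun p => c * f p :=
  ⟨hf.order.const_mul c, (hf.shift.const_mul c).congr (Eventually.of_forall fun _ _ _ => by ring)⟩

theorem sum {ι : Type*} {s : Finset ι} {f : ι → ℝ × ℝ → ℂ}
    (h : ∀ i ∈ s, SlowlyVarying A B k (f i)) : SlowlyVarying A B k fun p => ∑ i ∈ s, f i p :=
  ⟨HasOrder.sum fun i hi => (h i hi).order, (HasOrder.sum fun i hi => (h i hi).shift).congr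
    (Eventually.of_forall fun _ _ _ => by rw [Finset.sum_sub_distrib])⟩

theorem re (hf : SlowlyVarying A B k f) : SlowlyVarying A B k fun p => ((f p).re : ℂ) :=
  ⟨hf.order.re, hf.shift.re.congr (Eventually.of_forall fun _ _ _ => by simp)⟩

theorem im (hf : SlowlyVarying A B k f) : SlowlyVarying A B k fun p => ((f p).im : ℂ) :=
  ⟨hf.order.im, hf.shift.im.congr (Eventually.of_forall fun _ _ _ => by simp)⟩

theorem of_lipschitz (hf : HasOrder (Set.Icc A (B + 1)) 1 f) (M : ℝ)
    (h : ∀ᶠ ε in 𝓝[>] (0 : ℝ), ∀ s ∈ Set.Icc A B, ‖f (ε, s + ε) - f (ε, s)‖ ≤ M * ε * ε) :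
    SlowlyVarying A B 1 f := by
  refine ⟨hf, hasOrder_iff.2 ⟨M, ?_⟩⟩
  filter_upwards [h] with ε he s hs
  exact (he s hs).trans_eq (by ring)

end SlowlyVarying

theorem HasOrder.of_param_mul {α : Type*} {S : Set α} {k : ℕ} {f : ℝ × α → ℂ}
    (h : HasOrder S (k + 1) fun p => p.1 * f p) : HasOrder S k f := by
  rw [hasOrder_iff] at h ⊢
  obtain ⟨M, hM⟩ := h
  refine ⟨M, ?_⟩
  filter_upwards [hM, eventually_fst_mem] with ε h1 hε x hx
  have := h1 x hx
  rw [norm_mul, Complex.norm_real, Real.norm_of_nonneg hε.1.le, pow_succ] at this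
  exact le_of_mul_le_mul_left (this.trans_eq (by ring)) hε.1

/-- The rate of change of a quantity that is slowly varying up to terms of order `k + 1`. -/
theorem order_rate_of_slowlyVarying {D D' M : ℝ × ℝ → ℂ} {k : ℕ}
    (hD : HasOrder (Set.Icc A (B + 1)) (k + 1) fun p => D p - M p)
    (hM : SlowlyVarying A B k M)
    (hT : HasOrder (Set.Icc A B) (k + 1) fun p => D (p.1, p.2 + p.1) - D p - p.1 * D' p) :
    HasOrder (Set.Icc A B) k D' := by
  -- Up to the Taylor remainder, ε D' is the increment of D, hence that of D - M plus that of M.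
  -- Both are of order k + 1, and one power of ε is divided out.
  refine HasOrder.of_param_mul ?_
  refine (((hD.shift.sub (hD.mono_set (Icc_subset_Icc_add_one A B))).add hM.shift).sub hT).congr
    (Eventually.of_forall fun _ _ _ => by ring)

end SlowlyVarying

/-! ### The dipole equations of second and third order -/

theorem crossProduct_apply_eq_sum (a b : Fin 3 → ℂ) (k : Fin 3) :
    crossProduct a b k = ∑ i : Fin 3, ∑ j : Fin 3, (leviCivita i j k : ℂ) * (a i * b j) := by
  fin_cases k <;>
    simp [crossProduct, Fin.sum_univ_three, leviCivita_values, leviCivita_self_left,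
      leviCivita_self_right, leviCivita_self_outer] <;> ring

section Center

variable {q : ℝ} {φ : ℝ → Fin 3 → ℝ → ℂ → ℂ}

theorem MultipoleOrders.contDiff_bondiCenter (h : MultipoleOrders φ) {ε : ℝ} (hε : 0 < ε)
    (i : Fin 3) : ContDiff ℝ ∞ fun s => bondiCenter q (φ ε) s i :=
  ((h.dipole_smooth ε hε 0 i).comp (contDiff_id.div_const √2)).div_const _

theorem MultipoleOrders.bondiCenter_order (h : MultipoleOrders φ) (i : Fin 3) (j : ℕ) :
    IsOrder 1 Set.univ fun ε => iteratedDeriv j fun s => bondiCenter q (φ ε) s i := by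
  rw [isOrder_univ_iff]
  intro A B
  have h1 := (isOrder_univ_iff.1 (h.dipole_order 0 i j) (A / √2) (B / √2)).comp
    (T := Set.Icc A B) (fun _ s => s / √2) (Eventually.of_forall fun _ s hs =>
      ⟨div_le_div_of_nonneg_right hs.1 (Real.sqrt_nonneg 2),
        div_le_div_of_nonneg_right hs.2 (Real.sqrt_nonneg 2)⟩)
  refine (h1.const_mul ((2 * q : ℂ)⁻¹ * ((√2)⁻¹ ^ j : ℝ))).congr ?_
  filter_upwards [eventually_fst_mem] with ε hε s _
  have e : (fun s => bondiCenter q (φ ε) s i) = fun s =>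
      (2 * q : ℂ)⁻¹ * (fun s => (fun u => coeff1 0 (φ ε 0 u) i) ((√2)⁻¹ * s)) s := by
    ext s
    rw [bondiCenter, div_eq_inv_mul, div_eq_inv_mul]
  have hs : ContDiff ℝ j fun u => coeff1 0 (φ ε 0 u) i :=
    (h.dipole_smooth ε hε.1 0 i).of_le (by exact_mod_cast le_top)
  simp only [e]
  rw [iteratedDeriv_const_mul_field, iteratedDeriv_comp_const_smul hs, mul_assoc, div_eq_inv_mul,
    ← Complex.real_smul]

-- The time step is ε itself and all derivatives of η are of first order, so increments are O(ε²)
-- and the first-order Taylor remainder is O(ε · ε²).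
variable (q) in
theorem MultipoleOrders.center_estimates (h : MultipoleOrders φ) (A B : ℝ) (i : Fin 3) :
    SlowlyVarying A B 1 (fun p => bondiCenter q (φ p.1) p.2 i) ∧
    SlowlyVarying A B 1 (fun p => bondiCenterDeriv q (φ p.1) p.2 i) ∧
    HasOrder (Set.Icc A B) 3 fun p => bondiCenter q (φ p.1) (p.2 + p.1) i
      - bondiCenter q (φ p.1) p.2 i - p.1 * bondiCenterDeriv q (φ p.1) p.2 i := by
  obtain ⟨M, hM⟩ := smooth_family_bounds
    (f := fun ε s => bondiCenter q (φ ε) s i) (fun ε hε => h.contDiff_bondiCenter hε i)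
    (h.bondiCenter_order i) A (B + 1)
  have hM' : ∀ᶠ ε in 𝓝[>] (0 : ℝ), ∀ s ∈ Set.Icc A B,
      ‖bondiCenter q (φ ε) (s + ε) i - bondiCenter q (φ ε) s i‖ ≤ M * ε * ε ∧
      ‖bondiCenterDeriv q (φ ε) (s + ε) i - bondiCenterDeriv q (φ ε) s i‖ ≤ M * ε * ε ∧
      ‖bondiCenter q (φ ε) (s + ε) i - bondiCenter q (φ ε) s i
        - ε * bondiCenterDeriv q (φ ε) s i‖ ≤ M * ε ^ 3 := by
    filter_upwards [hM, eventually_shift_mem A B, eventually_fst_mem] with ε h1 h2 hε s hs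
    obtain ⟨a1, a2, a3⟩ := h1 _ (h2 s hs) s (Icc_subset_Icc_add_one A B hs)
    rw [pow_one, add_sub_cancel_left, Real.norm_of_nonneg hε.1.le] at a1 a2 a3
    exact ⟨a1, a2, a3.trans_eq (by ring)⟩
  have h0 := isOrder_univ_iff.1 (h.bondiCenter_order (q := q) i 0) A (B + 1)
  have h1 := isOrder_univ_iff.1 (h.bondiCenter_order (q := q) i 1) A (B + 1)
  simp only [iteratedDeriv_zero, iteratedDeriv_one] at h0 h1
  exact ⟨.of_lipschitz h0 M (hM'.mono fun ε he s hs => (he s hs).1),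
    .of_lipschitz h1 M (hM'.mono fun ε he s hs => (he s hs).2.1),
    hasOrder_iff.2 ⟨M, hM'.mono fun ε he s hs => (he s hs).2.2⟩⟩

variable {ξ : ℝ → ℂ → Fin 4 → ℂ} {A B ρ C : ℝ}

theorem WorldLineBounds.space_estimates (h : WorldLineBounds ξ A (B + 1) ρ C) (i : Fin 3) :
    SlowlyVarying A B 1 (fun p => ξ p.1 p.2 i.succ) ∧
    SlowlyVarying A B 1 (fun p => deriv (fun τ => ξ p.1 τ i.succ) p.2) ∧
    HasOrder (Set.Icc A B) 3 fun p => ξ p.1 (p.2 + p.1 : ℝ) i.succ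
      - ξ p.1 p.2 i.succ - p.1 * deriv (fun τ => ξ p.1 τ i.succ) p.2 := by
  have key : ∀ᶠ ε in 𝓝[>] (0 : ℝ), ∀ s ∈ Set.Icc A B,
      ‖ξ ε (s + ε : ℝ) i.succ - ξ ε s i.succ‖ ≤ C * ε * ε ∧
      ‖deriv (fun τ => ξ ε τ i.succ) (s + ε : ℝ) - deriv (fun τ => ξ ε τ i.succ) s‖ ≤ C * ε * ε ∧
      ‖ξ ε (s + ε : ℝ) i.succ - ξ ε s i.succ - ε * deriv (fun τ => ξ ε τ i.succ) s‖
        ≤ C * ε ^ 3 := by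
    filter_upwards [h.space i, eventually_mul_le (C := 1) h.radius_pos, eventually_fst_mem]
      with ε h1 h2 hε s hs
    obtain ⟨-, -, a1, a2, a3⟩ := h1 s (Icc_subset_Icc_add_one A B hs)
    have hn : ‖(ε : ℂ)‖ = ε := by rw [Complex.norm_real, Real.norm_of_nonneg hε.1.le]
    have hn' : ‖(ε : ℂ)‖ ≤ ρ := by rw [hn]; linarith
    have b1 := a1 ε 0 hn' (by simpa using h.radius_pos.le)
    have b2 := a2 ε hn'
    have b3 := a3 ε hn'
    rw [add_zero, sub_zero, hn] at b1
    rw [hn] at b2 b3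
    rw [Complex.ofReal_add]
    exact ⟨b1, b3, b2.trans_eq (by ring)⟩
  exact ⟨.of_lipschitz (h.hasOrder_space i) C (key.mono fun ε he s hs => (he s hs).1),
    .of_lipschitz (h.hasOrder_space_deriv i) C (key.mono fun ε he s hs => (he s hs).2.1),
    hasOrder_iff.2 ⟨C, key.mono fun ε he s hs => (he s hs).2.2⟩⟩

theorem WorldLineBounds.time_im_slowlyVarying (h : WorldLineBounds ξ A (B + 1) ρ C) :
    SlowlyVarying A B 1 fun p => ((ξ p.1 p.2 0).im : ℂ) := by
  have key : SlowlyVarying A B 1 fun p => ξ p.1 p.2 0 - p.2 := by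
    refine .of_lipschitz (hasOrder_iff.2 ⟨C, ?_⟩) C ?_
    · filter_upwards [h.time] with ε he s hs
      simpa using (he s hs).1 0 (by simpa using h.radius_pos.le)
    · filter_upwards [h.time, eventually_mul_le (C := 1) h.radius_pos, eventually_fst_mem]
        with ε h1 h2 hε s hs
      have hn : ‖(ε : ℂ)‖ = ε := by rw [Complex.norm_real, Real.norm_of_nonneg hε.1.le]
      have := (h1 s (Icc_subset_Icc_add_one A B hs)).2 ε 0 (by rw [hn]; linarith)
        (by simpa using h.radius_pos.le)
      simpa only [add_zero, sub_zero, hn, Complex.ofReal_add] using this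
  simpa using key.im

/-- The second-order correction to the Bondi center in the equation of third order. -/
noncomputable def centerCorrection (q : ℝ) (φ : Fin 3 → ℝ → ℂ → ℂ) (z : ℂ → Fin 4 → ℂ) (s : ℝ)
    (k : Fin 3) : ℂ :=
  Complex.I * (((z s 0).im : ℂ) * bondiCenterDeriv q φ s k)
    - Complex.I / 2 * ∑ i : Fin 3, ∑ j : Fin 3, (leviCivita i j k : ℂ) *
      (bondiCenter q φ s i * bondiCenterDeriv q φ s j)

theorem secondOrderCenter_eq (φ : Fin 3 → ℝ → ℂ → ℂ) (z : ℂ → Fin 4 → ℂ) (s : ℝ) (k : Fin 3) :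
    secondOrderCenter q φ z s k = bondiCenter q φ s k + centerCorrection q φ z s k := by
  rw [secondOrderCenter, crossProduct_apply_eq_sum, centerCorrection]; ring

/-- Antisymmetry of ε_{ijk} lets the mixed products of ξ and η' be regrouped so that every term
contains a factor ξ - η or ξ' - η'. Smallness of these factors is then all that is needed. -/
theorem dipoleQuadratic_sub_centerCorrection (φ : Fin 3 → ℝ → ℂ → ℂ) (z : ℂ → Fin 4 → ℂ) (s : ℝ)
    (k : Fin 3) : dipoleQuadratic q φ z s k - centerCorrection q φ z s k
      = Complex.I * (((z s 0).im : ℂ) *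
          (deriv (fun τ => z τ k.succ) s - bondiCenterDeriv q φ s k))
        + ∑ i : Fin 3, ∑ j : Fin 3, (leviCivita i j k : ℂ) *
          (1 / 2 * ((deriv (fun τ => z τ i.succ) s - bondiCenterDeriv q φ s i) * (z s j.succ).im)
            - Complex.I / 2 * ((z s i.succ - bondiCenter q φ s i) * bondiCenterDeriv q φ s j)) := by
  have key : ∀ (t : ℂ) (x y e e' d : Fin 3 → ℂ),
      Complex.I * t * d k + Complex.I / 2 * ∑ i : Fin 3, ∑ j : Fin 3, (leviCivita i j k : ℂ) *
        (-(e' i * x j) - Complex.I * (d i * y j) - 2 * ((x i + y i * Complex.I) * e' j))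
      - (Complex.I * (t * e' k) - Complex.I / 2 * ∑ i : Fin 3, ∑ j : Fin 3,
        (leviCivita i j k : ℂ) * (e i * e' j))
      = Complex.I * (t * (d k - e' k)) + ∑ i : Fin 3, ∑ j : Fin 3, (leviCivita i j k : ℂ) *
          (1 / 2 * ((d i - e' i) * y j)
            - Complex.I / 2 * ((x i + y i * Complex.I - e i) * e' j)) := by
    intro t x y e e' d
    fin_cases k <;>
      (simp [Fin.sum_univ_three, leviCivita_values, leviCivita_self_left,
        leviCivita_self_right, leviCivita_self_outer, -mul_eq_mul_left_iff,
        -mul_eq_mul_right_iff]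
       ring_nf
       simp only [Complex.I_sq]
       ring)
  have := key (z s 0).im (fun i => (z s i.succ).re) (fun i => (z s i.succ).im)
    (bondiCenter q φ s) (bondiCenterDeriv q φ s) (fun i => deriv (fun τ => z τ i.succ) s)
  simp only [Complex.re_add_im] at this
  exact this

theorem WorldLineBounds.centerCorrection_slowlyVarying (h : WorldLineBounds ξ A (B + 1) ρ C)
    (horders : MultipoleOrders φ) (k : Fin 3) :
    SlowlyVarying A B 2 fun p => centerCorrection q (φ p.1) (ξ p.1) p.2 k := by
  have hη := fun i => (horders.center_estimates q A B i).1
  have hη' := fun i => (horders.center_estimates q A B i).2.1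
  exact ((h.time_im_slowlyVarying.mul (hη' k)).const_mul _).sub
    ((SlowlyVarying.sum fun i _ => SlowlyVarying.sum fun j _ =>
      ((hη i).mul (hη' j)).const_mul _).const_mul _)

theorem WorldLineBounds.dipoleQuadratic_slowlyVarying (h : WorldLineBounds ξ A (B + 1) ρ C)
    (horders : MultipoleOrders φ) (k : Fin 3) :
    SlowlyVarying A B 2 fun p => dipoleQuadratic q (φ p.1) (ξ p.1) p.2 k := by
  have hη' := fun i => (horders.center_estimates q A B i).2.1
  have hx := fun i => (h.space_estimates i).1
  have hx' := fun i => (h.space_estimates i).2.1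
  have h1 := (h.time_im_slowlyVarying.mul (hx' k)).const_mul Complex.I
  have h2 := (SlowlyVarying.sum (s := Finset.univ) fun i _ =>
    SlowlyVarying.sum (s := Finset.univ) fun j _ =>
      ((((hη' i).mul (hx j).re).neg.sub (((hx' i).mul (hx j).im).const_mul Complex.I)).sub
        (((hx i).mul (hη' j)).const_mul 2)).const_mul (leviCivita i j k : ℂ)).const_mul
          (Complex.I / 2)
  have := h1.add h2
  simpa only [dipoleQuadratic, mul_assoc] using this

/-- If the world line differs from the Bondi center by a slowly varying quantity of second order, up
to third order, then the two second-order corrections agree. -/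
theorem WorldLineBounds.correction_sub_order (h : WorldLineBounds ξ A (B + 1) ρ C)
    (horders : MultipoleOrders φ) {M : Fin 3 → ℝ × ℝ → ℂ} (hM : ∀ i, SlowlyVarying A B 2 (M i))
    (hD : ∀ i : Fin 3, HasOrder (Set.Icc A (B + 1)) 3 fun p =>
      (ξ p.1 p.2 i.succ - bondiCenter q (φ p.1) p.2 i) - M i p) (k : Fin 3) :
    HasOrder (Set.Icc A B) 3 fun p => dipoleQuadratic q (φ p.1) (ξ p.1) p.2 k
      - centerCorrection q (φ p.1) (ξ p.1) p.2 k := by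
  have hsub := Icc_subset_Icc_add_one A B
  have hd : ∀ i, HasOrder (Set.Icc A B) 2 fun p =>
      ξ p.1 p.2 (Fin.succ i) - bondiCenter q (φ p.1) p.2 i := fun i =>
    (((hD i).mono (by norm_num)).add (hM i).order |>.mono_set hsub).congr
      (Eventually.of_forall fun _ _ _ => by ring)
  -- Interpolating between ξ - η = O(ε²) and its O(ε) second derivative would give only O(ε^(3/2));
  -- the slow variation of M is what raises this to second order.
  have hd' : ∀ i, HasOrder (Set.Icc A B) 2 fun p =>
      deriv (fun τ => ξ p.1 τ (Fin.succ i)) p.2 - bondiCenterDeriv q (φ p.1) p.2 i := fun i => by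
    refine order_rate_of_slowlyVarying (hD i) (hM i) ?_
    exact ((h.space_estimates i).2.2.sub (horders.center_estimates q A B i).2.2).congr
      (Eventually.of_forall fun _ _ _ => by ring)
  have hη' := fun i => (horders.center_estimates q A B i).2.1.order.mono_set hsub
  have hx := fun i => (h.space_estimates i).1.order.mono_set hsub
  simp only [dipoleQuadratic_sub_centerCorrection]
  exact ((h.time_im_slowlyVarying.order.mono_set hsub).mul (hd' k)).const_mul _ |>.add
    (HasOrder.sum fun i _ => HasOrder.sum fun j _ => ((((hd' i).mul (hx j).im).const_mul _).sub
      (((hd i).mul (hη' j)).const_mul _)).const_mul _)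

variable {F : ℝ → Minkowski → Fin 4 → Fin 4 → ℝ} {U : Set ℂ} {Λ : ℝ → ℝ → ℂ → ℝ}

theorem IsSlowWorldLine.rotatedDipole_sub_order (h : IsSlowWorldLine U ξ) (hq : q ≠ 0)
    (hF : ∀ ε > 0, IsAsymptoticallyVanishing (F ε) (φ ε))
    (hcharge : ∀ ε > 0, ∀ u : ℝ, monopole (φ ε 1 u) = q)
    (horders : MultipoleOrders φ) (hΛ : IsRealSlicing ξ Λ) (k : Fin 3) (A B : ℝ) :
    HasOrder (Set.Icc A B) 3 fun p => rotatedDipole (φ p.1) (ξ p.1) (Λ p.1 p.2) p.2 k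
      - q * (bondiCenter q (φ p.1) p.2 k - ξ p.1 p.2 k.succ
        + dipoleQuadratic q (φ p.1) (ξ p.1) p.2 k) := by
  obtain ⟨ρ, C, hb⟩ := h.exists_bounds A B
  exact hb.rotatedDipole_sub_order hq hF hcharge horders hΛ
    (isOrder_univ_iff.1 h.real_time_order A B) k

/-- The quadratic term is itself of second order, so D* and q(η - ξ) agree to that order, on each
time interval and for each component separately. -/
theorem IsSlowWorldLine.dipole_order_two_iff (h : IsSlowWorldLine U ξ) (hq : q ≠ 0)
    (hF : ∀ ε > 0, IsAsymptoticallyVanishing (F ε) (φ ε))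
    (hcharge : ∀ ε > 0, ∀ u : ℝ, monopole (φ ε 1 u) = q)
    (horders : MultipoleOrders φ) (hΛ : IsRealSlicing ξ Λ) (k : Fin 3) :
    IsOrder 2 Set.univ (fun ε (s : ℝ) => rotatedDipole (φ ε) (ξ ε) (Λ ε s) s k) ↔
      IsOrder 2 Set.univ (fun ε (s : ℝ) => q * ξ ε s k.succ - q * bondiCenter q (φ ε) s k) := by
  rw [isOrder_univ_iff, isOrder_univ_iff]
  refine forall₂_congr fun A B => ?_
  obtain ⟨ρ, C, hb⟩ := h.exists_bounds A (B + 1)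
  have h1 := (h.rotatedDipole_sub_order hq hF hcharge horders hΛ k A B).mono (m := 2) (by norm_num)
  have h2 := ((hb.dipoleQuadratic_slowlyVarying (q := q) horders k).order.mono_set
    (Icc_subset_Icc_add_one A B)).const_mul q
  exact ⟨fun hd => ((h1.add h2).sub hd).congr (Eventually.of_forall fun _ _ _ => by ring),
    fun hd => ((h1.add h2).sub hd).congr (Eventually.of_forall fun _ _ _ => by ring)⟩

/-- In either direction the hypothesis makes ξ - η equal, up to third order, to a slowly varying
second-order quantity: `dipoleQuadratic` in one case, `centerCorrection` in the other. The two then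
agree to third order. The cross product couples the components, so all three are treated together.
-/
theorem IsSlowWorldLine.dipole_order_three_iff (h : IsSlowWorldLine U ξ) (hq : q ≠ 0)
    (hF : ∀ ε > 0, IsAsymptoticallyVanishing (F ε) (φ ε))
    (hcharge : ∀ ε > 0, ∀ u : ℝ, monopole (φ ε 1 u) = q)
    (horders : MultipoleOrders φ) (hΛ : IsRealSlicing ξ Λ) :
    (∀ k, IsOrder 3 Set.univ (fun ε (s : ℝ) => rotatedDipole (φ ε) (ξ ε) (Λ ε s) s k)) ↔
      ∀ k : Fin 3, IsOrder 3 Set.univ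
        (fun ε (s : ℝ) => ξ ε s k.succ - secondOrderCenter q (φ ε) (ξ ε) s k) := by
  have hqC : (q : ℂ) ≠ 0 := by exact_mod_cast hq
  simp only [isOrder_univ_iff]
  constructor
  · intro hd k A B
    obtain ⟨ρ, C, hb⟩ := h.exists_bounds A (B + 1)
    have e : ∀ (i : Fin 3) (B : ℝ), HasOrder (Set.Icc A B) 3 fun p =>
        (ξ p.1 p.2 i.succ - bondiCenter q (φ p.1) p.2 i)
          - dipoleQuadratic q (φ p.1) (ξ p.1) p.2 i := fun i B =>
      (((h.rotatedDipole_sub_order hq hF hcharge horders hΛ i A B).sub (hd i A B)).const_mul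
        (q : ℂ)⁻¹).congr (Eventually.of_forall fun _ _ _ => by field_simp; ring)
    -- The hypothesis is used on the longer interval [A, B + 1], since the difference quotient looks
    -- ahead by ε ≤ 1.
    have := hb.correction_sub_order (q := q) horders
      (fun i => hb.dipoleQuadratic_slowlyVarying horders i) (fun i => e i (B + 1)) k
    exact ((e k B).add this).congr (Eventually.of_forall fun _ _ _ => by
      rw [secondOrderCenter_eq]; ring)
  · intro hd k A B
    obtain ⟨ρ, C, hb⟩ := h.exists_bounds A (B + 1)
    have := hb.correction_sub_order (q := q) horders
      (fun i => hb.centerCorrection_slowlyVarying horders i)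
      (fun i => (hd i A (B + 1)).congr (Eventually.of_forall fun _ _ _ => by
        rw [secondOrderCenter_eq]; ring)) k
    exact ((h.rotatedDipole_sub_order hq hF hcharge horders hΛ k A B).add
      ((this.sub (hd k A B)).const_mul q)).congr (Eventually.of_forall fun _ _ _ => by
        rw [secondOrderCenter_eq]; ring)

end Center

/-! ### The complex center of charge as a world line -/

theorem IsOrder.deriv {U : Set ℂ} (hU : IsOpen U) {k : ℕ} {f : ℝ → ℂ → ℂ}
    (hf : ∀ ε > 0, DifferentiableOn ℂ (f ε) U) (ho : IsOrder k U f) :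
    IsOrder k U fun ε => deriv (f ε) := by
  intro K hKU hK
  obtain ⟨δ, hδ, hsub⟩ := hK.exists_cthickening_subset_open hU hKU
  obtain ⟨C, hC⟩ := ho _ hsub hK.cthickening
  refine ⟨C / δ, ?_⟩
  filter_upwards [hC, eventually_fst_mem] with ε h1 hε x hx
  have hball : Metric.closedBall x δ ⊆ Metric.cthickening δ K :=
    Metric.closedBall_subset_cthickening hx δ
  have hd : DiffContOnCl ℂ (f ε) (Metric.ball x δ) := by
    refine (((hf ε hε.1).mono hsub).mono hball).diffContOnCl_ball subset_rfl
  refine (Complex.norm_deriv_le_of_forall_mem_sphere_norm_le hδ hd fun z hz =>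
    h1 z (hball (Metric.sphere_subset_closedBall hz))).trans_eq (by ring)

section CenterWorldLine

variable {U : Set ℂ}

/-- The part of `U` on which both `τ` and its conjugate are available. -/
def symmetricPart (U : Set ℂ) : Set ℂ := U ∩ star ⁻¹' U

theorem isOpen_symmetricPart (hU : IsOpen U) : IsOpen (symmetricPart U) :=
  hU.inter (hU.preimage continuous_star)

/-- Schwarz reflection. It provides the holomorphic continuation of the complex conjugate of the
time component, and with it that of Im ξ^0, off the real axis. -/
theorem differentiableOn_star_comp_star {f : ℂ → ℂ} (hU : IsOpen U) (hf : DifferentiableOn ℂ f U) :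
    DifferentiableOn ℂ (fun τ => star (f (star τ))) (star ⁻¹' U) := fun τ hτ => by
  have := (hf.differentiableAt (hU.mem_nhds hτ)).star_star
  rw [star_star] at this
  exact this.differentiableWithinAt

/-- The spatial components of the world line obtained from analytic extensions `η` of the Bondi center
and `t` of the time component. -/
noncomputable def centerSpace (t : ℂ → ℂ) (η : ℂ → Fin 3 → ℂ) (τ : ℂ) (k : Fin 3) : ℂ :=
  η τ k + (t τ - star (t (star τ))) / 2 * deriv (fun τ => η τ k) τ
    - Complex.I / 2 * crossProduct (η τ) (fun j => deriv (fun τ => η τ j) τ) k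

/-- The world line with time component `t` and spatial components `centerSpace t η`. -/
noncomputable def centerWorldLine (t : ℂ → ℂ) (η : ℂ → Fin 3 → ℂ) (τ : ℂ) : Fin 4 → ℂ :=
  Fin.cons (t τ) (centerSpace t η τ)

variable {ξ₀ : ℝ → ℂ → Fin 4 → ℂ} {η : ℝ → ℂ → Fin 3 → ℂ}

theorem isSlowWorldLine_centerWorldLine (h : IsSlowWorldLine U ξ₀)
    (hη : ∀ ε > 0, ∀ i, DifferentiableOn ℂ (fun τ => η ε τ i) U)
    (ho : ∀ i, IsOrder 1 U (fun ε τ => η ε τ i)) :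
    IsSlowWorldLine (symmetricPart U)
      fun ε => centerWorldLine (fun τ => ξ₀ ε τ 0) (η ε) := by
  have hVU : symmetricPart U ⊆ U := Set.inter_subset_left
  have hVU' : symmetricPart U ⊆ star ⁻¹' U := Set.inter_subset_right
  refine ⟨isOpen_symmetricPart h.isOpen, fun s => ⟨h.real_mem s, ?_⟩, fun ε hε a => ?_,
    fun k => ?_, ?_, h.real_time_order⟩
  · simpa using h.real_mem s
  · refine Fin.cases ?_ (fun k => ?_) a
    · exact (h.analytic ε hε 0).mono hVU
    · have e := fun i => (hη ε hε i).mono hVU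
      have e' := fun i => ((hη ε hε i).deriv h.isOpen).mono hVU
      have t := (h.analytic ε hε 0).mono hVU
      have t' := (differentiableOn_star_comp_star h.isOpen (h.analytic ε hε 0)).mono hVU'
      simp only [centerWorldLine, Fin.cons_succ, centerSpace, crossProduct_apply_eq_sum]
      exact ((e k).add (((t.sub t').div_const 2).mul (e' k))).sub
        ((DifferentiableOn.fun_sum fun i _ => DifferentiableOn.fun_sum fun j _ =>
          ((e i).mul (e' j)).const_mul _).const_mul _)
  · rw [isOrder_iff]
    intro K hKV hK
    have hKU := hKV.trans hVU
    have e := fun i => isOrder_iff.1 (ho i) K hKU hK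
    have e' := fun i => isOrder_iff.1
      (IsOrder.deriv h.isOpen (fun ε hε => hη ε hε i) (ho i)) K hKU hK
    have t := isOrder_iff.1 h.time_order K hKU hK
    have t' : HasOrder K 1 fun p => star (ξ₀ p.1 (star p.2) 0 - star p.2) := by
      have := (isOrder_iff.1 h.time_order (star '' K) (by
        rintro _ ⟨τ, hτ, rfl⟩; exact hVU' (hKV hτ)) (hK.image continuous_star)).comp (T := K)
        (fun _ τ => star τ) (Eventually.of_forall fun _ τ hτ => ⟨τ, hτ, rfl⟩)
      exact this.of_le 1 (Eventually.of_forall fun ε τ _ => by rw [norm_star, one_mul])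
    simp only [centerWorldLine, Fin.cons_succ, centerSpace, crossProduct_apply_eq_sum]
    have h1 := (((t.sub t').const_mul (1 / 2)).mul (e' k)).mono (m := 1) (by norm_num)
    have h2 := ((HasOrder.sum (s := Finset.univ) fun i _ => HasOrder.sum (s := Finset.univ)
      fun j _ => ((e i).mul (e' j)).const_mul (leviCivita i j k : ℂ)).const_mul
        (Complex.I / 2)).mono (m := 1) (by norm_num)
    exact (((e k).add h1).sub h2).congr (Eventually.of_forall fun ε τ _ => by
      simp only [star_sub, star_star]; ring)
  · intro K hK
    exact h.time_order K (hK.trans hVU)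

/-- On the real axis the complex derivative of the extension is the time derivative of the Bondi
center, and the reflected difference of t is 2i Im t. There is no circularity: `secondOrderCenter`
sees the world line only through its time component. -/
theorem centerSpace_ofReal {q : ℝ} {φ : Fin 3 → ℝ → ℂ → ℂ} {t : ℂ → ℂ} {η : ℂ → Fin 3 → ℂ}
    (hU : IsOpen U) (hr : ∀ s : ℝ, (s : ℂ) ∈ U) (hη : ∀ i, DifferentiableOn ℂ (fun τ => η τ i) U)
    (he : ∀ (s : ℝ) i, η s i = bondiCenter q φ s i) (s : ℝ) (k : Fin 3) :
    centerWorldLine t η s k.succ = secondOrderCenter q φ (centerWorldLine t η) s k := by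
  have hd : ∀ i, deriv (fun τ => η τ i) s = bondiCenterDeriv q φ s i := fun i => by
    have := (((hη i).differentiableAt (hU.mem_nhds (hr s))).hasDerivAt).comp_ofReal
    simp only [he] at this
    exact this.deriv.symm
  have ht : (t s - star (t s)) / 2 = Complex.I * ((t s).im : ℂ) := by
    have := Complex.sub_conj (t s)
    rw [Complex.star_def, this]; push_cast; ring
  have hss : star (s : ℂ) = s := Complex.conj_ofReal s
  simp only [centerWorldLine, Fin.cons_succ, Fin.cons_zero, centerSpace, secondOrderCenter, hd, hss,
    ht, he, show η s = bondiCenter q φ s from funext (he s)]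

end CenterWorldLine

end MaxwellCenter

open MaxwellCenter in
theorem mainTheorem10 (q : ℝ) (hq : q ≠ 0)
    (F : ℝ → Minkowski → Fin 4 → Fin 4 → ℝ) (φ : ℝ → Fin 3 → ℝ → ℂ → ℂ)
    (hF : ∀ ε > 0, IsAsymptoticallyVanishing (F ε) (φ ε))
    (hcharge : ∀ ε > 0, ∀ u : ℝ, monopole (φ ε 1 u) = q)
    (horders : MultipoleOrders φ) :
    (∀ (U : Set ℂ) (ξ : ℝ → ℂ → Fin 4 → ℂ), IsSlowWorldLine U ξ →
      (∃ Λ, IsRealSlicing ξ Λ) ∧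
      (∀ Λ Λ', IsRealSlicing ξ Λ → IsRealSlicing ξ Λ' →
        ∀ A B : ℝ, ∀ᶠ ε in 𝓝[>] (0 : ℝ), ∀ s ∈ Set.Icc A B, ∀ ζ, Λ ε s ζ = Λ' ε s ζ) ∧
      ∀ Λ, IsRealSlicing ξ Λ →
        ((∀ k, IsOrder 2 Set.univ
            (fun ε (s : ℝ) => rotatedDipole (φ ε) (ξ ε) (Λ ε s) s k)) ↔
          ∀ k : Fin 3, IsOrder 2 Set.univ
            (fun ε (s : ℝ) => q * ξ ε s k.succ - q * bondiCenter q (φ ε) s k)) ∧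
        ((∀ k, IsOrder 3 Set.univ
            (fun ε (s : ℝ) => rotatedDipole (φ ε) (ξ ε) (Λ ε s) s k)) ↔
          ∀ k : Fin 3, IsOrder 3 Set.univ
            (fun ε (s : ℝ) => ξ ε s k.succ - secondOrderCenter q (φ ε) (ξ ε) s k))) ∧
    (∀ (U : Set ℂ) (ξ₀ : ℝ → ℂ → Fin 4 → ℂ) (η : ℝ → ℂ → Fin 3 → ℂ), IsSlowWorldLine U ξ₀ →
      (∀ ε > 0, ∀ i, DifferentiableOn ℂ (fun τ => η ε τ i) U) →
      (∀ i, IsOrder 1 U (fun ε τ => η ε τ i)) →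
      (∀ ε > 0, ∀ (s : ℝ) i, η ε s i = bondiCenter q (φ ε) s i) →
      ∃ (V : Set ℂ) (ξ : ℝ → ℂ → Fin 4 → ℂ), IsSlowWorldLine V ξ ∧
        (∀ ε > 0, ∀ s : ℝ, ξ ε s 0 = ξ₀ ε s 0) ∧
        ∀ Λ, IsRealSlicing ξ Λ → ∀ k, IsOrder 3 Set.univ
          (fun ε (s : ℝ) => rotatedDipole (φ ε) (ξ ε) (Λ ε s) s k)) := by
  refine ⟨fun U ξ h => ⟨h.exists_isRealSlicing, fun Λ Λ' hΛ hΛ' => h.slicing_unique hΛ hΛ',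
    fun Λ hΛ => ⟨forall_congr' (h.dipole_order_two_iff hq hF hcharge horders hΛ),
      h.dipole_order_three_iff hq hF hcharge horders hΛ⟩⟩, fun U ξ₀ η h hη ho he => ?_⟩
  have hslow := isSlowWorldLine_centerWorldLine h hη ho
  refine ⟨_, _, hslow, fun ε _ s => rfl, fun Λ hΛ => ?_⟩
  -- The third-order equation holds exactly on the real axis for ε > 0, so the error constant is 0.
  refine (hslow.dipole_order_three_iff hq hF hcharge horders hΛ).2 fun k K _ _ => ⟨0, ?_⟩
  filter_upwards [self_mem_nhdsWithin] with ε hε s _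
  rw [centerSpace_ofReal h.isOpen h.real_mem (hη ε hε) (he ε hε) s k, sub_self, norm_zero, zero_mul]
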